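/- Let $M$ be a smooth manifold (Hausdorff, second countable, without boundary, of dimension $n\ge 0$), and let $\mathcal M$ be an N2-manifold over $M$ with $r\ge 1$ local coordinates of degree $1$ and $s\ge 1$ local coordinates of degree $2$: a sheaf $\mathcal O=\bigoplus_{k\ge 0}\mathcal O^k$ of graded commutative real algebras on $M$ with $\mathcal O^0=C^\infty_M$ (gluing is understood degree by degree), which is locally isomorphic, as a sheaf of graded algebras, to $C^\infty\otimes\Lambda(\xi^1,\dots,\xi^r)\otimes\mathbb R[b^1,\dots,b^s]$ with $|\xi^a|=1$, $|b^D|=2$. For $k\in\mathbb Z$ let $\mathfrak X_k$ be the $C^\infty(M)$-module of vector fields of degree $k$, i.e. of graded derivations of degree $k$ of the sheaf $\mathcal O$; let $[X,Y]=XY-(-1)^{kl}YX$ be the graded commutator of $X\in\mathfrak X_k$ and $Y\in\mathfrak X_l$. Let $Q\in\mathfrak X_1$ satisfy $[Q,Q]=0$ (so that $(\mathcal M,Q)$ is a Q2-manifold), and put $d_Q=[Q,\cdot\,]$. Then the following hold. 1. $(\mathfrak X_\bullet,[\cdot,\cdot],d_Q)$ is a differential graded Lie algebra with bracket of degree $0$,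 and it is strongly anchored over $R=C^\infty(M)$ by $\rho_0(X)[f]=X(f)$ for $X\in\mathfrak X_0$, $f\in R$. That is: $[X,f\psi]=\rho_0(X)(f)\,\psi+f[X,\psi]$ for $X\in\mathfrak X_0$, $f\in R$, $\psi\in\mathfrak X_\bullet$; the map $\rho_0$ is $R$-linear; $\rho_0(d_Q(f\phi))=f\rho_0(d_Q\phi)$ for $\phi\in\mathfrak X_{-1}$; and $d_Q(fg\psi)+fg\,d_Q\psi=f\,d_Q(g\psi)+g\,d_Q(f\psi)$ for $f,g\in R$, $\psi\in\mathfrak X_\bullet$. 2. $[\psi,f\phi]=f[\psi,\phi]$ for all $\psi,\phi\in\mathfrak X_{-1}$ and $f\in C^\infty(M)$. 3. There are smooth vector bundles $W\to M$ and $V\to M$ of finite rank with $C^\infty(M)$-linear isomorphisms $\mathfrak X_{-1}\cong\Gamma(W)$ and $\mathfrak X_{-2}\cong\Gamma(V)$. Under these identifications, the formulas (for $\phi,\psi\in\mathfrak X_{-1}$, $v\in\mathfrak X_{-2}$, $f\in C^\infty(M)$) $$\rho(\psi)[f]=[Q,\psi](f),\quad [\phi,\psi]_W=[[Q,\phi],\psi],\quad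 \langle\psi,\phi\rangle=[\psi,\phi],\quad \mathrm D v=[Q,v],\quad \nabla_\psi v=[[\psi,Q],v]$$ define a smooth bundle map $\rho\colon W\to TM$, a bracket on $\Gamma(W)$, a smooth symmetric fibrewise bilinear product $\langle\cdot,\cdot\rangle\colon W\otimes W\to V$ that is non-degenerate (for every $0\neq\phi\in W_x$ there is $\psi\in W_x$ with $\langle\phi,\psi\rangle\ne0$) and surjective (as a map $W_x\otimes W_x\to V_x$ for every $x$), a linear map $\mathrm D\colon\Gamma(V)\to\Gamma(W)$ and a map $\nabla\colon\Gamma(W)\times\Gamma(V)\to\Gamma(V)$. 4. With $\rho_D=\nabla$ these data form a Vinogradov algebroid: for all $\psi,\phi,\phi_1,\phi_2\in\Gamma(W)$, $v\in\Gamma(V)$, $f,g\in C^\infty(M)$ one has $\nabla_\psi(fv)=\rho(\psi)[f]\,v+f\nabla_\psi v$, $[\psi,[\phi_1,\phi_2]_W]_W=[[\psi,\phi_1]_W,\phi_2]_W+[\phi_1,[\psi,\phi_2]_W]_W$, $[\psi,\psi]_W=\tfrac12\mathrm D\langle\psi,\psi\rangle$, $\nabla_\psi\langle\phi,\phi\rangle=2\langle[\psi,\phi]_W,\phi\rangle$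 and $\mathrm D(fgv)+fg\,\mathrm Dv=f\,\mathrm D(gv)+g\,\mathrm D(fv)$. 5. This Vinogradov algebroid is a $V$-twisted Courant algebroid: $\nabla$ is moreover $C^\infty(M)$-linear in $\psi$, hence a $W$-connection on $V$, one has $\langle[\psi,\phi]_W,\phi\rangle=\tfrac12\nabla_\psi\langle\phi,\phi\rangle=\langle\psi,[\phi,\phi]_W\rangle$ for all $\psi,\phi\in\Gamma(W)$, and $\langle\psi,\mathrm Dv\rangle=\nabla_\psi v$ for all $\psi\in\Gamma(W)$, $v\in\Gamma(V)$. -/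

import Mathlib

open scoped Manifold ContDiff TensorProduct Bundle
open TopologicalSpace

universe u v

noncomputable section

namespace QTwo

/-! ### Smooth functions on an `n`-dimensional manifold and on its open subsets -/

/-- The model with corners of `n`-dimensional manifolds without boundary. -/
abbrev mdl (n : ℕ) := 𝓘(ℝ, EuclideanSpace ℝ (Fin n))

section Smooth

variable (n : ℕ) (M : Type u) [TopologicalSpace M] [ChartedSpace (EuclideanSpace ℝ (Fin n)) M]

/-- The algebra `C^∞(M)` of smooth real functions. -/
abbrev SmoothFn := C^∞⟮mdl n, M; 𝓘(ℝ, ℝ), ℝ⟯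

variable {M}

/-- The algebra `C^∞(U)` of smooth real functions on an open subset `U` of `M`. -/
abbrev SmoothOn (U : Opens M) := C^∞⟮mdl n, U; 𝓘(ℝ, ℝ), ℝ⟯

/-- Restriction `C^∞(V) → C^∞(U)` for `U ⊆ V`. -/
def smoothRes {U V : Opens M} (h : U ≤ V) : SmoothOn n V →ₐ[ℝ] SmoothOn n U where
  toRingHom := ContMDiffMap.restrictRingHom (mdl n) 𝓘(ℝ, ℝ) ℝ h
  commutes' _ := rfl

/-- Restriction `C^∞(M) → C^∞(U)`. -/
def smoothToOpen (U : Opens M) : SmoothFn n M →ₐ[ℝ] SmoothOn n U where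
  toFun f := ⟨fun x => f x, f.contMDiff.comp contMDiff_subtype_val⟩
  map_one' := rfl
  map_mul' _ _ := rfl
  map_zero' := rfl
  map_add' _ _ := rfl
  commutes' _ := rfl

/-- A smooth function on the open subset `M` of `M`, seen as a smooth function on `M`. -/
def smoothOfTop (g : SmoothOn n (⊤ : Opens M)) : SmoothFn n M :=
  ⟨fun x => g ⟨x, trivial⟩, fun x => by
    have h := g.contMDiff (⟨x, trivial⟩ : (⊤ : Opens M))
    exact (contMDiffAt_subtype_iff (U := (⊤ : Opens M))
      (f := fun x : M => g ⟨x, trivial⟩) (x := ⟨x, trivial⟩)).1 h⟩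

/-- The identification `C^∞(M) ≃ C^∞(⊤)`. -/
def smoothTopEquiv : SmoothFn n M ≃ₗ[ℝ] SmoothOn n (⊤ : Opens M) where
  toLinearMap := (smoothToOpen n ⊤).toLinearMap
  invFun := smoothOfTop n
  left_inv _ := rfl
  right_inv _ := rfl

/-- The derivative of the function `f` along the tangent vector `w` at `x`. -/
def dirDeriv (f : SmoothFn n M) (x : M) (w : TangentSpace (mdl n) x) : ℝ :=
  mfderiv (mdl n) 𝓘(ℝ, ℝ) f x w

end Smooth

/-! ### N-manifolds of degree two -/

/-- The graded algebra `Λ(ξ¹,…,ξʳ) ⊗ ℝ[b¹,…,bˢ]` of polynomials in `r` odd coordinates `ξ` of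
degree one and `s` even coordinates `b` of degree two. -/
abbrev CoordAlg (r s : ℕ) := ExteriorAlgebra ℝ (Fin r → ℝ) ⊗[ℝ] MvPolynomial (Fin s) ℝ

/-- The elements of degree `k` of `C ⊗ Λ(ξ¹,…,ξʳ) ⊗ ℝ[b¹,…,bˢ]`, where the elements of `C` have
degree zero, every `ξ` has degree one and every `b` has degree two. -/
def modelDeg (C : Type*) [CommRing C] [Algebra ℝ C] (r s : ℕ) (k : ℤ) :
    Submodule ℝ (C ⊗[ℝ] CoordAlg r s) :=
  Submodule.span ℝ {t | ∃ (i j : ℕ) (c : C) (a : ExteriorAlgebra ℝ (Fin r → ℝ))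
    (p : MvPolynomial (Fin s) ℝ), (i : ℤ) + 2 * j = k ∧ a ∈ ⋀[ℝ]^i (Fin r → ℝ) ∧
    p.IsHomogeneous j ∧ t = c ⊗ₜ[ℝ] (a ⊗ₜ[ℝ] p)}

/-- An N2-manifold over the `n`-dimensional smooth manifold `M`, with `r` local coordinates of
degree one and `s` local coordinates of degree two: a sheaf of graded commutative algebras on `M`,
with `C^∞` as its degree zero part, which is locally isomorphic to
`C^∞ ⊗ Λ(ξ¹,…,ξʳ) ⊗ ℝ[b¹,…,bˢ]`. -/
structure N2Manifold (n r s : ℕ) (M : Type u) [TopologicalSpace M]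
    [ChartedSpace (EuclideanSpace ℝ (Fin n)) M] where
  /-- The algebra of functions on the restriction of the N-manifold to an open set. -/
  Fn : Opens M → Type v
  [ring : ∀ U, Ring (Fn U)]
  [algebra : ∀ U, Algebra ℝ (Fn U)]
  [smoothAlgebra : ∀ U, Algebra (SmoothOn n U) (Fn U)]
  [tower : ∀ U, IsScalarTower ℝ (SmoothOn n U) (Fn U)]
  /-- The functions of degree `k`. -/
  deg : ∀ U, ℤ → Submodule ℝ (Fn U)
  /-- The algebra is the direct sum of its homogeneous parts. -/
  [graded : ∀ U, GradedAlgebra (deg U)]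
  deg_neg : ∀ U k, k < 0 → deg U k = ⊥
  /-- Graded commutativity. -/
  graded_comm : ∀ U i j, ∀ f ∈ deg U i, ∀ g ∈ deg U j, f * g = (i * j).negOnePow • (g * f)
  /-- The functions of degree zero are the smooth functions. -/
  smooth_injective : ∀ U, Function.Injective (algebraMap (SmoothOn n U) (Fn U))
  mem_deg_zero : ∀ U f, f ∈ deg U 0 ↔ ∃ g, algebraMap (SmoothOn n U) (Fn U) g = f
  /-- Restriction maps. -/
  res : ∀ {U V : Opens M}, U ≤ V → Fn V →ₐ[ℝ] Fn U
  res_refl : ∀ U f, res (le_refl U) f = f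
  res_res : ∀ {U V W : Opens M} (h : U ≤ V) (h' : V ≤ W) (f : Fn W),
    res h (res h' f) = res (h.trans h') f
  res_deg : ∀ {U V : Opens M} (h : U ≤ V) (k : ℤ), ∀ f ∈ deg V k, res h f ∈ deg U k
  res_smooth : ∀ {U V : Opens M} (h : U ≤ V) (g : SmoothOn n V),
    res h (algebraMap (SmoothOn n V) (Fn V) g) =
      algebraMap (SmoothOn n U) (Fn U) (smoothRes n h g)
  /-- Sheaf condition, uniqueness: functions that agree on a covering are equal. -/
  separated : ∀ {ι : Type u} (V : Opens M) (U : ι → Opens M) (h : ∀ i, U i ≤ V), V ≤ iSup U →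
    ∀ f g : Fn V, (∀ i, res (h i) f = res (h i) g) → f = g
  /-- Sheaf condition, existence: compatible functions of the same degree on a covering can be
  glued. -/
  glue : ∀ {ι : Type u} (V : Opens M) (U : ι → Opens M) (h : ∀ i, U i ≤ V), V ≤ iSup U →
    ∀ (k : ℤ) (f : ∀ i, Fn (U i)), (∀ i, f i ∈ deg (U i) k) →
      (∀ i j, res (inf_le_left : U i ⊓ U j ≤ U i) (f i) =
        res (inf_le_right : U i ⊓ U j ≤ U j) (f j)) →
      ∃ g ∈ deg V k, ∀ i, res (h i) g = f i
  /-- Local coordinates: near each point there is an isomorphism of sheaves of graded algebras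
  with the local model. -/
  coords : ∀ x : M, ∃ U : Opens M, x ∈ U ∧
    ∃ e : ∀ V : Opens M, V ≤ U → (Fn V ≃ₐ[SmoothOn n V] SmoothOn n V ⊗[ℝ] CoordAlg r s),
      (∀ (V : Opens M) (hV : V ≤ U) (k : ℤ) (f : Fn V),
        f ∈ deg V k ↔ e V hV f ∈ modelDeg (SmoothOn n V) r s k) ∧
      (∀ (V V' : Opens M) (hV : V ≤ U) (h : V' ≤ V) (f : Fn V),
        e V' (h.trans hV) (res h f) =
          Algebra.TensorProduct.map (smoothRes n h) (AlgHom.id ℝ (CoordAlg r s)) (e V hV f))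

attribute [instance] N2Manifold.ring N2Manifold.algebra N2Manifold.smoothAlgebra
  N2Manifold.tower N2Manifold.graded

section VectorFields

variable {n r s : ℕ} {M : Type u} [TopologicalSpace M]
  [ChartedSpace (EuclideanSpace ℝ (Fin n)) M] (N : N2Manifold.{u, v} n r s M)

/-- Families of linear endomorphisms of the spaces of functions over all open sets, with
composition as multiplication. -/
abbrev Operators := ∀ U : Opens M, Module.End ℝ (N.Fn U)

/-- The vector fields of degree `k`: the graded derivations of degree `k` of the structure
sheaf. -/
def vectorFields (k : ℤ) : Submodule ℝ (Operators N) where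
  carrier := {X |
    (∀ (U V : Opens M) (h : U ≤ V) (f : N.Fn V), N.res h (X V f) = X U (N.res h f)) ∧
    (∀ (U : Opens M) (i : ℤ), ∀ f ∈ N.deg U i, X U f ∈ N.deg U (k + i)) ∧
    (∀ (U : Opens M) (i : ℤ), ∀ f ∈ N.deg U i, ∀ g : N.Fn U,
      X U (f * g) = X U f * g + (k * i).negOnePow • (f * X U g))}
  zero_mem' := by
    refine ⟨?_, ?_, ?_⟩ <;> intros <;> simp
  add_mem' := by
    rintro X Y ⟨hX1, hX2, hX3⟩ ⟨hY1, hY2, hY3⟩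
    refine ⟨fun U V h f => ?_, fun U i f hf => ?_, fun U i f hf g => ?_⟩
    · simp [hX1, hY1]
    · exact add_mem (hX2 U i f hf) (hY2 U i f hf)
    · simp only [Pi.add_apply, LinearMap.add_apply, hX3 U i f hf g, hY3 U i f hf g, add_mul,
        mul_add, smul_add]
      abel
  smul_mem' := by
    rintro c X ⟨hX1, hX2, hX3⟩
    refine ⟨fun U V h f => ?_, fun U i f hf => ?_, fun U i f hf g => ?_⟩
    · simp [hX1]
    · exact Submodule.smul_mem _ c (hX2 U i f hf)
    · simp only [Pi.smul_apply, LinearMap.smul_apply, hX3 U i f hf g, smul_add,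
        smul_mul_assoc, mul_smul_comm]
      rw [smul_comm c]

theorem negOnePow_smul_end {A : Type*} [AddCommGroup A] [Module ℝ A] (e : ℤˣ) (a : A) :
    e • a = ((e : ℤ) : ℝ) • a := by
  rw [Units.smul_def, Int.cast_smul_eq_zsmul]

theorem bracket_mem {k l m : ℤ} (h : k + l = m) {X Y : Operators N}
    (hX : X ∈ vectorFields N k) (hY : Y ∈ vectorFields N l) :
    X * Y - (k * l).negOnePow • (Y * X) ∈ vectorFields N m := by
  subst h
  obtain ⟨hX1, hX2, hX3⟩ := hX
  obtain ⟨hY1, hY2, hY3⟩ := hY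
  refine ⟨fun U V h f => ?_, fun U i f hf => ?_, fun U i f hf g => ?_⟩
  · simp [negOnePow_smul_end, hX1, hY1]
  · simp only [negOnePow_smul_end, Pi.sub_apply, Pi.smul_apply, Pi.mul_apply,
      LinearMap.sub_apply, LinearMap.smul_apply, Module.End.mul_apply]
    refine sub_mem ?_ (Submodule.smul_mem _ _ ?_)
    · rw [add_assoc]
      exact hX2 U _ _ (hY2 U i f hf)
    · rw [add_comm k l, add_assoc]
      exact hY2 U _ _ (hX2 U i f hf)
  · have h1 := hX3 U _ _ (hY2 U i f hf) g
    have h2 := hX3 U i f hf (Y U g)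
    have h3 := hY3 U _ _ (hX2 U i f hf) g
    have h4 := hY3 U i f hf (X U g)
    have sq : ∀ a : ℤ, (((a.negOnePow : ℤˣ) : ℤ) : ℝ) * (((a.negOnePow : ℤˣ) : ℤ) : ℝ) = 1 := by
      intro a
      rw [← Int.cast_mul, ← Units.val_mul, Int.units_mul_self]
      simp
    have hkl := sq (k * l)
    simp only [negOnePow_smul_end, Pi.sub_apply, Pi.smul_apply, Pi.mul_apply,
      LinearMap.sub_apply, LinearMap.smul_apply, Module.End.mul_apply, hX3 U i f hf g,
      hY3 U i f hf g, map_add, map_smul] at h1 h2 h3 h4 ⊢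
    rw [h1, h2, h3, h4]
    have e1 : (k * (l + i)).negOnePow = (k * l).negOnePow * (k * i).negOnePow := by
      rw [← Int.negOnePow_add, mul_add]
    have e2 : (l * (k + i)).negOnePow = (k * l).negOnePow * (l * i).negOnePow := by
      rw [← Int.negOnePow_add, mul_add, mul_comm l k]
    have e3 : ((k + l) * i).negOnePow = (k * i).negOnePow * (l * i).negOnePow := by
      rw [← Int.negOnePow_add, add_mul]
    rw [e1, e2, e3]
    simp only [Units.val_mul, Int.cast_mul, sub_mul, mul_sub, smul_mul_assoc, mul_smul_comm]
    generalize ((((k * l).negOnePow : ℤˣ) : ℤ) : ℝ) = p at *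
    generalize ((((k * i).negOnePow : ℤˣ) : ℤ) : ℝ) = q at *
    generalize ((((l * i).negOnePow : ℤˣ) : ℤ) : ℝ) = t at *
    match_scalars <;> try ring1
    · linear_combination (-t) * hkl

/-- The graded commutator `[X, Y] = XY - (-1)^{kl} YX` of vector fields of degrees `k` and `l`, as
a vector field of degree `m = k + l`. -/
def bracket {k l m : ℤ} (h : k + l = m) :
    vectorFields N k →ₗ[ℝ] vectorFields N l →ₗ[ℝ] vectorFields N m :=
  LinearMap.mk₂ ℝ (fun X Y => ⟨X.1 * Y.1 - (k * l).negOnePow • (Y.1 * X.1),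
      bracket_mem N h X.2 Y.2⟩)
    (fun X X' Y => by
      ext1; simp only [Submodule.coe_add, add_mul, mul_add, smul_add]; abel)
    (fun c X Y => by
      ext1
      simp only [Submodule.coe_smul, smul_mul_assoc, mul_smul_comm, smul_sub]
      rw [smul_comm c])
    (fun X Y Y' => by
      ext1; simp only [Submodule.coe_add, add_mul, mul_add, smul_add]; abel)
    (fun c X Y => by
      ext1
      simp only [Submodule.coe_smul, smul_mul_assoc, mul_smul_comm, smul_sub]
      rw [smul_comm c])

/-- The differential `d_Q = [Q, ·]` given by a vector field `Q` of degree one. -/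
def dQ (Q : vectorFields N 1) {k m : ℤ} (h : k + 1 = m) :
    vectorFields N k →ₗ[ℝ] vectorFields N m :=
  bracket N ((add_comm 1 k).trans h) Q

/-- The pairing of a smooth function on `M` with a vector field, `(f X)(g) = f · X(g)`. -/
def smulOp (f : SmoothFn n M) (X : Operators N) : Operators N := fun U =>
  { toFun := fun g => smoothToOpen n U f • X U g
    map_add' := by intros; simp
    map_smul' := by intro c g; simp only [map_smul, RingHom.id_apply]; rw [smul_comm] }

theorem smulOp_mem (f : SmoothFn n M) {k : ℤ} {X : Operators N} (hX : X ∈ vectorFields N k) :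
    smulOp N f X ∈ vectorFields N k := by
  obtain ⟨hX1, hX2, hX3⟩ := hX
  refine ⟨fun U V h g => ?_, fun U i g hg => ?_, fun U i g hg g' => ?_⟩
  · change N.res h (smoothToOpen n V f • X V g) = smoothToOpen n U f • X U (N.res h g)
    rw [Algebra.smul_def, Algebra.smul_def, map_mul, N.res_smooth, hX1]
    rfl
  · change smoothToOpen n U f • X U g ∈ _
    rw [Algebra.smul_def, ← zero_add (k + i)]
    exact SetLike.mul_mem_graded ((N.mem_deg_zero U _).2 ⟨_, rfl⟩) (hX2 U i g hg)
  · change smoothToOpen n U f • X U (g * g') = smoothToOpen n U f • X U g * g' +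
      (k * i).negOnePow • (g * smoothToOpen n U f • X U g')
    rw [hX3 U i g hg g', smul_add, smul_mul_assoc, mul_smul_comm, negOnePow_smul_end,
      negOnePow_smul_end, smul_comm]

/-- The vector fields of degree `k` form a module over `C^∞(M)`. -/
instance vectorFieldsModule (k : ℤ) : Module (SmoothFn n M) (vectorFields N k) where
  smul f X := ⟨smulOp N f X.1, smulOp_mem N f X.2⟩
  one_smul X := by
    refine Subtype.ext (funext fun U => LinearMap.ext fun g => ?_)
    change smoothToOpen n U 1 • X.1 U g = _
    rw [map_one, one_smul]
  mul_smul f f' X := by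
    refine Subtype.ext (funext fun U => LinearMap.ext fun g => ?_)
    change smoothToOpen n U (f * f') • X.1 U g =
      smoothToOpen n U f • (smoothToOpen n U f' • X.1 U g)
    rw [map_mul, mul_smul]
  smul_zero f := by
    refine Subtype.ext (funext fun U => LinearMap.ext fun g => ?_)
    change smoothToOpen n U f • (0 : N.Fn U) = 0
    rw [smul_zero]
  smul_add f X Y := by
    refine Subtype.ext (funext fun U => LinearMap.ext fun g => ?_)
    change smoothToOpen n U f • (X.1 U g + Y.1 U g) =
      smoothToOpen n U f • X.1 U g + smoothToOpen n U f • Y.1 U g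
    rw [smul_add]
  add_smul f f' X := by
    refine Subtype.ext (funext fun U => LinearMap.ext fun g => ?_)
    change smoothToOpen n U (f + f') • X.1 U g =
      smoothToOpen n U f • X.1 U g + smoothToOpen n U f' • X.1 U g
    rw [map_add, add_smul]
  zero_smul X := by
    refine Subtype.ext (funext fun U => LinearMap.ext fun g => ?_)
    change smoothToOpen n U 0 • X.1 U g = 0
    rw [map_zero, zero_smul]

/-- The identification of `C^∞(M)` with the global functions of degree zero. -/
def degZeroEquiv : SmoothFn n M ≃ₗ[ℝ] N.deg ⊤ 0 :=
  (smoothTopEquiv n).trans <| LinearEquiv.ofBijective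
    (LinearMap.codRestrict (N.deg ⊤ 0)
      (IsScalarTower.toAlgHom ℝ (SmoothOn n (⊤ : Opens M)) (N.Fn ⊤)).toLinearMap
      (fun g => (N.mem_deg_zero ⊤ _).2 ⟨g, rfl⟩))
    ⟨fun a b hab => N.smooth_injective ⊤ (congrArg Subtype.val hab), fun f => by
      obtain ⟨g, hg⟩ := (N.mem_deg_zero ⊤ f.1).1 f.2
      exact ⟨g, Subtype.ext hg⟩⟩

/-- The action `ρ₀(X)[f] = X(f)` of the vector fields `X` of degree zero on the functions of degree
zero. -/
def anchorZero {k : ℤ} (hk : k = 0) :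
    vectorFields N k →ₗ[ℝ] Module.End ℝ (SmoothFn n M) where
  toFun X := (degZeroEquiv N).symm.toLinearMap ∘ₗ
    ((X.1 ⊤).restrict (p := N.deg ⊤ 0) (q := N.deg ⊤ 0)
      (fun f hf => by simpa [hk] using X.2.2.1 ⊤ 0 f hf)) ∘ₗ (degZeroEquiv N).toLinearMap
  map_add' X Y := by
    ext1 f
    simp only [LinearMap.comp_apply, LinearMap.add_apply, LinearEquiv.coe_coe, ← map_add]
    rfl
  map_smul' c X := by
    ext1 f
    simp only [LinearMap.comp_apply, LinearMap.smul_apply, LinearEquiv.coe_coe, RingHom.id_apply]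
    rw [← map_smul (degZeroEquiv N).symm]
    rfl

end VectorFields

/-! ### Strongly anchored differential graded Lie algebras -/

/-- The graded module `A` over `R`, with a bracket of degree `d`, a differential `D` and a map
`ρ₀ : A^{-d} → End_ℝ(R)`, is a strongly anchored differential graded Lie algebra. -/
structure IsStronglyAnchoredDGLA {R : Type*} [CommRing R] [Algebra ℝ R] {A : ℤ → Type*}
    [∀ k, AddCommGroup (A k)] [∀ k, Module ℝ (A k)] [∀ k, Module R (A k)] (d : ℤ)
    (br : ∀ {k l m : ℤ}, k + l + d = m → A k →ₗ[ℝ] A l →ₗ[ℝ] A m)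
    (D : ∀ {k m : ℤ}, k + 1 = m → A k →ₗ[ℝ] A m)
    (ρ₀ : ∀ {k : ℤ}, k + d = 0 → A k →ₗ[ℝ] Module.End ℝ R) : Prop where
  /-- The bracket is graded antisymmetric. -/
  antisymm : ∀ {k l m : ℤ} (h : k + l + d = m) (h' : l + k + d = m) (a : A k) (b : A l),
    br h' b a = -(((k + d) * (l + d)).negOnePow • br h a b)
  /-- The graded Jacobi identity `[a,[b,c]] = [[a,b],c] + (-1)^{(|a|+d)(|b|+d)} [b,[a,c]]`. -/
  jacobi : ∀ {i j k ij jk ik m : ℤ} (hij : i + j + d = ij) (hjk : j + k + d = jk)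
    (hik : i + k + d = ik) (h₁ : i + jk + d = m) (h₂ : ij + k + d = m) (h₃ : j + ik + d = m)
    (a : A i) (b : A j) (c : A k),
    br h₁ a (br hjk b c) = br h₂ (br hij a b) c +
      ((i + d) * (j + d)).negOnePow • br h₃ b (br hik a c)
  /-- The differential squares to zero. -/
  sq_zero : ∀ {k l m : ℤ} (h : k + 1 = l) (h' : l + 1 = m) (a : A k), D h' (D h a) = 0
  /-- The differential is a graded derivation, `D[a,b] = [Da,b] + (-1)^{|a|+d} [a,Db]`. -/
  derivation : ∀ {k l m k' l' m' : ℤ} (h : k + l + d = m) (hm : m + 1 = m') (hk : k + 1 = k')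
    (hl : l + 1 = l') (h₁ : k' + l + d = m') (h₂ : k + l' + d = m') (a : A k) (b : A l),
    D hm (br h a b) = br h₁ (D hk a) b + (k + d).negOnePow • br h₂ a (D hl b)
  /-- The actions of `ℝ` and of `R` are compatible. -/
  scalar : ∀ {k : ℤ} (c : ℝ) (f : R) (a : A k), (c • f) • a = c • (f • a)
  /-- `[φ, fψ] = ρ₀(φ)(f) ψ + f [φ, ψ]`. -/
  leibniz : ∀ {k l : ℤ} (hk : k + d = 0) (h : k + l + d = l) (φ : A k) (f : R)
    (ψ : A l), br h φ (f • ψ) = ρ₀ hk φ f • ψ + f • br h φ ψ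
  /-- `ρ₀` is `R`-linear. -/
  anchor_linear : ∀ {k : ℤ} (hk : k + d = 0) (f g : R) (φ : A k),
    ρ₀ hk (f • φ) g = f * ρ₀ hk φ g
  /-- `ρ₀ ∘ D` is `R`-linear. -/
  anchor_diff_linear : ∀ {k l : ℤ} (hk : k + 1 = l) (hl : l + d = 0) (f g : R) (φ : A k),
    ρ₀ hl (D hk (f • φ)) g = f * ρ₀ hl (D hk φ) g
  /-- `D` is a first order differential operator. -/
  first_order : ∀ {k l : ℤ} (h : k + 1 = l) (f g : R) (ψ : A k),
    D h ((f * g) • ψ) + (f * g) • D h ψ = f • D h (g • ψ) + g • D h (f • ψ)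

/-! ### Vector bundles, Vinogradov algebroids and `V`-twisted Courant algebroids -/

/-- A smooth real vector bundle of finite rank over `M`. -/
structure SmoothVectorBundle (n : ℕ) (M : Type u) [TopologicalSpace M]
    [ChartedSpace (EuclideanSpace ℝ (Fin n)) M] where
  /-- The rank. -/
  rank : ℕ
  /-- The fibres. -/
  Fib : M → Type
  [fibAddCommGroup : ∀ x, AddCommGroup (Fib x)]
  [fibModule : ∀ x, Module ℝ (Fib x)]
  [fibTopology : ∀ x, TopologicalSpace (Fib x)]
  [totalTopology : TopologicalSpace (Bundle.TotalSpace (EuclideanSpace ℝ (Fin rank)) Fib)]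
  [fiberBundle : FiberBundle (EuclideanSpace ℝ (Fin rank)) Fib]
  [vectorBundle : VectorBundle ℝ (EuclideanSpace ℝ (Fin rank)) Fib]
  [smooth : ContMDiffVectorBundle ∞ (EuclideanSpace ℝ (Fin rank)) Fib (mdl n)]

attribute [instance] SmoothVectorBundle.fibAddCommGroup SmoothVectorBundle.fibModule
  SmoothVectorBundle.fibTopology SmoothVectorBundle.totalTopology SmoothVectorBundle.fiberBundle
  SmoothVectorBundle.vectorBundle SmoothVectorBundle.smooth

section Algebroids

variable {n : ℕ} {M : Type u} [TopologicalSpace M] [ChartedSpace (EuclideanSpace ℝ (Fin n)) M]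
  [IsManifold (mdl n) ∞ M]

/-- The smooth sections of a vector bundle. -/
abbrev Sec (W : SmoothVectorBundle n M) :=
  Cₛ^∞⟮mdl n; EuclideanSpace ℝ (Fin W.rank), W.Fib⟯

/-- The product `f s` of a smooth function and a smooth section. -/
def fsmul {W : SmoothVectorBundle n M} (f : SmoothFn n M) (s : Sec W) : Sec W :=
  ⟨fun x => f x • s x, f.contMDiff.smul_section s.contMDiff⟩

/-- A family of linear maps `ρ_x : W_x → T_xM` is a smooth bundle map `W → TM`, i.e. it maps smooth
sections to smooth vector fields. -/
def IsSmoothAnchor (W : SmoothVectorBundle n M)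
    (ρ : ∀ x : M, W.Fib x →ₗ[ℝ] TangentSpace (mdl n) x) : Prop :=
  ∀ s : Sec W, ContMDiff (mdl n) (mdl n).tangent ∞
    (fun x => (⟨x, ρ x (s x)⟩ : TangentBundle (mdl n) M))

/-- A family of bilinear maps `W_x × W_x → V_x` is a smooth, symmetric, non-degenerate and
surjective inner product `W ⊗ W → V`. -/
structure IsInnerProduct (W V : SmoothVectorBundle n M)
    (pair : ∀ x : M, W.Fib x →ₗ[ℝ] W.Fib x →ₗ[ℝ] V.Fib x) : Prop where
  smooth : ∀ s t : Sec W, ∃ w : Sec V, ∀ x, w x = pair x (s x) (t x)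
  symm : ∀ x φ ψ, pair x φ ψ = pair x ψ φ
  nondegenerate : ∀ x φ, φ ≠ 0 → ∃ ψ, pair x φ ψ ≠ 0
  surjective : ∀ x, Function.Surjective (TensorProduct.lift (pair x))

/-- The induced pairing of smooth sections. -/
def secPair {W V : SmoothVectorBundle n M}
    {pair : ∀ x : M, W.Fib x →ₗ[ℝ] W.Fib x →ₗ[ℝ] V.Fib x} (h : IsInnerProduct W V pair)
    (s t : Sec W) : Sec V :=
  ⟨fun x => pair x (s x) (t x), by
    obtain ⟨w, hw⟩ := h.smooth s t
    simp only [← hw]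
    exact w.contMDiff⟩

/-- A Vinogradov algebroid: vector bundles `W` and `V`, an anchor `ρ : W → TM`, a bracket on the
sections of `W`, an inner product on `W` with values in `V`, a linear map `D : Γ(V) → Γ(W)`, and a
map `ρD` from `Γ(W)` to the covariant differential operators on `V` that covers `ρ`. -/
structure IsVinogradovAlgebroid (W V : SmoothVectorBundle n M)
    (ρ : ∀ x : M, W.Fib x →ₗ[ℝ] TangentSpace (mdl n) x)
    (br : Sec W →ₗ[ℝ] Sec W →ₗ[ℝ] Sec W)
    (pair : ∀ x : M, W.Fib x →ₗ[ℝ] W.Fib x →ₗ[ℝ] V.Fib x)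
    (D : Sec V →ₗ[ℝ] Sec W) (ρD : Sec W →ₗ[ℝ] Sec V →ₗ[ℝ] Sec V) : Prop where
  anchor : IsSmoothAnchor W ρ
  inner : IsInnerProduct W V pair
  covers : ∀ (φ : Sec W) (f : SmoothFn n M) (v : Sec V) (x : M),
    ρD φ (fsmul f v) x = dirDeriv n f x (ρ x (φ x)) • v x + f x • ρD φ v x
  jacobi : ∀ ψ φ₁ φ₂, br ψ (br φ₁ φ₂) = br (br ψ φ₁) φ₂ + br φ₁ (br ψ φ₂)
  symmetric_part : ∀ ψ, br ψ ψ = (1 / 2 : ℝ) • D (secPair inner ψ ψ)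
  invariant : ∀ ψ φ, ρD ψ (secPair inner φ φ) = (2 : ℝ) • secPair inner (br ψ φ) φ
  first_order : ∀ (f g : SmoothFn n M) (v : Sec V),
    D (fsmul (f * g) v) + fsmul (f * g) (D v) = fsmul f (D (fsmul g v)) + fsmul g (D (fsmul f v))

/-- A `V`-twisted Courant algebroid: vector bundles `W` and `V`, an anchor `ρ : W → TM`, a bracket
on the sections of `W`, an inner product on `W` with values in `V`, and a `W`-connection `conn` on
`V`. -/
structure IsVTwistedCourantAlgebroid (W V : SmoothVectorBundle n M)
    (ρ : ∀ x : M, W.Fib x →ₗ[ℝ] TangentSpace (mdl n) x)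
    (br : Sec W →ₗ[ℝ] Sec W →ₗ[ℝ] Sec W)
    (pair : ∀ x : M, W.Fib x →ₗ[ℝ] W.Fib x →ₗ[ℝ] V.Fib x)
    (conn : Sec W →ₗ[ℝ] Sec V →ₗ[ℝ] Sec V) : Prop where
  anchor : IsSmoothAnchor W ρ
  inner : IsInnerProduct W V pair
  /-- The connection is `C^∞(M)`-linear in the section of `W`. -/
  conn_linear : ∀ (f : SmoothFn n M) (ψ : Sec W) (v : Sec V),
    conn (fsmul f ψ) v = fsmul f (conn ψ v)
  /-- The connection satisfies the Leibniz rule. -/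
  conn_leibniz : ∀ (ψ : Sec W) (f : SmoothFn n M) (v : Sec V) (x : M),
    conn ψ (fsmul f v) x = dirDeriv n f x (ρ x (ψ x)) • v x + f x • conn ψ v x
  jacobi : ∀ ψ φ₁ φ₂, br ψ (br φ₁ φ₂) = br (br ψ φ₁) φ₂ + br φ₁ (br ψ φ₂)
  invariant_left : ∀ ψ φ,
    secPair inner (br ψ φ) φ = (1 / 2 : ℝ) • conn ψ (secPair inner φ φ)
  invariant_right : ∀ ψ φ,
    secPair inner ψ (br φ φ) = (1 / 2 : ℝ) • conn ψ (secPair inner φ φ)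

end Algebroids

end QTwo

end

noncomputable section

namespace QTwo

/-! ### Hadamard's lemma -/

section Hadamard

variable {E G : Type u} [NormedAddCommGroup E] [NormedSpace ℝ E] [FiniteDimensional ℝ E]
  [NormedAddCommGroup G] [NormedSpace ℝ G]

/-! The algebra rests on two facts. Graded commutators satisfy antisymmetry and the graded Jacobi
identity, and `[Q,Q] = 2Q²`, so `Q² = 0` and `d_Q² = 0`. The Leibniz rule gives `d_Q(fX) = Q(f)X + f
d_Q X` (`dQ_smul`). The defect of linearity `Q(f)X` is a derivation in `f`, which is the first order
property, and `Q(f)X` kills smooth functions when `X` has negative degree, which makes `ρ₀ ∘ d_Q`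
linear in degree `-1`.

The geometry comes from degree counting. A field of negative degree kills smooth functions, so it is
`C^∞`-linear and determined by its values on the coordinates. In degree `-1`, `X(ξᵃ)` is a smooth
function and `X(b^D)` is linear in the `ξᵃ`, so `∂/∂ξᵃ` and `ξᵃ∂/∂b^D` form a local frame of rank `r
+ rs`. In degree `-2` only `∂/∂b^D` remain, of rank `s`. Below degree `-2` there is nothing
(`vectorFields_eq_zero`). Fields glue because functions do, so in degrees `-1` and `-2` they form
locally free sheaves, and the transition matrices build `W` and `V`.

In these frames the pairing is `⟨u,w⟩^D = ∑ₐ (uᵃ w^{aD} + wᵃ u^{aD})`. It is non-degenerate because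
`s ≥ 1` and surjective because `r ≥ 1`. For the anchor, `[Q,ψ](f) = ψ(Qf) = ∑ₐ ψᵃ ∂(Qf)/∂ξᵃ`. Each
`f ↦ ∂(Qf)/∂ξᵃ` is a derivation of germs of smooth functions, hence a tangent vector by Hadamard's
lemma, and the formula involves only the value of `ψ` at the point.

The algebroid axioms are derived bracket computations, all instances of Jacobi with `Q` or `[Q,ψ]`
among the entries. The absence of degree `-3` is what makes the structure a twisted Courant
algebroid: `[ψ,v] = 0` for `v` of degree `-2`, so `[ψ,[Q,v]] = [[ψ,Q],v]` (`pairing_diffTwo`), which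
gives the adjointness of `D` and `∇`, the linearity of `∇` in `ψ` and the second invariance
identity. -/

theorem hasFDerivAt_parametric_integral {F : E × ℝ → G} (hF : ContDiff ℝ ∞ F) (x : E) :
    HasFDerivAt (fun x => ∫ t in (0 : ℝ)..1, F (x, t))
      (∫ t in (0 : ℝ)..1, (fderiv ℝ F (x, t)).comp (ContinuousLinearMap.inl ℝ E ℝ)) x := by
  have hdc : Continuous fun z : E × ℝ =>
      (fderiv ℝ F z).comp (ContinuousLinearMap.inl ℝ E ℝ) :=
    (hF.continuous_fderiv (by simp)).clm_comp continuous_const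
  -- The partial derivative is bounded on the compact product of a ball with the interval of
  -- integration; this constant dominates the integrand.
  obtain ⟨B, hB⟩ := ((isCompact_closedBall x 1).prod (isCompact_Icc (a := (0 : ℝ)) (b := 1))
    ).exists_bound_of_continuousOn hdc.continuousOn
  refine intervalIntegral.hasFDerivAt_integral_of_dominated_of_fderiv_le (bound := fun _ => B)
    (F' := fun x t => (fderiv ℝ F (x, t)).comp (ContinuousLinearMap.inl ℝ E ℝ))
    (Metric.closedBall_mem_nhds x one_pos) ?_ ?_ ?_ ?_ ?_ ?_
  · exact Filter.Eventually.of_forall fun y =>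
      (hF.continuous.comp (by fun_prop : Continuous fun t : ℝ => (y, t))).aestronglyMeasurable
  · exact (hF.continuous.comp (by fun_prop : Continuous fun t : ℝ => (x, t))).intervalIntegrable
      _ _
  · exact (hdc.comp (by fun_prop : Continuous fun t : ℝ => (x, t))).aestronglyMeasurable
  · refine Filter.Eventually.of_forall fun t ht y hy => hB (y, t) ⟨hy, ?_⟩
    rw [Set.uIoc_of_le zero_le_one] at ht
    exact ⟨ht.1.le, ht.2⟩
  · exact intervalIntegrable_const
  · refine Filter.Eventually.of_forall fun t _ y _ => ?_
    have h1 : HasFDerivAt F (fderiv ℝ F (y, t)) (y, t) :=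
      (hF.differentiable (by simp) _).hasFDerivAt
    have h2 : HasFDerivAt (fun y : E => (y, t)) (ContinuousLinearMap.inl ℝ E ℝ) y := by
      exact (hasFDerivAt_id y).prodMk (hasFDerivAt_const t y)
    exact h1.comp y h2

omit [FiniteDimensional ℝ E] in
theorem contDiff_fderiv_comp_inl {F : E × ℝ → G} (hF : ContDiff ℝ ∞ F) :
    ContDiff ℝ ∞ fun z : E × ℝ => (fderiv ℝ F z).comp (ContinuousLinearMap.inl ℝ E ℝ) :=
  (hF.fderiv_right (by simp)).clm_comp contDiff_const

end Hadamard

/-- The derivative of the integral is the integral of the partial derivative, which is again a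
smooth integrand, now with values in `E →L[ℝ] G`. Hence `G` is quantified inside the induction, and
`E` and `G` share a universe so that `E →L[ℝ] G` stays in it. -/
theorem contDiff_parametric_integral_nat {E : Type u} [NormedAddCommGroup E] [NormedSpace ℝ E]
    [FiniteDimensional ℝ E] (k : ℕ) :
    ∀ {G : Type u} [NormedAddCommGroup G] [NormedSpace ℝ G] {F : E × ℝ → G},
      ContDiff ℝ ∞ F → ContDiff ℝ k fun x => ∫ t in (0 : ℝ)..1, F (x, t) := by
  induction k with
  | zero =>
    intro G _ _ F hF
    have : Differentiable ℝ fun x => ∫ t in (0 : ℝ)..1, F (x, t) :=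
      fun x => (hasFDerivAt_parametric_integral hF x).differentiableAt
    exact_mod_cast contDiff_zero.2 this.continuous
  | succ k ih =>
    intro G _ _ F hF
    push_cast
    rw [contDiff_succ_iff_hasFDerivAt]
    · exact ⟨_, ih (contDiff_fderiv_comp_inl hF), hasFDerivAt_parametric_integral hF⟩

theorem contDiff_parametric_integral {E G : Type u} [NormedAddCommGroup E] [NormedSpace ℝ E]
    [FiniteDimensional ℝ E] [NormedAddCommGroup G] [NormedSpace ℝ G] {F : E × ℝ → G}
    (hF : ContDiff ℝ ∞ F) : ContDiff ℝ ∞ fun x => ∫ t in (0 : ℝ)..1, F (x, t) :=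
  contDiff_infty.2 fun k => contDiff_parametric_integral_nat k hF

/-- Hadamard's lemma. -/
theorem exists_hadamard {E : Type} [NormedAddCommGroup E] [NormedSpace ℝ E]
    [FiniteDimensional ℝ E] {f : E → ℝ} (hf : ContDiff ℝ ∞ f) (p : E) :
    ∃ g : E → (E →L[ℝ] ℝ), ContDiff ℝ ∞ g ∧ g p = fderiv ℝ f p ∧
      ∀ y, f y = f p + g y (y - p) := by
  have hs : ContDiff ℝ ∞ fun z : E × ℝ => fderiv ℝ f (p + z.2 • (z.1 - p)) :=
    (hf.fderiv_right (m := ∞) (by simp)).comp (by fun_prop)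
  -- The average of the derivative along the segment from `p` to `y`; the identity is the
  -- fundamental theorem of calculus on that segment.
  refine ⟨fun y => ∫ t in (0 : ℝ)..1, fderiv ℝ f (p + t • (y - p)),
    contDiff_parametric_integral (F := fun z : E × ℝ => fderiv ℝ f (p + z.2 • (z.1 - p))) hs,
    by simp, fun y => ?_⟩
  have hc : Continuous fun t : ℝ => fderiv ℝ f (p + t • (y - p)) :=
    hs.continuous.comp (by fun_prop : Continuous fun t : ℝ => (y, t))
  have hd : ∀ t ∈ Set.uIcc (0 : ℝ) 1, HasDerivAt (fun t : ℝ => f (p + t • (y - p)))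
      (fderiv ℝ f (p + t • (y - p)) (y - p)) t := fun t _ => by
    have h1 : HasDerivAt (fun t : ℝ => p + t • (y - p)) (y - p) t := by
      simpa using ((hasDerivAt_id t).smul_const (y - p)).const_add p
    exact (hf.differentiable (by simp) _).hasFDerivAt.comp_hasDerivAt t h1
  have h := intervalIntegral.integral_eq_sub_of_hasDerivAt hd
    ((hc.clm_apply continuous_const).intervalIntegrable _ _)
  rw [← ContinuousLinearMap.intervalIntegral_apply (hc.intervalIntegrable _ _)] at h
  simp only [one_smul, zero_smul, add_zero, add_sub_cancel] at h
  rw [h]; ring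

/-- A function that is smooth near `p` agrees near `p` with a smooth function. -/
theorem exists_contDiff_eventuallyEq {E : Type} [NormedAddCommGroup E] [NormedSpace ℝ E]
    [FiniteDimensional ℝ E] {f : E → ℝ} {s : Set E} (hs : IsOpen s) (hf : ContDiffOn ℝ ∞ f s)
    {p : E} (hp : p ∈ s) : ∃ g : E → ℝ, ContDiff ℝ ∞ g ∧ g =ᶠ[nhds p] f := by
  obtain ⟨ε, hε, hb⟩ := Metric.isOpen_iff.1 hs p hp
  -- The bump is one near `p` and its support lies in the closed ball of radius `ε / 2`, well inside
  -- `s`, so the product extends smoothly by zero.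
  let χ : ContDiffBump p := ⟨ε / 4, ε / 2, by positivity, by linarith⟩
  refine ⟨fun x => χ x * f x, contDiff_iff_contDiffAt.2 fun x => ?_, ?_⟩
  · by_cases hx : x ∈ s
    · exact χ.contDiff.contDiffAt.mul (hf.contDiffAt (hs.mem_nhds hx))
    · have hx' : x ∈ (tsupport χ)ᶜ := by
        rw [χ.tsupport_eq]
        intro h
        apply hx
        apply hb
        have h2 : dist x p ≤ ε / 2 := h
        rw [Metric.mem_ball]
        linarith
      have h0 : (fun x => χ x * f x) =ᶠ[nhds x] fun _ => 0 := by
        filter_upwards [(isClosed_tsupport χ).isOpen_compl.mem_nhds hx'] with y hy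
        rw [image_eq_zero_of_notMem_tsupport hy, zero_mul]
      exact contDiffAt_const.congr_of_eventuallyEq h0
  · filter_upwards [χ.eventuallyEq_one] with y hy
    simp [hy]

/-! ### Functions on open subsets and derivations of germs -/

section Germs

variable {n : ℕ} {M : Type u} [TopologicalSpace M] [ChartedSpace (EuclideanSpace ℝ (Fin n)) M]

/-- The restriction to `U` of a function that is smooth on `U`. -/
def toSmoothOn (U : Opens M) (F : M → ℝ) (hF : ContMDiffOn (mdl n) 𝓘(ℝ, ℝ) ∞ F U) :
    SmoothOn n U :=
  ⟨fun x => F x, fun x => contMDiffAt_subtype_iff.2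
    ((hF x x.2).contMDiffAt (U.isOpen.mem_nhds x.2))⟩

open Classical in
/-- The extension by zero of a function on `U`. -/
def zeroExt {U : Opens M} (f : SmoothOn n U) (x : M) : ℝ := if h : x ∈ U then f ⟨x, h⟩ else 0

theorem zeroExt_of_mem {U : Opens M} (f : SmoothOn n U) {x : M} (h : x ∈ U) :
    zeroExt f x = f ⟨x, h⟩ := dif_pos h

theorem contMDiffOn_of_eq {U : Opens M} (f : SmoothOn n U) {F : M → ℝ}
    (hF : ∀ x (hx : x ∈ U), F x = f ⟨x, hx⟩) : ContMDiffOn (mdl n) 𝓘(ℝ, ℝ) ∞ F U := by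
  intro x hx
  have h := f.contMDiff ⟨x, hx⟩
  have e : (f : U → ℝ) = fun y : U => F y := funext fun y => (hF y y.2).symm
  rw [e] at h
  exact (contMDiffAt_subtype_iff.1 h).contMDiffWithinAt

theorem contMDiffOn_zeroExt {U : Opens M} (f : SmoothOn n U) :
    ContMDiffOn (mdl n) 𝓘(ℝ, ℝ) ∞ (zeroExt f) U :=
  contMDiffOn_of_eq f fun _ hx => zeroExt_of_mem f hx

theorem contMDiffAt_euclidean_of_coord {m : ℕ} {f : M → EuclideanSpace ℝ (Fin m)} {x : M}
    (h : ∀ i, ContMDiffAt (mdl n) 𝓘(ℝ, ℝ) ∞ (fun y => f y i) x) :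
    ContMDiffAt (mdl n) 𝓘(ℝ, EuclideanSpace ℝ (Fin m)) ∞ f x := by
  have h1 : ContMDiffAt (mdl n) 𝓘(ℝ, Fin m → ℝ) ∞ (fun y i => f y i) x :=
    contMDiffAt_pi_space.2 h
  exact (EuclideanSpace.equiv (Fin m) ℝ).symm.contDiff.contMDiff.contMDiffAt.comp x h1

theorem smoothRes_apply {U V : Opens M} (h : U ≤ V) (f : SmoothOn n V) (x : U) :
    smoothRes n h f x = f ⟨x, h x.2⟩ := rfl

/-- The domain of the preferred chart at `p`. -/
def chartDomain (n : ℕ) {M : Type u} [TopologicalSpace M]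
    [ChartedSpace (EuclideanSpace ℝ (Fin n)) M] (p : M) : Opens M :=
  ⟨(chartAt (EuclideanSpace ℝ (Fin n)) p).source, (chartAt _ p).open_source⟩

theorem mem_chartDomain (p : M) : p ∈ chartDomain n p := mem_chart_source _ p

theorem mfderiv_eq_fderiv {p : M} {F : M → ℝ} (hF : ContMDiffAt (mdl n) 𝓘(ℝ, ℝ) ∞ F p)
    (w : TangentSpace (mdl n) p) :
    mfderiv (mdl n) 𝓘(ℝ, ℝ) F p w =
      fderiv ℝ (F ∘ (chartAt (EuclideanSpace ℝ (Fin n)) p).symm)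
        (chartAt (EuclideanSpace ℝ (Fin n)) p p) w := by
  have h := hF.mdifferentiableAt (by simp)
  rw [h.mfderiv]
  simp only [mfld_simps, fderivWithin_univ, writtenInExtChartAt]
  rfl

/-- A derivation at `p` of the algebra of germs at `p` of smooth functions. -/
structure GermDerivation (n : ℕ) {M : Type u} [TopologicalSpace M]
    [ChartedSpace (EuclideanSpace ℝ (Fin n)) M] (p : M) where
  /-- The value on smooth functions defined on a neighbourhood of `p`. -/
  toFun : ∀ V : Opens M, p ∈ V → SmoothOn n V →ₗ[ℝ] ℝ
  map_res : ∀ {U V : Opens M} (h : U ≤ V) (hp : p ∈ U) (f : SmoothOn n V),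
    toFun U hp (smoothRes n h f) = toFun V (h hp) f
  map_mul : ∀ (V : Opens M) (hp : p ∈ V) (f g : SmoothOn n V),
    toFun V hp (f * g) = toFun V hp f * g ⟨p, hp⟩ + f ⟨p, hp⟩ * toFun V hp g

namespace GermDerivation

variable {p : M} (δ : GermDerivation n p)

theorem map_one (V : Opens M) (hp : p ∈ V) : δ.toFun V hp 1 = 0 := by
  have h := δ.map_mul V hp 1 1
  have e : (1 : SmoothOn n V) ⟨p, hp⟩ = 1 := rfl
  rw [mul_one, e] at h
  linarith

theorem map_const (V : Opens M) (hp : p ∈ V) (c : ℝ) :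
    δ.toFun V hp (algebraMap ℝ (SmoothOn n V) c) = 0 := by
  rw [Algebra.algebraMap_eq_smul_one, map_smul, map_one, smul_zero]

variable [IsManifold (mdl n) ∞ M]

theorem contMDiffOn_chart_coord (p : M) (i : Fin n) :
    ContMDiffOn (mdl n) 𝓘(ℝ, ℝ) ∞
      (fun x => chartAt (EuclideanSpace ℝ (Fin n)) p x i) (chartDomain n p) := by
  have h : ContMDiffOn (mdl n) (mdl n) ∞ (chartAt (EuclideanSpace ℝ (Fin n)) p)
      (chartDomain n p) := contMDiffOn_chart
  exact (EuclideanSpace.proj (𝕜 := ℝ) i).contMDiff.comp_contMDiffOn h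

/-- The `i`-th coordinate of the preferred chart at `p`. -/
def chartCoord (p : M) (i : Fin n) : SmoothOn n (chartDomain n p) :=
  toSmoothOn _ (fun x => chartAt (EuclideanSpace ℝ (Fin n)) p x i) (contMDiffOn_chart_coord p i)

/-- The tangent vector given by a derivation of germs. -/
def toTangent : TangentSpace (mdl n) p :=
  (WithLp.toLp 2 fun i => δ.toFun _ (mem_chartDomain p) (chartCoord p i) :
    EuclideanSpace ℝ (Fin n))

/-- A derivation of germs is the derivative along the associated tangent vector. -/
theorem mfderiv_toTangent {V : Opens M} (hp : p ∈ V) (f : SmoothOn n V) {F : M → ℝ}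
    (hF : ∀ x (hx : x ∈ V), F x = f ⟨x, hx⟩) :
    mfderiv (mdl n) 𝓘(ℝ, ℝ) F p δ.toTangent = δ.toFun V hp f := by
  have hFs := contMDiffOn_of_eq f hF
  rw [mfderiv_eq_fderiv ((hFs p hp).contMDiffAt (V.isOpen.mem_nhds hp))]
  set φ := chartAt (EuclideanSpace ℝ (Fin n)) p with hφ
  have hpφ : p ∈ φ.source := mem_chart_source _ p
  let s : Set (EuclideanSpace ℝ (Fin n)) := φ.target ∩ φ.symm ⁻¹' V
  have hs : IsOpen s := φ.isOpen_inter_preimage_symm V.isOpen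
  have hps : φ p ∈ s := ⟨φ.map_source hpφ, by
    simp only [Set.mem_preimage, φ.left_inv hpφ]; exact hp⟩
  have hsm : ContDiffOn ℝ ∞ (F ∘ φ.symm) s := by
    rw [← contMDiffOn_iff_contDiffOn]
    exact hFs.comp ((contMDiffOn_chart_symm (I := mdl n) (n := ∞) (x := p)).mono
      Set.inter_subset_left) fun y hy => hy.2
  -- The chart expression of `F` is smooth only on `s`. Only its germ matters, so it is replaced by
  -- a globally smooth `h`, to which Hadamard's lemma on the whole vector space applies.
  obtain ⟨h, hh, he⟩ := exists_contDiff_eventuallyEq hs hsm hps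
  obtain ⟨g, hg, hgp, hgt⟩ := exists_hadamard hh (φ p)
  obtain ⟨t, hte, hto, hpt⟩ := eventually_nhds_iff.1 he
  -- On `W` the chart and `f` are defined and `h` represents `f`, so Hadamard's expansion becomes an
  -- identity `key` between smooth functions on `W`.
  let W : Opens M := ⟨φ.source ∩ φ ⁻¹' t, φ.isOpen_inter_preimage hto⟩ ⊓ V
  have hpW : p ∈ W := ⟨⟨hpφ, hpt⟩, hp⟩
  have hWc : W ≤ chartDomain n p := fun x hx => hx.1.1
  have hgsm : ∀ i : Fin n, ContMDiffOn (mdl n) 𝓘(ℝ, ℝ) ∞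
      (fun x => g (φ x) (EuclideanSpace.single i 1)) W := fun i => by
    have h1 : ContMDiffOn (mdl n) (mdl n) ∞ φ W := (contMDiffOn_chart (I := mdl n)
      (n := ∞) (x := p)).mono hWc
    have h2 : ContDiff ℝ ∞ fun y => g y (EuclideanSpace.single i 1) :=
      hg.clm_apply contDiff_const
    exact h2.contMDiff.comp_contMDiffOn h1
  let G : Fin n → SmoothOn n W := fun i => toSmoothOn W _ (hgsm i)
  let Φ : Fin n → SmoothOn n W := fun i => smoothRes n hWc (chartCoord p i)
  have key : smoothRes n inf_le_right f = algebraMap ℝ (SmoothOn n W) (F p) +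
      ∑ i, G i * (Φ i - algebraMap ℝ (SmoothOn n W) (φ p i)) := by
    ext x
    have hx : φ x ∈ t := x.2.1.2
    have h1 := hte _ hx
    rw [hgt, Function.comp_apply, φ.left_inv x.2.1.1] at h1
    have h0 := hte _ hpt
    rw [Function.comp_apply, φ.left_inv hpφ] at h0
    rw [smoothRes_apply, ← hF x x.2.2, ← h1, h0]
    have h3 : φ x - φ p = ∑ i, (φ x i - φ p i) • EuclideanSpace.single i (1 : ℝ) := by
      ext j
      simp [Pi.single_apply]
    have h4 : (algebraMap ℝ (SmoothOn n W) (F p) +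
        ∑ i, G i * (Φ i - algebraMap ℝ (SmoothOn n W) (φ p i))) x =
        F p + ∑ i, (G i * (Φ i - algebraMap ℝ (SmoothOn n W) (φ p i))) x := by
      change F p + (ContMDiffMap.evalRingHom x) (∑ i, _) = _
      rw [map_sum]
      rfl
    rw [h4, h3, map_sum]
    congr 1
    refine Finset.sum_congr rfl fun i _ => ?_
    rw [map_smul, smul_eq_mul, mul_comm]
    rfl
  -- The derivation kills constants, and each factor `Φ i - φ p i` vanishes at `p`, so by the
  -- product rule only `G i (p) · δ(Φ i)` survives, and `G i (p)` is the `i`-th partial derivative.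
  rw [← δ.map_res (inf_le_right : W ≤ V) hpW, key, map_add, δ.map_const, zero_add, map_sum]
  rw [← he.fderiv_eq, ← hgp]
  have h5 : δ.toTangent = ∑ i, (δ.toFun _ (mem_chartDomain p) (chartCoord p i)) •
      EuclideanSpace.single i (1 : ℝ) := by
    apply PiLp.ext
    intro j
    have : (∑ i, (δ.toFun _ (mem_chartDomain p) (chartCoord p i)) •
      EuclideanSpace.single i (1 : ℝ)) j = δ.toFun _ (mem_chartDomain p) (chartCoord p j) := by
      simp [Pi.single_apply]
    rw [this]
    rfl
  rw [h5]
  have h6 := map_sum (g (φ p)) (fun i => (δ.toFun _ (mem_chartDomain p) (chartCoord p i)) •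
      EuclideanSpace.single i (1 : ℝ)) Finset.univ
  refine h6.trans (Finset.sum_congr rfl fun i _ => ?_)
  rw [δ.map_mul, map_sub, δ.map_const, sub_zero, map_smul, smul_eq_mul, δ.map_res hWc hpW]
  have h7 : (Φ i - algebraMap ℝ (SmoothOn n W) (φ p i)) ⟨p, hpW⟩ = 0 := sub_self _
  rw [h7, mul_zero, zero_add, mul_comm]
  rfl

theorem dirDeriv_toTangent (f : SmoothFn n M) {V : Opens M} (hp : p ∈ V) :
    dirDeriv n f p δ.toTangent = δ.toFun V hp (smoothToOpen n V f) :=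
  δ.mfderiv_toTangent hp _ fun _ _ => rfl

/-- In the trivialization at `x₀`, the `i`-th component of the vector at `x` is its derivative of
the `i`-th chart coordinate at `x₀`, that is `δ x` applied to this coordinate. The hypothesis makes
that smooth in `x`. -/
theorem contMDiff_toTangent (δ : ∀ p : M, GermDerivation n p)
    (h : ∀ (V : Opens M) (f : SmoothOn n V), ∃ g : SmoothOn n V,
      ∀ p (hp : p ∈ V), g ⟨p, hp⟩ = (δ p).toFun V hp f) :
    ContMDiff (mdl n) (mdl n).tangent ∞
      (fun p => (⟨p, (δ p).toTangent⟩ : TangentBundle (mdl n) M)) := by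
  intro x₀
  refine (Bundle.contMDiffAt_section (IB := mdl n) (F := EuclideanSpace ℝ (Fin n))
    (E := (TangentSpace (mdl n) : M → Type _)) (s := fun p => (δ p).toTangent) x₀).2 ?_
  refine contMDiffAt_euclidean_of_coord fun i => ?_
  obtain ⟨g, hg⟩ := h _ (chartCoord x₀ i)
  have hx₀ : x₀ ∈ chartDomain n x₀ := mem_chartDomain x₀
  refine ((contMDiffOn_zeroExt g).contMDiffAt ((chartDomain n x₀).isOpen.mem_nhds hx₀)
    ).congr_of_eventuallyEq ?_
  filter_upwards [(chartDomain n x₀).isOpen.mem_nhds hx₀] with x hx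
  rw [zeroExt_of_mem g hx, hg, ← (δ x).mfderiv_toTangent hx (chartCoord x₀ i)
    (F := fun x => chartAt (EuclideanSpace ℝ (Fin n)) x₀ x i) fun _ _ => rfl]
  have h1 := TangentBundle.continuousLinearMapAt_trivializationAt (I := mdl n) hx
  have hb : x ∈ (trivializationAt (EuclideanSpace ℝ (Fin n)) (TangentSpace (mdl n)) x₀).baseSet :=
    hx
  rw [← Bundle.Trivialization.continuousLinearMapAt_apply_of_mem (R := ℝ) _ hb, h1]
  have h2 : MDifferentiableAt (mdl n) (mdl n) (extChartAt (mdl n) x₀) x :=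
    mdifferentiableAt_extChartAt hx
  have h3 := ((EuclideanSpace.proj (𝕜 := ℝ) i).hasMFDerivAt
    (x := extChartAt (mdl n) x₀ x)).comp x h2.hasMFDerivAt
  have h4 : mfderiv (mdl n) 𝓘(ℝ, ℝ)
    (fun x => chartAt (EuclideanSpace ℝ (Fin n)) x₀ x i) x = _ := h3.mfderiv
  rw [h4]
  rfl

end GermDerivation

end Germs

theorem sum_smoothOn_apply {n : ℕ} {M : Type u} [TopologicalSpace M]
    [ChartedSpace (EuclideanSpace ℝ (Fin n)) M] {V : Opens M} {ι : Type*} (t : Finset ι)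
    (f : ι → SmoothOn n V) (x : V) : (∑ i ∈ t, f i) x = ∑ i ∈ t, f i x :=
  map_sum (ContMDiffMap.evalRingHom (I := mdl n) (I' := 𝓘(ℝ, ℝ)) (n := ∞) x :
    SmoothOn n V →+* ℝ) f t

/-! ### The vector bundle of a locally free sheaf -/

universe w

/-- A locally free sheaf of `C^∞`-modules of rank `m`, with a chosen frame near each point. -/
structure LocallyFreeSheaf (n : ℕ) (M : Type u) [TopologicalSpace M]
    [ChartedSpace (EuclideanSpace ℝ (Fin n)) M] (m : ℕ) where
  /-- The sections over an open set. -/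
  S : Opens M → Type w
  [addCommGroup : ∀ U, AddCommGroup (S U)]
  [module : ∀ U, Module (SmoothOn n U) (S U)]
  /-- Restriction. -/
  res : ∀ {U V : Opens M}, U ≤ V → S V →+ S U
  res_smul : ∀ {U V : Opens M} (h : U ≤ V) (f : SmoothOn n V) (s : S V),
    res h (f • s) = smoothRes n h f • res h s
  res_res : ∀ {U V W : Opens M} (h : U ≤ V) (h' : V ≤ W) (s : S W),
    res h (res h' s) = res (h.trans h') s
  /-- A neighbourhood of `x` with a frame. -/
  dom : M → Opens M
  mem_dom : ∀ x, x ∈ dom x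
  /-- The coordinates with respect to the frame near `x`. -/
  coord : ∀ (x : M) (V : Opens M), V ≤ dom x → S V ≃ₗ[SmoothOn n V] (Fin m → SmoothOn n V)
  coord_res : ∀ (x : M) {U V : Opens M} (hV : V ≤ dom x) (h : U ≤ V) (s : S V) (i : Fin m),
    coord x U (h.trans hV) (res h s) i = smoothRes n h (coord x V hV s i)
  separated : ∀ s t : S ⊤, (∀ x, res (le_top : dom x ≤ ⊤) s = res le_top t) → s = t
  glue : ∀ s : ∀ x, S (dom x),
    (∀ x y, res (inf_le_left : dom x ⊓ dom y ≤ dom x) (s x) = res inf_le_right (s y)) →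
      ∃ t : S ⊤, ∀ x, res le_top t = s x

attribute [instance] LocallyFreeSheaf.addCommGroup LocallyFreeSheaf.module

namespace LocallyFreeSheaf

variable {n m : ℕ} {M : Type u} [TopologicalSpace M] [ChartedSpace (EuclideanSpace ℝ (Fin n)) M]
  (L : LocallyFreeSheaf.{u, w} n M m)

/-- The matrix of the change of frames over `V`. -/
def trans (V : Opens M) {x y : M} (hx : V ≤ L.dom x) (hy : V ≤ L.dom y) (i j : Fin m) :
    SmoothOn n V :=
  L.coord y V hy ((L.coord x V hx).symm (Pi.single j 1)) i

theorem coord_eq_sum_trans {V : Opens M} {x y : M} (hx : V ≤ L.dom x) (hy : V ≤ L.dom y)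
    (s : L.S V) (i : Fin m) :
    L.coord y V hy s i = ∑ j, L.trans V hx hy i j * L.coord x V hx s j := by
  have h : s = ∑ j, L.coord x V hx s j • (L.coord x V hx).symm (Pi.single j 1) := by
    apply (L.coord x V hx).injective
    simp only [map_sum, map_smul, LinearEquiv.apply_symm_apply]
    exact pi_eq_sum_univ' _
  conv_lhs => rw [h]
  simp only [map_sum, map_smul, Finset.sum_apply, Pi.smul_apply, smul_eq_mul]
  exact Finset.sum_congr rfl fun j _ => mul_comm _ _

theorem trans_res {U V : Opens M} (h : U ≤ V) {x y : M} (hx : V ≤ L.dom x) (hy : V ≤ L.dom y)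
    (i j : Fin m) :
    smoothRes n h (L.trans V hx hy i j) = L.trans U (h.trans hx) (h.trans hy) i j := by
  rw [trans, trans, ← L.coord_res]
  refine congrFun (congrArg (L.coord y U (h.trans hy)) ?_) i
  apply (L.coord x U (h.trans hx)).injective
  ext1 k
  rw [L.coord_res x hx h, LinearEquiv.apply_symm_apply, LinearEquiv.apply_symm_apply]
  rcases eq_or_ne k j with rfl | hk
  · simp
  · simp [hk]

/-- Both matrices restrict to the same one on `V ⊓ V'`. Pointwise transition matrices may therefore
be computed on any convenient neighbourhood. -/
theorem trans_apply {V V' : Opens M} {x y : M} (hx : V ≤ L.dom x) (hy : V ≤ L.dom y)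
    (hx' : V' ≤ L.dom x) (hy' : V' ≤ L.dom y) {p : M} (hp : p ∈ V) (hp' : p ∈ V') (i j : Fin m) :
    L.trans V hx hy i j ⟨p, hp⟩ = L.trans V' hx' hy' i j ⟨p, hp'⟩ := by
  have h1 := L.trans_res (inf_le_left : V ⊓ V' ≤ V) hx hy i j
  have h2 := L.trans_res (inf_le_right : V ⊓ V' ≤ V') hx' hy' i j
  have h3 := congrArg (fun f : SmoothOn n (V ⊓ V') => f ⟨p, hp, hp'⟩) (h1.trans h2.symm)
  exact h3

/-- The transition functions. -/
def coordChange (x y p : M) : EuclideanSpace ℝ (Fin m) →L[ℝ] EuclideanSpace ℝ (Fin m) :=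
  ∑ i, ∑ j, zeroExt (L.trans (L.dom x ⊓ L.dom y) (x := x) (y := y) inf_le_left inf_le_right i j) p •
    (EuclideanSpace.proj (𝕜 := ℝ) j).smulRight (EuclideanSpace.single i (1 : ℝ))

theorem coordChange_apply {V : Opens M} {x y p : M} (hx : V ≤ L.dom x) (hy : V ≤ L.dom y)
    (hp : p ∈ V) (v : EuclideanSpace ℝ (Fin m)) (i : Fin m) :
    L.coordChange x y p v i = ∑ j, L.trans V hx hy i j ⟨p, hp⟩ * v j := by
  have hp' : p ∈ L.dom x ⊓ L.dom y := ⟨hx hp, hy hp⟩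
  simp only [coordChange, zeroExt_of_mem _ hp', L.trans_apply _ _ hx hy hp' hp]
  simp [Pi.single_apply, Finset.sum_ite_eq]

/-- Since every vector is the coordinate vector at `p` of some section (`exists_coord_eq`), this
turns the cocycle conditions of `core` into tautologies about sections. -/
theorem coordChange_coord {V : Opens M} {x y p : M} (hx : V ≤ L.dom x) (hy : V ≤ L.dom y)
    (hp : p ∈ V) (s : L.S V) :
    L.coordChange x y p (WithLp.toLp 2 fun i => L.coord x V hx s i ⟨p, hp⟩) =
      WithLp.toLp 2 fun i => L.coord y V hy s i ⟨p, hp⟩ := by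
  ext i
  rw [L.coordChange_apply hx hy hp]
  change _ = L.coord y V hy s i ⟨p, hp⟩
  rw [L.coord_eq_sum_trans hx hy]
  exact (sum_smoothOn_apply Finset.univ
    (fun j => L.trans V hx hy i j * L.coord x V hx s j) ⟨p, hp⟩).symm

theorem exists_coord_eq {V : Opens M} {x p : M} (hx : V ≤ L.dom x) (hp : p ∈ V)
    (v : EuclideanSpace ℝ (Fin m)) :
    ∃ s : L.S V, (WithLp.toLp 2 fun i => L.coord x V hx s i ⟨p, hp⟩) = v :=
  ⟨(L.coord x V hx).symm fun i => algebraMap ℝ (SmoothOn n V) (v i), by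
    simp only [LinearEquiv.apply_symm_apply]
    rfl⟩

theorem contMDiffOn_coordChange (x y : M) :
    ContMDiffOn (mdl n) 𝓘(ℝ, EuclideanSpace ℝ (Fin m) →L[ℝ] EuclideanSpace ℝ (Fin m)) ∞
      (L.coordChange x y) (L.dom x ⊓ L.dom y : Opens M) := by
  unfold coordChange
  refine contMDiffOn_finsetSum fun i _ => contMDiffOn_finsetSum fun j _ => ?_
  exact (contMDiffOn_zeroExt _).smul contMDiffOn_const

/-- The vector bundle core given by the transition functions. -/
def core : VectorBundleCore ℝ M (EuclideanSpace ℝ (Fin m)) M where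
  baseSet x := L.dom x
  isOpen_baseSet x := (L.dom x).isOpen
  indexAt := id
  mem_baseSet_at := L.mem_dom
  coordChange := L.coordChange
  coordChange_self x p hp v := by
    obtain ⟨s, rfl⟩ := L.exists_coord_eq le_rfl hp v
    exact L.coordChange_coord le_rfl le_rfl hp s
  continuousOn_coordChange x y := (L.contMDiffOn_coordChange x y).continuousOn
  coordChange_comp x y z p hp v := by
    let V := L.dom x ⊓ L.dom y ⊓ L.dom z
    obtain ⟨s, rfl⟩ := L.exists_coord_eq (V := V) (inf_le_left.trans inf_le_left) hp v
    rw [L.coordChange_coord _ (inf_le_left.trans inf_le_right), L.coordChange_coord _ inf_le_right,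
      L.coordChange_coord _ inf_le_right]

instance : L.core.IsContMDiff (mdl n) ∞ := ⟨L.contMDiffOn_coordChange⟩

/-- The vector bundle of a locally free sheaf. -/
def bundle : SmoothVectorBundle n M where
  rank := m
  Fib := L.core.Fiber

/-- The fibre at `p` is identified with `ℝᵐ` by the chosen frame near `p`. -/
def fibCoord (p : M) : L.bundle.Fib p ≃ₗ[ℝ] EuclideanSpace ℝ (Fin m) :=
  LinearEquiv.refl ℝ (EuclideanSpace ℝ (Fin m))

/-- The value at `p` of a global section, in the frame near `x`. -/
def value (s : L.S ⊤) {x p : M} (hp : p ∈ L.dom x) : EuclideanSpace ℝ (Fin m) :=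
  WithLp.toLp 2 fun i => L.coord x (L.dom x) le_rfl (L.res le_top s) i ⟨p, hp⟩

theorem value_eq (s : L.S ⊤) {V : Opens M} {x p : M} (hx : V ≤ L.dom x) (hp : p ∈ V) :
    L.value s (hx hp) = WithLp.toLp 2 fun i => L.coord x V hx (L.res le_top s) i ⟨p, hp⟩ := by
  unfold value
  congr 1
  funext i
  rw [← L.res_res hx le_top, L.coord_res x le_rfl hx]
  rfl

theorem coordChange_value (s : L.S ⊤) {x y p : M} (hx : p ∈ L.dom x) (hy : p ∈ L.dom y) :
    L.coordChange x y p (L.value s hx) = L.value s hy := by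
  have hp : p ∈ L.dom x ⊓ L.dom y := ⟨hx, hy⟩
  rw [L.value_eq s (V := L.dom x ⊓ L.dom y) inf_le_left hp,
    L.value_eq s (V := L.dom x ⊓ L.dom y) inf_le_right hp,
    L.coordChange_coord]

/-- A section of the bundle is smooth on the domain of a frame iff its coordinates are smooth. -/
theorem contMDiffOn_section_iff (σ : ∀ p, L.core.Fiber p) (x : M) :
    ContMDiffOn (mdl n) ((mdl n).prod 𝓘(ℝ, EuclideanSpace ℝ (Fin m))) ∞
      (fun p => Bundle.TotalSpace.mk' (EuclideanSpace ℝ (Fin m)) p (σ p)) (L.dom x) ↔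
    ContMDiffOn (mdl n) 𝓘(ℝ, EuclideanSpace ℝ (Fin m)) ∞
      (fun p => L.coordChange p x p (L.fibCoord p (σ p))) (L.dom x) := by
  have : MemTrivializationAtlas (F := EuclideanSpace ℝ (Fin m)) (E := L.core.Fiber)
    (L.core.localTriv x) := ⟨⟨x, rfl⟩⟩
  exact Bundle.Trivialization.contMDiffOn_section_baseSet_iff (IB := mdl n) (n := ∞)
    (F := EuclideanSpace ℝ (Fin m)) (E := L.core.Fiber) (e := L.core.localTriv x) (s := σ)

/-- The section of the bundle given by a global section of the sheaf. -/
def toSec (s : L.S ⊤) : Sec L.bundle :=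
  ⟨fun p => (L.fibCoord p).symm (L.value s (L.mem_dom p)), fun x => by
    refine ContMDiffOn.contMDiffAt ((L.contMDiffOn_section_iff _ x).2 ?_)
      ((L.dom x).isOpen.mem_nhds (L.mem_dom x))
    intro p hp
    refine ContMDiffAt.contMDiffWithinAt (contMDiffAt_euclidean_of_coord fun i => ?_)
    refine ((contMDiffOn_zeroExt (L.coord x (L.dom x) le_rfl (L.res le_top s) i)).contMDiffAt
      ((L.dom x).isOpen.mem_nhds hp)).congr_of_eventuallyEq ?_
    filter_upwards [(L.dom x).isOpen.mem_nhds hp] with q hq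
    rw [LinearEquiv.apply_symm_apply, L.coordChange_value s _ hq, zeroExt_of_mem _ hq]
    rfl⟩

theorem fibCoord_toSec (s : L.S ⊤) (p : M) (i : Fin m) :
    L.fibCoord p (L.toSec s p) i =
      L.coord p (L.dom p) le_rfl (L.res le_top s) i ⟨p, L.mem_dom p⟩ := rfl

theorem toSec_add (s t : L.S ⊤) : L.toSec (s + t) = L.toSec s + L.toSec t := by
  ext p
  apply (L.fibCoord p).injective
  ext i
  rw [fibCoord_toSec, map_add, map_add]
  rfl

theorem toSec_smul (f : SmoothFn n M) (s : L.S ⊤) :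
    L.toSec (smoothToOpen n ⊤ f • s) = fsmul f (L.toSec s) := by
  ext p
  apply (L.fibCoord p).injective
  ext i
  rw [fibCoord_toSec, L.res_smul, map_smul]
  rfl

/-- The value at `p` in the frame chosen at `p` determines the value in every other frame through
the transition matrices, so all local coordinates agree and the sheaf is separated. -/
theorem toSec_injective : Function.Injective L.toSec := by
  intro s t h
  refine L.separated s t fun x => (L.coord x (L.dom x) le_rfl).injective ?_
  ext i p
  obtain ⟨p, hp⟩ := p
  have h1 : L.value s (L.mem_dom p) = L.value t (L.mem_dom p) :=
    congrArg (fun σ : Sec L.bundle => L.fibCoord p (σ p)) h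
  have h2 : L.value s hp = L.value t hp := by
    rw [← L.coordChange_value s (L.mem_dom p) hp, h1, L.coordChange_value]
  exact congrArg (fun v : EuclideanSpace ℝ (Fin m) => v i) h2

/-- Reading the section in each frame gives local sections of the sheaf. They agree on overlaps by
the cocycle identity and are then glued. -/
theorem toSec_surjective : Function.Surjective L.toSec := by
  intro σ
  have hsm : ∀ x i, ContMDiffOn (mdl n) 𝓘(ℝ, ℝ) ∞
      (fun p => L.coordChange p x p (L.fibCoord p (σ p)) i) (L.dom x) := fun x i =>
    (EuclideanSpace.proj (𝕜 := ℝ) i).contDiff.contMDiff.comp_contMDiffOn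
      ((L.contMDiffOn_section_iff σ x).1 σ.contMDiff.contMDiffOn)
  let s : ∀ x, L.S (L.dom x) := fun x =>
    (L.coord x _ le_rfl).symm fun i => toSmoothOn _ _ (hsm x i)
  have hs : ∀ x p (hp : p ∈ L.dom x),
      (WithLp.toLp 2 fun i => L.coord x _ le_rfl (s x) i ⟨p, hp⟩) =
        L.coordChange p x p (L.fibCoord p (σ p)) := fun x p hp => by
    simp only [s, LinearEquiv.apply_symm_apply]
    rfl
  obtain ⟨t, ht⟩ := L.glue s fun x y => by
    apply (L.coord y _ inf_le_right).injective
    ext i ⟨p, hp⟩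
    have h1 := L.coordChange_coord (V := L.dom x ⊓ L.dom y) inf_le_left inf_le_right hp
      (L.res inf_le_left (s x))
    have h2 : (WithLp.toLp 2 fun i =>
        L.coord x (L.dom x ⊓ L.dom y) inf_le_left (L.res inf_le_left (s x)) i ⟨p, hp⟩) =
        L.coordChange p x p (L.fibCoord p (σ p)) := by
      simp only [L.coord_res x le_rfl inf_le_left]
      exact hs x p hp.1
    have h3 : (WithLp.toLp 2 fun i =>
        L.coord y (L.dom x ⊓ L.dom y) inf_le_right (L.res inf_le_right (s y)) i ⟨p, hp⟩) =
        L.coordChange p y p (L.fibCoord p (σ p)) := by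
      simp only [L.coord_res y le_rfl inf_le_right]
      exact hs y p hp.2
    rw [h2] at h1
    -- Passing from the frame of `p` to that of `x` and on to that of `y` is the direct passage from
    -- `p` to `y`; this is the compatibility needed for gluing.
    have h4 : L.coordChange x y p (L.coordChange p x p (L.fibCoord p (σ p))) =
        L.coordChange p y p (L.fibCoord p (σ p)) :=
      L.core.coordChange_comp p x y p ⟨⟨L.mem_dom p, hp.1⟩, hp.2⟩ _
    rw [h4, ← h3] at h1
    exact (congrArg (fun v : EuclideanSpace ℝ (Fin m) => v i) h1).symm
  refine ⟨t, ?_⟩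
  ext p
  apply (L.fibCoord p).injective
  ext i
  rw [fibCoord_toSec, ht]
  have h5 := hs p p (L.mem_dom p)
  have h6 : L.coordChange p p p (L.fibCoord p (σ p)) = L.fibCoord p (σ p) :=
    L.core.coordChange_self p p (L.mem_dom p) _
  rw [h6] at h5
  exact congrArg (fun v : EuclideanSpace ℝ (Fin m) => v i) h5

end LocallyFreeSheaf

/-! ### Signs -/

/-- The sign of an integer as a real number. -/
def sgn (k : ℤ) : ℝ := ((k.negOnePow : ℤ) : ℝ)

theorem negOnePow_smul_eq {A : Type*} [AddCommGroup A] [Module ℝ A] (k : ℤ) (a : A) :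
    k.negOnePow • a = sgn k • a := negOnePow_smul_end _ _

theorem sgn_add (k l : ℤ) : sgn (k + l) = sgn k * sgn l := by
  simp [sgn, Int.negOnePow_add]

theorem sgn_even {k : ℤ} (h : Even k) : sgn k = 1 := by
  simp [sgn, Int.negOnePow_even k h]

theorem sgn_odd {k : ℤ} (h : Odd k) : sgn k = -1 := by
  simp [sgn, Int.negOnePow_odd k h]

theorem sgn_mul_self (k : ℤ) : sgn k * sgn k = 1 := by
  rw [← sgn_add, sgn_even ⟨k, rfl⟩]

theorem sgn_natCast (i : ℕ) : sgn i = (-1) ^ i := by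
  rcases Nat.even_or_odd i with h | h
  · rw [sgn_even (by exact_mod_cast h), h.neg_one_pow]
  · rw [sgn_odd (by exact_mod_cast h), h.neg_one_pow]

theorem sgn_neg_one_mul (i j : ℕ) : sgn (-1 * (i + 2 * j)) = (-1) ^ i := by
  rw [← sgn_natCast, show (-1 * (i + 2 * j) : ℤ) = i + (2 * (-i - j)) by ring, sgn_add,
    sgn_even (even_two_mul _), mul_one]

theorem sgn_neg_two_mul (i : ℤ) : sgn (-2 * i) = 1 :=
  sgn_even ⟨-i, by ring⟩

/-! ### Graded derivations of the exterior algebra -/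

section Exterior

variable {W : Type*} [AddCommGroup W] [Module ℝ W]

/-- The power `⋀^(i+1)` is the product of the range of `ι` with `⋀^i`. This induction peels off one
vector on the left, the form in which the recursion `contract_ι_mul` can be used. -/
theorem exteriorPower_succ_induction {i : ℕ} {P : ExteriorAlgebra ℝ W → Prop}
    (hmul : ∀ v : W, ∀ a ∈ ⋀[ℝ]^i W, P (ExteriorAlgebra.ι ℝ v * a))
    (hadd : ∀ a b, P a → P b → P (a + b)) {a : ExteriorAlgebra ℝ W} (ha : a ∈ ⋀[ℝ]^(i + 1) W) :
    P a := by
  have ha' : a ∈ LinearMap.range (ExteriorAlgebra.ι ℝ (M := W)) * ⋀[ℝ]^i W := by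
    rw [ExteriorAlgebra.exteriorPower, ← pow_succ']; exact ha
  refine Submodule.mul_induction_on ha' ?_ hadd
  rintro _ ⟨v, rfl⟩ b hb
  exact hmul v b hb

theorem exteriorPower_zero_iff {a : ExteriorAlgebra ℝ W} :
    a ∈ ⋀[ℝ]^0 W ↔ ∃ c, algebraMap ℝ _ c = a := by
  rw [ExteriorAlgebra.exteriorPower, pow_zero, Submodule.mem_one]

theorem ι_mul_mem_exteriorPower (v : W) {i : ℕ} {a : ExteriorAlgebra ℝ W} (ha : a ∈ ⋀[ℝ]^i W) :
    ExteriorAlgebra.ι ℝ v * a ∈ ⋀[ℝ]^(i + 1) W := by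
  rw [ExteriorAlgebra.exteriorPower, pow_succ']
  exact Submodule.mul_mem_mul ⟨v, rfl⟩ ha

theorem mul_ι_eq_of_mem_exteriorPower (v : W) (i : ℕ) :
    ∀ a ∈ ⋀[ℝ]^i W,
      ExteriorAlgebra.ι ℝ v * a = (-1 : ℝ) ^ i • (a * ExteriorAlgebra.ι ℝ v) := by
  induction i with
  | zero =>
    intro a ha
    obtain ⟨c, rfl⟩ := exteriorPower_zero_iff.1 ha
    rw [pow_zero, one_smul, Algebra.commutes]
  | succ i ih =>
    intro a ha
    refine exteriorPower_succ_induction (P := fun a => ExteriorAlgebra.ι ℝ v * a =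
      (-1 : ℝ) ^ (i + 1) • (a * ExteriorAlgebra.ι ℝ v))
      (fun w b hb => ?_) (fun a b ha hb => ?_) ha
    · have h := eq_neg_of_add_eq_zero_left (ExteriorAlgebra.ι_add_mul_swap (R := ℝ) v w)
      rw [← mul_assoc, h, neg_mul, mul_assoc, ih b hb, mul_smul_comm, mul_assoc, pow_succ,
        mul_neg_one, neg_smul]
    · rw [mul_add, ha, hb, add_mul, smul_add]

/-- Contraction with a linear form. -/
def contract (d : Module.Dual ℝ W) : ExteriorAlgebra ℝ W →ₗ[ℝ] ExteriorAlgebra ℝ W :=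
  CliffordAlgebra.contractLeft (Q := (0 : QuadraticForm ℝ W)) d

theorem contract_ι_mul (d : Module.Dual ℝ W) (v : W) (a : ExteriorAlgebra ℝ W) :
    contract d (ExteriorAlgebra.ι ℝ v * a) = d v • a - ExteriorAlgebra.ι ℝ v * contract d a :=
  CliffordAlgebra.contractLeft_ι_mul d v a

theorem contract_algebraMap (d : Module.Dual ℝ W) (c : ℝ) :
    contract d (algebraMap ℝ _ c) = 0 :=
  CliffordAlgebra.contractLeft_algebraMap (Q := (0 : QuadraticForm ℝ W)) d c

theorem contract_one (d : Module.Dual ℝ W) : contract d 1 = 0 :=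
  CliffordAlgebra.contractLeft_one (Q := (0 : QuadraticForm ℝ W)) d

theorem contract_ι (d : Module.Dual ℝ W) (v : W) :
    contract d (ExteriorAlgebra.ι ℝ v) = algebraMap ℝ _ (d v) :=
  CliffordAlgebra.contractLeft_ι (Q := (0 : QuadraticForm ℝ W)) d v

theorem contract_mem (d : Module.Dual ℝ W) (i : ℕ) :
    ∀ a ∈ ⋀[ℝ]^(i + 1) W, contract d a ∈ ⋀[ℝ]^i W := by
  induction i with
  | zero =>
    intro a ha
    refine exteriorPower_succ_induction (P := fun a => contract d a ∈ ⋀[ℝ]^0 W)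
      (fun v b hb => ?_) (fun a b ha hb => ?_) ha
    · obtain ⟨c, rfl⟩ := exteriorPower_zero_iff.1 hb
      rw [contract_ι_mul, contract_algebraMap, mul_zero, sub_zero]
      exact Submodule.smul_mem _ _ hb
    · rw [map_add]; exact add_mem ha hb
  | succ i ih =>
    intro a ha
    refine exteriorPower_succ_induction (P := fun a => contract d a ∈ ⋀[ℝ]^(i + 1) W)
      (fun v b hb => ?_) (fun a b ha hb => ?_) ha
    · rw [contract_ι_mul]
      exact sub_mem (Submodule.smul_mem _ _ hb) (ι_mul_mem_exteriorPower v (ih b hb))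
    · rw [map_add]; exact add_mem ha hb

/-- Contraction is given only by its rule for one vector on the left; induction on the degree of the
left factor upgrades this to the graded Leibniz rule, each vector contributing one sign. -/
theorem contract_mul (d : Module.Dual ℝ W) (i : ℕ) (a' : ExteriorAlgebra ℝ W) :
    ∀ a ∈ ⋀[ℝ]^i W,
      contract d (a * a') = contract d a * a' + (-1 : ℝ) ^ i • (a * contract d a') := by
  induction i with
  | zero =>
    intro a ha
    obtain ⟨c, rfl⟩ := exteriorPower_zero_iff.1 ha
    rw [contract_algebraMap, zero_mul, zero_add, pow_zero, one_smul, ← Algebra.smul_def, map_smul,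
      ← Algebra.smul_def]
  | succ i ih =>
    intro a ha
    refine exteriorPower_succ_induction (P := fun a => contract d (a * a') =
      contract d a * a' + (-1 : ℝ) ^ (i + 1) • (a * contract d a'))
      (fun v b hb => ?_) (fun a b ha hb => ?_) ha
    · rw [mul_assoc, contract_ι_mul, contract_ι_mul, ih b hb, sub_mul, mul_add, mul_smul_comm,
        smul_mul_assoc, pow_succ, mul_neg_one, neg_smul, mul_assoc, mul_assoc]
      abel
    · rw [add_mul, map_add, ha, hb, map_add, add_mul, add_mul, smul_add]
      abel

end Exterior

/-! ### Derivations of the local model -/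

/-- A linear map of degree `k` that satisfies the graded Leibniz rule. -/
structure IsGradedDerivation {A : Type*} [Ring A] [Algebra ℝ A] (deg : ℤ → Submodule ℝ A) (k : ℤ)
    (X : A →ₗ[ℝ] A) : Prop where
  map_deg : ∀ i : ℤ, ∀ f ∈ deg i, X f ∈ deg (k + i)
  leibniz : ∀ i : ℤ, ∀ f ∈ deg i, ∀ g, X (f * g) = X f * g + (k * i).negOnePow • (f * X g)

section Tensor

variable {C D : Type*} [CommRing C] [Algebra ℝ C] [Ring D] [Algebra ℝ D]

/-- The degree on `C ⊗ D` given by sets of homogeneous elements that span `D`. -/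
def tensorDeg (C : Type*) [CommRing C] [Algebra ℝ C] (S : ℤ → Set D) (k : ℤ) :
    Submodule ℝ (C ⊗[ℝ] D) :=
  Submodule.span ℝ {t | ∃ c : C, ∃ d ∈ S k, t = c ⊗ₜ[ℝ] d}

/-- The factor `C` has degree zero and is untouched by `1 ⊗ δ`, so by linearity both conditions need
checking only on the homogeneous generators of `D`. -/
theorem isGradedDerivation_lTensor {S : ℤ → Set D} {δ : D →ₗ[ℝ] D} {k : ℤ}
    (hdeg : ∀ i : ℤ, ∀ d ∈ S i, δ d ∈ Submodule.span ℝ (S (k + i)))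
    (hleib : ∀ i : ℤ, ∀ d ∈ S i, ∀ d', δ (d * d') = δ d * d' + sgn (k * i) • (d * δ d')) :
    IsGradedDerivation (tensorDeg C S) k (LinearMap.lTensor C δ) := by
  refine ⟨fun l f hf => ?_, fun l f hf g => ?_⟩
  · induction hf using Submodule.span_induction with
    | mem x hx =>
      obtain ⟨c, d, hd, rfl⟩ := hx
      rw [LinearMap.lTensor_tmul]
      have h := hdeg l d hd
      generalize δ d = u at h
      induction h using Submodule.span_induction with
      | mem x hx => exact Submodule.subset_span ⟨c, x, hx, rfl⟩
      | zero => rw [TensorProduct.tmul_zero]; exact zero_mem _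
      | add x y _ _ hx hy => rw [TensorProduct.tmul_add]; exact add_mem hx hy
      | smul t x _ hx => rw [TensorProduct.tmul_smul]; exact Submodule.smul_mem _ _ hx
    | zero => rw [map_zero]; exact zero_mem _
    | add x y _ _ hx hy => rw [map_add]; exact add_mem hx hy
    | smul t x _ hx => rw [map_smul]; exact Submodule.smul_mem _ _ hx
  · rw [negOnePow_smul_eq]
    induction hf using Submodule.span_induction with
    | mem x hx =>
      obtain ⟨c, d, hd, rfl⟩ := hx
      induction g using TensorProduct.induction_on with
      | zero => simp
      | add g g' hg hg' => rw [mul_add, map_add, hg, hg', map_add, mul_add, mul_add, smul_add]; abel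
      | tmul c' d' =>
        rw [Algebra.TensorProduct.tmul_mul_tmul, LinearMap.lTensor_tmul, LinearMap.lTensor_tmul,
          LinearMap.lTensor_tmul, hleib l d hd d', Algebra.TensorProduct.tmul_mul_tmul,
          Algebra.TensorProduct.tmul_mul_tmul, TensorProduct.tmul_add, TensorProduct.tmul_smul]
    | zero => simp
    | add x y _ _ hx hy => rw [add_mul, map_add, hx, hy, map_add, add_mul, add_mul, smul_add]; abel
    | smul t x _ hx =>
      rw [smul_mul_assoc, map_smul, hx, map_smul, smul_mul_assoc, smul_mul_assoc, smul_add,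
        smul_comm t]

theorem eq_sum_of_mem_tensorDeg {ι : Type*} [Fintype ι] {S : ℤ → Set D} {k : ℤ}
    {δ : ι → D →ₗ[ℝ] D} {x : ι → D} (h : ∀ d ∈ S k, d = ∑ a, δ a d * x a) {f : C ⊗[ℝ] D}
    (hf : f ∈ tensorDeg C S k) : f = ∑ a, LinearMap.lTensor C (δ a) f * (1 ⊗ₜ x a) := by
  induction hf using Submodule.span_induction with
  | mem y hy =>
    obtain ⟨c, d, hd, rfl⟩ := hy
    conv_lhs => rw [h d hd]
    simp only [LinearMap.lTensor_tmul, Algebra.TensorProduct.tmul_mul_tmul, mul_one,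
      TensorProduct.tmul_sum]
  | zero => simp
  | add x y _ _ hx hy =>
    conv_lhs => rw [hx, hy]
    simp only [map_add, add_mul, Finset.sum_add_distrib]
  | smul t x _ hx =>
    conv_lhs => rw [hx]
    simp only [map_smul, smul_mul_assoc, Finset.smul_sum]

/-- The hypothesis `hX` says that `X` generates `D`. It is phrased through stability under left
multiplication because the kernel of a derivation that kills the generators has this property. -/
theorem tensor_induction {X : Set D}
    (hX : ∀ T : Submodule ℝ D, 1 ∈ T → (∀ x ∈ X, ∀ d ∈ T, x * d ∈ T) → ∀ d, d ∈ T)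
    (T : Submodule ℝ (C ⊗[ℝ] D)) (h1 : 1 ∈ T) (hc : ∀ c : C, ∀ f ∈ T, (c ⊗ₜ 1) * f ∈ T)
    (hx : ∀ x ∈ X, ∀ f ∈ T, (1 ⊗ₜ x) * f ∈ T) (f : C ⊗[ℝ] D) : f ∈ T := by
  have h : ∀ d : D, (1 : C) ⊗ₜ[ℝ] d ∈ T :=
    hX (T.comap (TensorProduct.mk ℝ C D 1)) h1 fun x hxX d hd => by
      have h := hx x hxX _ hd
      simpa only [Submodule.mem_comap, TensorProduct.mk_apply, Algebra.TensorProduct.tmul_mul_tmul,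
        one_mul] using h
  induction f using TensorProduct.induction_on with
  | zero => exact T.zero_mem
  | add f g hf hg => exact T.add_mem hf hg
  | tmul c d =>
    have h := hc c _ (h d)
    rwa [Algebra.TensorProduct.tmul_mul_tmul, mul_one, one_mul] at h

end Tensor

/-! ### The coordinate algebra and its coordinate derivations. -/

section Model

variable {r s : ℕ}

/-- The odd coordinates. -/
def odd (s : ℕ) (a : Fin r) : CoordAlg r s := ExteriorAlgebra.ι ℝ (Pi.single a 1) ⊗ₜ 1

/-- The even coordinates. -/
def even (r : ℕ) (D : Fin s) : CoordAlg r s := 1 ⊗ₜ MvPolynomial.X D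

/-- The derivation `∂/∂ξᵃ`. -/
def partialOdd (s : ℕ) (a : Fin r) : CoordAlg r s →ₗ[ℝ] CoordAlg r s :=
  TensorProduct.map (contract (LinearMap.proj a)) LinearMap.id

/-- The derivation `∂/∂b^D`. -/
def partialEven (r : ℕ) (D : Fin s) : CoordAlg r s →ₗ[ℝ] CoordAlg r s :=
  TensorProduct.map LinearMap.id (MvPolynomial.pderiv D).toLinearMap

/-- The derivation `ξᵃ ∂/∂b^D`. -/
def oddPartialEven (a : Fin r) (D : Fin s) : CoordAlg r s →ₗ[ℝ] CoordAlg r s :=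
  TensorProduct.map (LinearMap.mulLeft ℝ (ExteriorAlgebra.ι ℝ (Pi.single a 1)))
    (MvPolynomial.pderiv D).toLinearMap

/-- The products of homogeneous elements of the exterior and of the polynomial algebra. -/
def monomialSet (r s : ℕ) (k : ℤ) : Set (CoordAlg r s) :=
  {t | ∃ (i j : ℕ) (a : ExteriorAlgebra ℝ (Fin r → ℝ)) (p : MvPolynomial (Fin s) ℝ),
    (i : ℤ) + 2 * j = k ∧ a ∈ ⋀[ℝ]^i (Fin r → ℝ) ∧ p.IsHomogeneous j ∧ t = a ⊗ₜ[ℝ] p}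

theorem modelDeg_eq (C : Type*) [CommRing C] [Algebra ℝ C] (r s : ℕ) (k : ℤ) :
    modelDeg C r s k = tensorDeg C (monomialSet r s) k := by
  unfold modelDeg tensorDeg
  congr 1
  ext t
  constructor
  · rintro ⟨i, j, c, a, p, hk, ha, hp, rfl⟩
    exact ⟨c, _, ⟨i, j, a, p, hk, ha, hp, rfl⟩, rfl⟩
  · rintro ⟨c, _, ⟨i, j, a, p, hk, ha, hp, rfl⟩, rfl⟩
    exact ⟨i, j, c, a, p, hk, ha, hp, rfl⟩

theorem tmul_mem_span {i j : ℕ} {a : ExteriorAlgebra ℝ (Fin r → ℝ)}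
    {p : MvPolynomial (Fin s) ℝ} (ha : a ∈ ⋀[ℝ]^i (Fin r → ℝ)) (hp : p.IsHomogeneous j) {k : ℤ}
    (hk : (i : ℤ) + 2 * j = k) : a ⊗ₜ[ℝ] p ∈ Submodule.span ℝ (monomialSet r s k) :=
  Submodule.subset_span ⟨i, j, a, p, hk, ha, hp, rfl⟩

/-- Degrees are natural numbers and cannot drop below zero, so constants, whose derivative vanishes,
need a case of their own. -/
theorem pderiv_isHomogeneous {D : Fin s} {p : MvPolynomial (Fin s) ℝ} {j : ℕ}
    (hp : p.IsHomogeneous j) : j = 0 ∧ MvPolynomial.pderiv D p = 0 ∨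
      ∃ j', j = j' + 1 ∧ (MvPolynomial.pderiv D p).IsHomogeneous j' := by
  cases j with
  | zero =>
    left
    refine ⟨rfl, ?_⟩
    rw [← MvPolynomial.totalDegree_zero_iff_isHomogeneous,
      MvPolynomial.totalDegree_eq_zero_iff_eq_C] at hp
    rw [hp]
    exact MvPolynomial.pderiv_C
  | succ j => exact Or.inr ⟨j, rfl, hp.pderiv⟩

theorem isGradedDerivation_model (C : Type*) [CommRing C] [Algebra ℝ C]
    {δ : CoordAlg r s →ₗ[ℝ] CoordAlg r s} {k : ℤ}
    (hdeg : ∀ (i j : ℕ) (a : ExteriorAlgebra ℝ (Fin r → ℝ)) (p : MvPolynomial (Fin s) ℝ),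
      a ∈ ⋀[ℝ]^i (Fin r → ℝ) → p.IsHomogeneous j →
      δ (a ⊗ₜ[ℝ] p) ∈ Submodule.span ℝ (monomialSet r s (k + (i + 2 * j))))
    (hleib : ∀ (i j : ℕ) (a a' : ExteriorAlgebra ℝ (Fin r → ℝ)) (p p' : MvPolynomial (Fin s) ℝ),
      a ∈ ⋀[ℝ]^i (Fin r → ℝ) → p.IsHomogeneous j →
      δ ((a * a') ⊗ₜ[ℝ] (p * p')) = δ (a ⊗ₜ[ℝ] p) * (a' ⊗ₜ[ℝ] p') +
        sgn (k * (i + 2 * j)) • ((a ⊗ₜ[ℝ] p) * δ (a' ⊗ₜ[ℝ] p'))) :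
    IsGradedDerivation (tensorDeg C (monomialSet r s)) k (LinearMap.lTensor C δ) := by
  refine isGradedDerivation_lTensor ?_ ?_
  · rintro _ _ ⟨i, j, a, p, rfl, ha, hp, rfl⟩
    exact hdeg i j a p ha hp
  · rintro _ _ ⟨i, j, a, p, rfl, ha, hp, rfl⟩ g
    induction g using TensorProduct.induction_on with
    | zero => simp
    | add g g' hg hg' =>
      rw [mul_add, map_add, hg, hg', map_add, mul_add (δ _), mul_add (a ⊗ₜ[ℝ] p), smul_add]
      abel
    | tmul a' p' => rw [Algebra.TensorProduct.tmul_mul_tmul, hleib i j a a' p p' ha hp]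

theorem isGradedDerivation_partialOdd (C : Type*) [CommRing C] [Algebra ℝ C] (a : Fin r) :
    IsGradedDerivation (tensorDeg C (monomialSet r s)) (-1) (LinearMap.lTensor C (partialOdd s a)) := by
  refine isGradedDerivation_model C (fun i j b p hb hp => ?_) fun i j b b' p p' hb hp => ?_
  · rw [partialOdd, TensorProduct.map_tmul]
    cases i with
    | zero =>
      obtain ⟨t, rfl⟩ := exteriorPower_zero_iff.1 hb
      rw [contract_algebraMap, TensorProduct.zero_tmul]
      exact zero_mem _
    | succ i => exact tmul_mem_span (contract_mem _ i b hb) hp (by push_cast; ring)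
  · rw [sgn_neg_one_mul]
    simp only [partialOdd, TensorProduct.map_tmul, LinearMap.id_apply, contract_mul _ i b' b hb,
      TensorProduct.add_tmul, Algebra.TensorProduct.tmul_mul_tmul, TensorProduct.smul_tmul']

theorem isGradedDerivation_partialEven (C : Type*) [CommRing C] [Algebra ℝ C] (D : Fin s) :
    IsGradedDerivation (tensorDeg C (monomialSet r s)) (-2) (LinearMap.lTensor C (partialEven r D)) := by
  refine isGradedDerivation_model C (fun i j b p hb hp => ?_) fun i j b b' p p' hb hp => ?_
  · rw [partialEven, TensorProduct.map_tmul]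
    rcases pderiv_isHomogeneous (D := D) hp with ⟨-, h⟩ | ⟨j, rfl, h⟩
    · rw [Derivation.coeFn_coe, h, TensorProduct.tmul_zero]
      exact zero_mem _
    · exact tmul_mem_span hb h (by push_cast; ring)
  · rw [sgn_neg_two_mul, one_smul]
    simp only [partialEven, TensorProduct.map_tmul, LinearMap.id_apply,
      Algebra.TensorProduct.tmul_mul_tmul, Derivation.coeFn_coe,
      Derivation.leibniz, smul_eq_mul, TensorProduct.tmul_add]
    rw [add_comm, mul_comm p']

/-- Moving `ξᵃ` past an element of exterior degree `i` costs `(-1)^i`. This is exactly the sign for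
a derivation of degree `-1`, as the even coordinates contribute an even amount to the degree. -/
theorem isGradedDerivation_oddPartialEven (C : Type*) [CommRing C] [Algebra ℝ C] (a : Fin r) (D : Fin s) :
    IsGradedDerivation (tensorDeg C (monomialSet r s)) (-1) (LinearMap.lTensor C (oddPartialEven a D)) := by
  refine isGradedDerivation_model C (fun i j b p hb hp => ?_) fun i j b b' p p' hb hp => ?_
  · rw [oddPartialEven, TensorProduct.map_tmul]
    rcases pderiv_isHomogeneous (D := D) hp with ⟨-, h⟩ | ⟨j, rfl, h⟩
    · rw [Derivation.coeFn_coe, h, TensorProduct.tmul_zero]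
      exact zero_mem _
    · exact tmul_mem_span (ι_mul_mem_exteriorPower _ hb) h (by push_cast; ring)
  · rw [sgn_neg_one_mul]
    have h := mul_ι_eq_of_mem_exteriorPower (Pi.single a (1 : ℝ)) i b hb
    simp only [oddPartialEven, TensorProduct.map_tmul, LinearMap.mulLeft_apply,
      Algebra.TensorProduct.tmul_mul_tmul, Derivation.coeFn_coe,
      Derivation.leibniz, smul_eq_mul, TensorProduct.tmul_add]
    rw [add_comm, mul_comm p', ← mul_assoc, ← mul_assoc, TensorProduct.smul_tmul',
      ← smul_mul_assoc, ← h]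

theorem partialOdd_odd (a b : Fin r) :
    partialOdd s a (odd s b) = if a = b then 1 else 0 := by
  rw [partialOdd, odd, TensorProduct.map_tmul, contract_ι, LinearMap.proj_apply, Pi.single_apply]
  split_ifs
  · rw [_root_.map_one]; rfl
  · rw [_root_.map_zero, TensorProduct.zero_tmul]

theorem partialOdd_even (a : Fin r) (D : Fin s) : partialOdd s a (even r D) = 0 := by
  rw [partialOdd, even, TensorProduct.map_tmul, contract_one, TensorProduct.zero_tmul]

theorem oddPartialEven_odd (a b : Fin r) (D : Fin s) : oddPartialEven a D (odd s b) = 0 := by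
  rw [oddPartialEven, odd, TensorProduct.map_tmul, Derivation.coeFn_coe, MvPolynomial.pderiv_one, TensorProduct.tmul_zero]

theorem oddPartialEven_even (a : Fin r) (D E : Fin s) :
    oddPartialEven a D (even r E) = if D = E then odd s a else 0 := by
  rw [oddPartialEven, even, TensorProduct.map_tmul, Derivation.coeFn_coe, MvPolynomial.pderiv_X, LinearMap.mulLeft_apply, mul_one,
    Pi.single_apply]
  by_cases h : D = E
  · rw [if_pos h, if_pos h.symm]; rfl
  · rw [if_neg h, if_neg (Ne.symm h), TensorProduct.tmul_zero]

theorem partialEven_even (D E : Fin s) :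
    partialEven r D (even r E) = if D = E then 1 else 0 := by
  rw [partialEven, even, TensorProduct.map_tmul, Derivation.coeFn_coe, MvPolynomial.pderiv_X, Pi.single_apply]
  by_cases h : D = E
  · rw [if_pos h, if_pos h.symm]; rfl
  · rw [if_neg h, if_neg (Ne.symm h), TensorProduct.tmul_zero]

theorem odd_mem (a : Fin r) : odd s a ∈ monomialSet r s 1 :=
  ⟨1, 0, _, _, by norm_num, by rw [ExteriorAlgebra.exteriorPower, pow_one]; exact ⟨_, rfl⟩,
    MvPolynomial.isHomogeneous_one _ _, rfl⟩

theorem even_mem (D : Fin s) : even r D ∈ monomialSet r s 2 :=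
  ⟨0, 1, _, _, by norm_num, exteriorPower_zero_iff.2 ⟨1, _root_.map_one _⟩,
    MvPolynomial.isHomogeneous_X _ _, rfl⟩

theorem sum_smul_ι (v : Fin r → ℝ) :
    ExteriorAlgebra.ι ℝ v = ∑ a, v a • ExteriorAlgebra.ι ℝ (Pi.single a (1 : ℝ)) := by
  conv_lhs => rw [pi_eq_sum_univ' v]
  simp only [map_sum, map_smul]

/-- No `b` fits into degree one: `i + 2j = 1` forces `i = 1` and `j = 0`, so the element is linear
in the `ξᵃ`, and contraction reads off the coefficients. -/
theorem eq_sum_of_mem_monomialSet_one {d : CoordAlg r s} (hd : d ∈ monomialSet r s 1) :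
    d = ∑ a, partialOdd s a d * odd s a := by
  obtain ⟨i, j, a, p, hij, ha, hp, rfl⟩ := hd
  obtain ⟨rfl, rfl⟩ : i = 1 ∧ j = 0 := by omega
  rw [ExteriorAlgebra.exteriorPower, pow_one] at ha
  obtain ⟨v, rfl⟩ := ha
  simp only [partialOdd, TensorProduct.map_tmul, contract_ι,
    LinearMap.proj_apply, LinearMap.id_apply, Algebra.TensorProduct.tmul_mul_tmul, odd, mul_one,
    ← Algebra.smul_def]
  rw [← TensorProduct.sum_tmul, ← sum_smul_ι]

/-- The algebra of coordinates is generated by the coordinates. -/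
theorem coordAlg_induction (T : Submodule ℝ (CoordAlg r s)) (h1 : 1 ∈ T)
    (hx : ∀ x ∈ Set.range (odd s) ∪ Set.range (even r), ∀ d ∈ T, x * d ∈ T)
    (d : CoordAlg r s) : d ∈ T := by
  have hp : ∀ p : MvPolynomial (Fin s) ℝ,
      (1 : ExteriorAlgebra ℝ (Fin r → ℝ)) ⊗ₜ[ℝ] p ∈ T := fun p => by
    induction p using MvPolynomial.induction_on with
    | C t =>
      rw [← MvPolynomial.algebraMap_eq, Algebra.algebraMap_eq_smul_one, TensorProduct.tmul_smul]
      exact T.smul_mem t h1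
    | add p q hp hq =>
      rw [TensorProduct.tmul_add]
      exact T.add_mem hp hq
    | mul_X p D hp =>
      have h := hx _ (Or.inr ⟨D, rfl⟩) _ hp
      rwa [even, Algebra.TensorProduct.tmul_mul_tmul, one_mul, mul_comm] at h
  induction d using TensorProduct.induction_on with
  | zero => exact T.zero_mem
  | add f g hf hg => exact T.add_mem hf hg
  | tmul a p =>
    induction a using CliffordAlgebra.left_induction with
    | algebraMap t =>
      rw [Algebra.algebraMap_eq_smul_one, ← TensorProduct.smul_tmul']
      exact T.smul_mem t (hp p)
    | add a b ha hb =>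
      rw [TensorProduct.add_tmul]
      exact T.add_mem ha hb
    | ι_mul b v hb =>
      have e := sum_smul_ι v
      rw [ExteriorAlgebra.ι] at e
      rw [e, Finset.sum_mul, TensorProduct.sum_tmul]
      refine sum_mem fun a _ => ?_
      have h := hx _ (Or.inl ⟨a, rfl⟩) _ hb
      rw [odd, Algebra.TensorProduct.tmul_mul_tmul, one_mul] at h
      rw [smul_mul_assoc, ← TensorProduct.smul_tmul']
      exact T.smul_mem _ h

end Model

/-! ### Transport along an isomorphism with a tensor product -/

section Transport

variable {C C' D A A' : Type*} [CommRing C] [Algebra ℝ C] [CommRing C'] [Algebra ℝ C'] [Ring D]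
  [Algebra ℝ D] [Ring A] [Algebra ℝ A] [Ring A'] [Algebra ℝ A']

/-- The operator `1 ⊗ δ`, transported along `e`. -/
def transport (e : A ≃ₐ[ℝ] C ⊗[ℝ] D) (δ : D →ₗ[ℝ] D) : A →ₗ[ℝ] A :=
  e.symm.toLinearMap ∘ₗ LinearMap.lTensor C δ ∘ₗ e.toLinearMap

theorem transport_apply (e : A ≃ₐ[ℝ] C ⊗[ℝ] D) (δ : D →ₗ[ℝ] D) (f : A) :
    transport e δ f = e.symm (LinearMap.lTensor C δ (e f)) := rfl

theorem transport_symm (e : A ≃ₐ[ℝ] C ⊗[ℝ] D) (δ : D →ₗ[ℝ] D) (x : D) :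
    transport e δ (e.symm (1 ⊗ₜ x)) = e.symm (1 ⊗ₜ δ x) := by
  rw [transport_apply, AlgEquiv.apply_symm_apply, LinearMap.lTensor_tmul]

theorem isGradedDerivation_transport (e : A ≃ₐ[ℝ] C ⊗[ℝ] D) {δ : D →ₗ[ℝ] D}
    {deg : ℤ → Submodule ℝ A} {S : ℤ → Set D} {k : ℤ}
    (he : ∀ i f, f ∈ deg i ↔ e f ∈ tensorDeg C S i)
    (h : IsGradedDerivation (tensorDeg C S) k (LinearMap.lTensor C δ)) :
    IsGradedDerivation deg k (transport e δ) := by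
  refine ⟨fun i f hf => ?_, fun i f hf g => ?_⟩
  · rw [he, transport_apply, AlgEquiv.apply_symm_apply]
    exact h.map_deg i _ ((he i f).1 hf)
  · have h1 := h.leibniz i _ ((he i f).1 hf) (e g)
    apply e.injective
    rw [negOnePow_smul_eq] at h1 ⊢
    simp only [transport_apply, map_mul, map_add, map_smul, AlgEquiv.apply_symm_apply, h1]

theorem map_lTensor (φ : C →ₐ[ℝ] C') (δ : D →ₗ[ℝ] D) (u : C ⊗[ℝ] D) :
    Algebra.TensorProduct.map φ (AlgHom.id ℝ D) (LinearMap.lTensor C δ u) =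
      LinearMap.lTensor C' δ (Algebra.TensorProduct.map φ (AlgHom.id ℝ D) u) := by
  induction u using TensorProduct.induction_on with
  | zero => simp
  | add x y hx hy => simp only [map_add, hx, hy]
  | tmul c d => simp

theorem transport_comm {e : A ≃ₐ[ℝ] C ⊗[ℝ] D} {e' : A' ≃ₐ[ℝ] C' ⊗[ℝ] D} {φ : C →ₐ[ℝ] C'}
    {ρ : A → A'} (h : ∀ f, e' (ρ f) = Algebra.TensorProduct.map φ (AlgHom.id ℝ D) (e f))
    (δ : D →ₗ[ℝ] D) (f : A) : ρ (transport e δ f) = transport e' δ (ρ f) := by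
  apply e'.injective
  rw [h, transport_apply, transport_apply, AlgEquiv.apply_symm_apply, AlgEquiv.apply_symm_apply, h,
    map_lTensor]

theorem map_symm_one_tmul {e : A ≃ₐ[ℝ] C ⊗[ℝ] D} {e' : A' ≃ₐ[ℝ] C' ⊗[ℝ] D} {φ : C →ₐ[ℝ] C'}
    {ρ : A → A'} (h : ∀ f, e' (ρ f) = Algebra.TensorProduct.map φ (AlgHom.id ℝ D) (e f)) (x : D) :
    ρ (e.symm (1 ⊗ₜ x)) = e'.symm (1 ⊗ₜ x) := by
  apply e'.injective
  rw [h, AlgEquiv.apply_symm_apply, AlgEquiv.apply_symm_apply, Algebra.TensorProduct.map_tmul,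
    map_one, AlgHom.id_apply]

theorem eq_sum_transport {ι : Type*} [Fintype ι] (e : A ≃ₐ[ℝ] C ⊗[ℝ] D) {S : ℤ → Set D} {k : ℤ}
    {δ : ι → D →ₗ[ℝ] D} {x : ι → D} (h : ∀ d ∈ S k, d = ∑ a, δ a d * x a) {f : A}
    (hf : e f ∈ tensorDeg C S k) :
    f = ∑ a, transport e (δ a) f * e.symm (1 ⊗ₜ x a) := by
  apply e.injective
  rw [map_sum]
  simp only [map_mul, transport_apply, AlgEquiv.apply_symm_apply]
  exact eq_sum_of_mem_tensorDeg h hf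

theorem transport_induction (e : A ≃ₐ[ℝ] C ⊗[ℝ] D) {X : Set D}
    (hX : ∀ T : Submodule ℝ D, 1 ∈ T → (∀ x ∈ X, ∀ d ∈ T, x * d ∈ T) → ∀ d, d ∈ T)
    (T : Submodule ℝ A) (h1 : 1 ∈ T) (hc : ∀ c : C, ∀ f ∈ T, e.symm (c ⊗ₜ 1) * f ∈ T)
    (hx : ∀ x ∈ X, ∀ f ∈ T, e.symm (1 ⊗ₜ x) * f ∈ T) (f : A) : f ∈ T := by
  have h := tensor_induction (C := C) hX (T.comap e.symm.toLinearMap)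
    (by rw [Submodule.mem_comap, AlgEquiv.toLinearMap_apply, map_one]; exact h1)
    (fun c f hf => by
      rw [Submodule.mem_comap, AlgEquiv.toLinearMap_apply, map_mul]
      exact hc c _ hf)
    (fun x hxX f hf => by
      rw [Submodule.mem_comap, AlgEquiv.toLinearMap_apply, map_mul]
      exact hx x hxX _ hf) (e f)
  rwa [Submodule.mem_comap, AlgEquiv.toLinearMap_apply, AlgEquiv.symm_apply_apply] at h

end Transport

/-! ### Coordinates of an N2-manifold and the corresponding derivations -/

section Frames

variable {n r s : ℕ} {M : Type u} [TopologicalSpace M]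
  [ChartedSpace (EuclideanSpace ℝ (Fin n)) M]

/-- Coordinates `ξᵃ` and `b^D` of an N2-manifold over `U`, with the derivations `∂/∂ξᵃ`,
`ξᵃ ∂/∂b^D` and `∂/∂b^D`. -/
structure Frame (N : N2Manifold.{u, v} n r s M) (U : Opens M) where
  /-- The odd coordinates. -/
  ξ : ∀ V : Opens M, V ≤ U → Fin r → N.Fn V
  /-- The even coordinates. -/
  b : ∀ V : Opens M, V ≤ U → Fin s → N.Fn V
  /-- The derivation `∂/∂ξᵃ`. -/
  dξ : ∀ V : Opens M, V ≤ U → Fin r → Module.End ℝ (N.Fn V)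
  /-- The derivation `ξᵃ ∂/∂b^D`. -/
  ξdb : ∀ V : Opens M, V ≤ U → Fin r → Fin s → Module.End ℝ (N.Fn V)
  /-- The derivation `∂/∂b^D`. -/
  db : ∀ V : Opens M, V ≤ U → Fin s → Module.End ℝ (N.Fn V)
  ξ_mem : ∀ V hV a, ξ V hV a ∈ N.deg V 1
  b_mem : ∀ V hV D, b V hV D ∈ N.deg V 2
  res_ξ : ∀ {V V' : Opens M} (hV : V ≤ U) (h : V' ≤ V) (a),
    N.res h (ξ V hV a) = ξ V' (h.trans hV) a
  res_b : ∀ {V V' : Opens M} (hV : V ≤ U) (h : V' ≤ V) (D),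
    N.res h (b V hV D) = b V' (h.trans hV) D
  dξ_der : ∀ V hV a, IsGradedDerivation (N.deg V) (-1) (dξ V hV a)
  ξdb_der : ∀ V hV a D, IsGradedDerivation (N.deg V) (-1) (ξdb V hV a D)
  db_der : ∀ V hV D, IsGradedDerivation (N.deg V) (-2) (db V hV D)
  res_dξ : ∀ {V V' : Opens M} (hV : V ≤ U) (h : V' ≤ V) (a) (f),
    N.res h (dξ V hV a f) = dξ V' (h.trans hV) a (N.res h f)
  res_ξdb : ∀ {V V' : Opens M} (hV : V ≤ U) (h : V' ≤ V) (a) (D) (f),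
    N.res h (ξdb V hV a D f) = ξdb V' (h.trans hV) a D (N.res h f)
  res_db : ∀ {V V' : Opens M} (hV : V ≤ U) (h : V' ≤ V) (D) (f),
    N.res h (db V hV D f) = db V' (h.trans hV) D (N.res h f)
  dξ_ξ : ∀ V hV a a', dξ V hV a (ξ V hV a') = if a = a' then 1 else 0
  dξ_b : ∀ V hV a D, dξ V hV a (b V hV D) = 0
  ξdb_ξ : ∀ V hV a D a', ξdb V hV a D (ξ V hV a') = 0
  ξdb_b : ∀ V hV a D D', ξdb V hV a D (b V hV D') = if D = D' then ξ V hV a else 0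
  db_b : ∀ V hV D D', db V hV D (b V hV D') = if D = D' then 1 else 0
  eq_sum : ∀ V hV, ∀ f ∈ N.deg V 1, f = ∑ a, dξ V hV a f * ξ V hV a
  induction : ∀ V hV, ∀ T : Submodule ℝ (N.Fn V), 1 ∈ T →
    (∀ c : SmoothOn n V, ∀ f ∈ T, algebraMap (SmoothOn n V) (N.Fn V) c * f ∈ T) →
    (∀ a, ∀ f ∈ T, ξ V hV a * f ∈ T) → (∀ D, ∀ f ∈ T, b V hV D * f ∈ T) → ∀ f, f ∈ T

/-- The coordinate derivations of the model, extended to smooth coefficients by `lTensor`, are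
conjugated by the local isomorphism. They commute with restriction because the isomorphism does and
their coefficients on the model are constant. Later arguments use only the properties recorded in
`Frame`. -/
theorem exists_frame (N : N2Manifold.{u, v} n r s M) (x : M) :
    ∃ U : Opens M, x ∈ U ∧ Nonempty (Frame N U) := by
  obtain ⟨U, hxU, E, hdeg, hres⟩ := N.coords x
  refine ⟨U, hxU, ⟨?_⟩⟩
  let e : ∀ (V : Opens M) (_ : V ≤ U), N.Fn V ≃ₐ[ℝ] SmoothOn n V ⊗[ℝ] CoordAlg r s :=
    fun V hV => (E V hV).restrictScalars ℝ
  have he : ∀ V hV k f, f ∈ N.deg V k ↔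
      e V hV f ∈ tensorDeg (SmoothOn n V) (monomialSet r s) k := fun V hV k f => by
    rw [← modelDeg_eq]
    exact hdeg V hV k f
  have hr : ∀ {V V' : Opens M} (hV : V ≤ U) (h : V' ≤ V) (f : N.Fn V),
      e V' (h.trans hV) (N.res h f) =
        Algebra.TensorProduct.map (smoothRes n h) (AlgHom.id ℝ (CoordAlg r s)) (e V hV f) :=
    fun {V V'} hV h f => hres V V' hV h f
  have hc : ∀ V hV (c : SmoothOn n V),
      (e V hV).symm (c ⊗ₜ 1) = algebraMap (SmoothOn n V) (N.Fn V) c := fun V hV c =>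
    (E V hV).symm.commutes c
  have hmem : ∀ V hV k, ∀ d ∈ monomialSet r s k, (e V hV).symm (1 ⊗ₜ d) ∈ N.deg V k :=
    fun V hV k d hd => by
      rw [he V hV, AlgEquiv.apply_symm_apply]
      exact Submodule.subset_span ⟨1, d, hd, rfl⟩
  have hone : ∀ V hV, (e V hV).symm (1 ⊗ₜ 1) = 1 := fun V hV => map_one (e V hV).symm
  have hzero : ∀ V hV, (e V hV).symm (1 ⊗ₜ 0) = 0 := fun V hV => by
    rw [TensorProduct.tmul_zero, map_zero]
  exact
  { ξ := fun V hV a => (e V hV).symm (1 ⊗ₜ odd s a)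
    b := fun V hV D => (e V hV).symm (1 ⊗ₜ even r D)
    dξ := fun V hV a => transport (e V hV) (partialOdd s a)
    ξdb := fun V hV a D => transport (e V hV) (oddPartialEven a D)
    db := fun V hV D => transport (e V hV) (partialEven r D)
    ξ_mem := fun V hV a => hmem V hV 1 _ (odd_mem a)
    b_mem := fun V hV D => hmem V hV 2 _ (even_mem D)
    res_ξ := fun hV h a => map_symm_one_tmul (hr hV h) _
    res_b := fun hV h a => map_symm_one_tmul (hr hV h) _
    dξ_der := fun V hV a => isGradedDerivation_transport _ (he V hV)
      (isGradedDerivation_partialOdd _ a)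
    ξdb_der := fun V hV a D => isGradedDerivation_transport _ (he V hV)
      (isGradedDerivation_oddPartialEven _ a D)
    db_der := fun V hV D => isGradedDerivation_transport _ (he V hV)
      (isGradedDerivation_partialEven _ D)
    res_dξ := fun hV h a f => transport_comm (hr hV h) _ f
    res_ξdb := fun hV h a D f => transport_comm (hr hV h) _ f
    res_db := fun hV h D f => transport_comm (hr hV h) _ f
    dξ_ξ := fun V hV a a' => by
      rw [transport_symm, partialOdd_odd]
      split_ifs
      · exact hone V hV
      · exact hzero V hV
    dξ_b := fun V hV a D => by rw [transport_symm, partialOdd_even, hzero]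
    ξdb_ξ := fun V hV a D a' => by rw [transport_symm, oddPartialEven_odd, hzero]
    ξdb_b := fun V hV a D D' => by
      rw [transport_symm, oddPartialEven_even]
      split_ifs
      · rfl
      · exact hzero V hV
    db_b := fun V hV D D' => by
      rw [transport_symm, partialEven_even]
      split_ifs
      · exact hone V hV
      · exact hzero V hV
    eq_sum := fun V hV f hf => eq_sum_transport (e V hV)
      (fun _ hd => eq_sum_of_mem_monomialSet_one hd) ((he V hV 1 f).1 hf)
    induction := fun V hV T h1 hcT hξ hb f => by
      refine transport_induction (e V hV) coordAlg_induction T h1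
        (fun c f hf => by rw [hc]; exact hcT c f hf) ?_ f
      rintro x (⟨a, rfl⟩ | ⟨D, rfl⟩) f hf
      · exact hξ a f hf
      · exact hb D f hf }

end Frames

/-! ### Vector fields over open subsets -/

section Local

variable {n r s : ℕ} {M : Type u} [TopologicalSpace M]
  [ChartedSpace (EuclideanSpace ℝ (Fin n)) M] (N : N2Manifold.{u, v} n r s M)

theorem smooth_mem_deg {V : Opens M} (c : SmoothOn n V) :
    algebraMap (SmoothOn n V) (N.Fn V) c ∈ N.deg V 0 := (N.mem_deg_zero V _).2 ⟨c, rfl⟩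

variable {N}

theorem eq_zero_of_mem_deg_neg {V : Opens M} {k : ℤ} (hk : k < 0) {f : N.Fn V}
    (hf : f ∈ N.deg V k) : f = 0 := by
  rwa [N.deg_neg V k hk, Submodule.mem_bot] at hf

namespace IsGradedDerivation

variable {V : Opens M} {k : ℤ} {X Y : Module.End ℝ (N.Fn V)}

theorem zero : IsGradedDerivation (N.deg V) k (0 : Module.End ℝ (N.Fn V)) :=
  ⟨fun _ _ _ => zero_mem _, fun _ _ _ _ => by simp⟩

theorem add (hX : IsGradedDerivation (N.deg V) k X) (hY : IsGradedDerivation (N.deg V) k Y) :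
    IsGradedDerivation (N.deg V) k (X + Y) :=
  ⟨fun i f hf => add_mem (hX.map_deg i f hf) (hY.map_deg i f hf), fun i f hf g => by
    simp only [LinearMap.add_apply, hX.leibniz i f hf, hY.leibniz i f hf, add_mul, mul_add,
      smul_add]
    abel⟩

theorem smul (c : SmoothOn n V) (hX : IsGradedDerivation (N.deg V) k X) :
    IsGradedDerivation (N.deg V) k (c • X) := by
  refine ⟨fun i f hf => ?_, fun i f hf g => ?_⟩
  · rw [LinearMap.smul_apply, Algebra.smul_def, ← zero_add (k + i)]
    exact SetLike.mul_mem_graded (smooth_mem_deg N c) (hX.map_deg i f hf)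
  · simp only [LinearMap.smul_apply, hX.leibniz i f hf, smul_add, smul_mul_assoc, mul_smul_comm,
      negOnePow_smul_eq]
    rw [smul_comm c]

/-- The image lies in degree `k < 0`, where there are no functions. This is why derivations of
negative degree are `C^∞`-linear. -/
theorem map_smooth (hX : IsGradedDerivation (N.deg V) k X) (hk : k < 0) (c : SmoothOn n V) :
    X (algebraMap (SmoothOn n V) (N.Fn V) c) = 0 :=
  eq_zero_of_mem_deg_neg (by omega : k + 0 < 0) (hX.map_deg 0 _ (smooth_mem_deg N c))

theorem map_smooth_mul (hX : IsGradedDerivation (N.deg V) k X) (hk : k < 0) (c : SmoothOn n V)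
    (f : N.Fn V) : X (algebraMap (SmoothOn n V) (N.Fn V) c * f) =
      algebraMap (SmoothOn n V) (N.Fn V) c * X f := by
  rw [hX.leibniz 0 _ (smooth_mem_deg N c), hX.map_smooth hk, zero_mul, zero_add, mul_zero,
    Int.negOnePow_zero, one_smul]

theorem map_smooth_smul (hX : IsGradedDerivation (N.deg V) k X) (hk : k < 0) (c : SmoothOn n V)
    (f : N.Fn V) : X (c • f) = c • X f := by
  rw [Algebra.smul_def, hX.map_smooth_mul hk, Algebra.smul_def]

end IsGradedDerivation

variable (N)

/-- Families of linear endomorphisms of the spaces of functions over the open subsets of `U`. -/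
def LocalOperators (U : Opens M) := ∀ V : Opens M, V ≤ U → Module.End ℝ (N.Fn V)

instance (U : Opens M) : AddCommGroup (LocalOperators N U) :=
  Equiv.addCommGroup (β := ∀ V : {V : Opens M // V ≤ U}, Module.End ℝ (N.Fn V.1))
    { toFun := fun X V => X V.1 V.2
      invFun := fun X V hV => X ⟨V, hV⟩
      left_inv := fun _ => rfl
      right_inv := fun _ => rfl }

instance (U : Opens M) : Module (SmoothOn n U) (LocalOperators N U) where
  smul c X := fun V hV => smoothRes n hV c • X V hV
  one_smul X := funext₂ fun V hV => by
    change smoothRes n hV 1 • X V hV = _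
    rw [map_one, one_smul]
  mul_smul c c' X := funext₂ fun V hV => by
    change smoothRes n hV (c * c') • X V hV = smoothRes n hV c • smoothRes n hV c' • X V hV
    rw [map_mul, mul_smul]
  smul_zero c := funext₂ fun V hV => smul_zero (smoothRes n hV c)
  smul_add c X Y := funext₂ fun V hV => smul_add (smoothRes n hV c) (X V hV) (Y V hV)
  add_smul c c' X := funext₂ fun V hV => by
    change smoothRes n hV (c + c') • X V hV = smoothRes n hV c • X V hV + smoothRes n hV c' • X V hV
    rw [map_add, add_smul]
  zero_smul X := funext₂ fun V hV => by
    change smoothRes n hV 0 • X V hV = 0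
    rw [map_zero, zero_smul]

/-- The vector fields of degree `k` over `U`. -/
def localFields (k : ℤ) (U : Opens M) : Submodule (SmoothOn n U) (LocalOperators N U) where
  carrier := {X |
    (∀ (V V' : Opens M) (hV : V ≤ U) (h : V' ≤ V) (f : N.Fn V),
      N.res h (X V hV f) = X V' (h.trans hV) (N.res h f)) ∧
    ∀ (V : Opens M) (hV : V ≤ U), IsGradedDerivation (N.deg V) k (X V hV)}
  zero_mem' := ⟨fun V V' hV h f => map_zero (N.res h), fun V hV => IsGradedDerivation.zero⟩
  add_mem' := fun {X Y} hX hY => ⟨fun V V' hV h f => by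
    change N.res h (X V hV f + Y V hV f) =
      X V' (h.trans hV) (N.res h f) + Y V' (h.trans hV) (N.res h f)
    rw [map_add, hX.1 V V' hV h, hY.1 V V' hV h], fun V hV => (hX.2 V hV).add (hY.2 V hV)⟩
  smul_mem' := fun c X hX => ⟨fun V V' hV h f => by
    change N.res h (smoothRes n hV c • X V hV f) =
      smoothRes n (h.trans hV) c • X V' (h.trans hV) (N.res h f)
    rw [Algebra.smul_def, Algebra.smul_def, map_mul, N.res_smooth, hX.1 V V' hV h]
    rfl, fun V hV => (hX.2 V hV).smul _⟩

variable {N}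

/-- Restriction of vector fields. -/
def localRes (k : ℤ) {U U' : Opens M} (h : U' ≤ U) : localFields N k U →+ localFields N k U' where
  toFun X := ⟨fun V hV => X.1 V (hV.trans h),
    fun V V' hV h' f => X.2.1 V V' (hV.trans h) h' f, fun V hV => X.2.2 V (hV.trans h)⟩
  map_zero' := rfl
  map_add' _ _ := rfl

theorem localFields_ext {k : ℤ} {U : Opens M} {X Y : localFields N k U}
    (h : ∀ V hV f, X.1 V hV f = Y.1 V hV f) : X = Y :=
  Subtype.ext (funext₂ fun V hV => LinearMap.ext (h V hV))

/-- A vector field of degree `k` on all of `M`, as a vector field over `⊤`. -/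
def vectorFieldsEquiv (k : ℤ) : vectorFields N k ≃+ localFields N k ⊤ where
  toFun X := ⟨fun V _ => X.1 V, fun V V' _ h f => X.2.1 V' V h f,
    fun V _ => ⟨X.2.2.1 V, X.2.2.2 V⟩⟩
  invFun X := ⟨fun V => X.1 V le_top, fun V V' h f => X.2.1 V' V le_top h f,
    fun V => (X.2.2 V le_top).map_deg, fun V => (X.2.2 V le_top).leibniz⟩
  left_inv _ := rfl
  right_inv _ := rfl
  map_add' _ _ := rfl

variable (N) in
/-- A shortcut to the multiplication of vector fields by smooth functions. -/
@[reducible]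
def vectorFieldsSMul (k : ℤ) : SMul (SmoothFn n M) (vectorFields N k) :=
  (vectorFieldsModule N k).toSMul

attribute [local instance] vectorFieldsSMul

/-! ### Gluing of vector fields -/

theorem le_iSup_inf {d : M → Opens M} (hd : ∀ x, x ∈ d x) (V : Opens M) :
    V ≤ iSup fun x => V ⊓ d x := fun x hx => by
  rw [Opens.mem_iSup]
  exact ⟨x, hx, hd x⟩

theorem eq_of_res_eq {d : M → Opens M} (hd : ∀ x, x ∈ d x) {V : Opens M} {f g : N.Fn V}
    (h : ∀ x, N.res (inf_le_left : V ⊓ d x ≤ V) f = N.res inf_le_left g) : f = g :=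
  N.separated V (fun x => V ⊓ d x) (fun _ => inf_le_left) (le_iSup_inf hd V) f g h

theorem localFields_separated {k : ℤ} {d : M → Opens M} (hd : ∀ x, x ∈ d x)
    {X Y : localFields N k ⊤} (h : ∀ x, localRes k (le_top : d x ≤ ⊤) X = localRes k le_top Y) :
    X = Y := by
  refine localFields_ext fun V hV f => eq_of_res_eq hd fun x => ?_
  rw [X.2.1 V _ hV inf_le_left, Y.2.1 V _ hV inf_le_left]
  exact LinearMap.congr_fun (congrFun₂ (congrArg Subtype.val (h x)) (V ⊓ d x) inf_le_right) _

/-- The value on a homogeneous `f` is glued from the values of the `X x` on restrictions of `f`;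
homogeneity is needed because the sheaf glues degree by degree. Separatedness (`uniq`) characterizes
the glued value, and linearity, compatibility with restriction and the Leibniz rule all follow from
that characterization. -/
theorem localFields_glue {k : ℤ} {d : M → Opens M} (hd : ∀ x, x ∈ d x)
    (X : ∀ x, localFields N k (d x))
    (h : ∀ x y, localRes k (inf_le_left : d x ⊓ d y ≤ d x) (X x) = localRes k inf_le_right (X y)) :
    ∃ Y : localFields N k ⊤, ∀ x, localRes k le_top Y = X x := by
  have hom : ∀ (V : Opens M) (i : ℤ), ∀ f ∈ N.deg V i, ∃ g ∈ N.deg V (k + i),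
      ∀ x, N.res (inf_le_left : V ⊓ d x ≤ V) g =
        (X x).1 (V ⊓ d x) inf_le_right (N.res inf_le_left f) := fun V i f hf => by
    refine N.glue V (fun x => V ⊓ d x) (fun _ => inf_le_left) (le_iSup_inf hd V) (k + i)
      (fun x => (X x).1 (V ⊓ d x) inf_le_right (N.res inf_le_left f))
      (fun x => ((X x).2.2 _ _).map_deg i _ (N.res_deg _ i f hf)) fun x y => ?_
    rw [(X x).2.1 _ _ inf_le_right inf_le_left, (X y).2.1 _ _ inf_le_right inf_le_right,
      N.res_res, N.res_res]
    exact LinearMap.congr_fun (congrFun₂ (congrArg Subtype.val (h x y))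
      (V ⊓ d x ⊓ (V ⊓ d y)) (le_inf (inf_le_left.trans inf_le_right)
        (inf_le_right.trans inf_le_right))) _
  have ex : ∀ (V : Opens M) (f : N.Fn V), ∃ g, ∀ x, N.res (inf_le_left : V ⊓ d x ≤ V) g =
      (X x).1 (V ⊓ d x) inf_le_right (N.res inf_le_left f) := fun V f => by
    classical
    -- A general function is a finite sum of homogeneous components, so the components are treated
    -- separately and the results added.
    choose g _ hg using fun i => hom V i (DirectSum.decompose (N.deg V) f i)
      (DirectSum.decompose (N.deg V) f i).2
    refine ⟨∑ i ∈ (DirectSum.decompose (N.deg V) f).support, g i, fun x => ?_⟩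
    conv_rhs => rw [← DirectSum.sum_support_decompose (N.deg V) f]
    rw [map_sum, map_sum, map_sum]
    exact Finset.sum_congr rfl fun i _ => hg i x
  choose Y hY using ex
  have uniq : ∀ {V : Opens M} {f g : N.Fn V}, (∀ x, N.res (inf_le_left : V ⊓ d x ≤ V) g =
      (X x).1 (V ⊓ d x) inf_le_right (N.res inf_le_left f)) → Y V f = g := fun {V f g} hg =>
    eq_of_res_eq hd fun x => by rw [hY, hg]
  let Z : LocalOperators N ⊤ := fun V _ =>
    { toFun := Y V
      map_add' := fun f g => uniq fun x => by simp only [map_add, hY]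
      map_smul' := fun c f => uniq fun x => by simp only [map_smul, hY, RingHom.id_apply] }
  refine ⟨⟨Z, fun V V' hV hV' f => (uniq fun x => ?_).symm, fun V hV => ⟨fun i f hf => ?_,
    fun i f hf g => uniq fun x => ?_⟩⟩, fun x => localFields_ext fun V hV f => uniq fun y => ?_⟩
  · change N.res _ (N.res _ (Y V f)) = _
    have hle : V' ⊓ d x ≤ V ⊓ d x := inf_le_inf_right _ hV'
    rw [N.res_res, ← N.res_res hle inf_le_left, hY, (X x).2.1 _ _ inf_le_right hle, N.res_res,
      N.res_res]
  · obtain ⟨g, hg, hgx⟩ := hom V i f hf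
    change Y V f ∈ _
    rwa [uniq hgx]
  · change N.res _ (Y V f * g + (k * i).negOnePow • (f * Y V g)) = _
    rw [map_mul, ((X x).2.2 _ _).leibniz i _ (N.res_deg _ i f hf), negOnePow_smul_eq,
      negOnePow_smul_eq, map_add, map_smul, map_mul, map_mul, hY, hY]
  · rw [(X x).2.1 _ _ hV inf_le_left]
    exact LinearMap.congr_fun (congrFun₂ (congrArg Subtype.val (h x y))
      (V ⊓ d y) (le_inf (inf_le_left.trans hV) inf_le_right)) _

/-! ### Frames of the modules of vector fields of negative degree -/

open Classical in
/-- The smooth function that is equal to a given function of degree zero. -/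
def smoothPart {V : Opens M} (f : N.Fn V) : SmoothOn n V :=
  if h : ∃ g, algebraMap (SmoothOn n V) (N.Fn V) g = f then h.choose else 0

theorem algebraMap_smoothPart {V : Opens M} {f : N.Fn V} (hf : f ∈ N.deg V 0) :
    algebraMap (SmoothOn n V) (N.Fn V) (smoothPart f) = f := by
  have h := (N.mem_deg_zero V f).1 hf
  rw [smoothPart, dif_pos h]
  exact h.choose_spec

theorem smoothPart_eq {V : Opens M} {f : N.Fn V} {c : SmoothOn n V}
    (h : algebraMap (SmoothOn n V) (N.Fn V) c = f) : smoothPart f = c :=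
  N.smooth_injective V <| by
    rw [algebraMap_smoothPart ((N.mem_deg_zero V f).2 ⟨c, h⟩), h]

theorem smoothPart_res {V V' : Opens M} (h : V' ≤ V) {f : N.Fn V} (hf : f ∈ N.deg V 0) :
    smoothPart (N.res h f) = smoothRes n h (smoothPart f) :=
  smoothPart_eq (by rw [← N.res_smooth, algebraMap_smoothPart hf])

theorem smoothPart_add {V : Opens M} {f g : N.Fn V} (hf : f ∈ N.deg V 0) (hg : g ∈ N.deg V 0) :
    smoothPart (f + g) = smoothPart f + smoothPart g :=
  smoothPart_eq (by rw [map_add, algebraMap_smoothPart hf, algebraMap_smoothPart hg])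

theorem smoothPart_smul {V : Opens M} (c : SmoothOn n V) {f : N.Fn V} (hf : f ∈ N.deg V 0) :
    smoothPart (c • f) = c * smoothPart f :=
  smoothPart_eq (by rw [map_mul, algebraMap_smoothPart hf, Algebra.smul_def])

theorem smoothPart_zero {V : Opens M} : smoothPart (0 : N.Fn V) = 0 :=
  smoothPart_eq (map_zero _)

theorem smoothPart_one {V : Opens M} : smoothPart (1 : N.Fn V) = 1 :=
  smoothPart_eq (map_one _)

namespace Frame

variable {U : Opens M} (F : Frame N U)

/-- A vector field of negative degree that annihilates the coordinates vanishes. -/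
theorem eq_zero {k : ℤ} (hk : k < 0) {V : Opens M} (hV : V ≤ U) (X : localFields N k V)
    (hξ : ∀ a, X.1 V le_rfl (F.ξ V hV a) = 0) (hb : ∀ D, X.1 V le_rfl (F.b V hV D) = 0) :
    X = 0 := by
  refine localFields_ext fun V' hV' f => ?_
  have hX := X.2.2 V' hV'
  have hξ' : ∀ a, X.1 V' hV' (F.ξ V' (hV'.trans hV) a) = 0 := fun a => by
    rw [← F.res_ξ hV hV', ← X.2.1 V V' le_rfl hV', hξ, map_zero]
  have hb' : ∀ D, X.1 V' hV' (F.b V' (hV'.trans hV) D) = 0 := fun D => by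
    rw [← F.res_b hV hV', ← X.2.1 V V' le_rfl hV', hb, map_zero]
  -- The kernel contains `1` and is stable under multiplication by smooth functions and, by the
  -- Leibniz rule, by the coordinates, so it is everything.
  refine F.induction V' (hV'.trans hV) (LinearMap.ker (X.1 V' hV')) ?_ ?_ ?_ ?_ f
  · rw [LinearMap.mem_ker, ← map_one (algebraMap (SmoothOn n V') (N.Fn V')), hX.map_smooth hk]
  · intro c f hf
    rw [LinearMap.mem_ker] at hf ⊢
    rw [hX.map_smooth_mul hk, hf, mul_zero]
  · intro a f hf
    rw [LinearMap.mem_ker] at hf ⊢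
    rw [hX.leibniz 1 _ (F.ξ_mem _ _ a), hξ', hf, zero_mul, mul_zero, smul_zero, zero_add]
  · intro D f hf
    rw [LinearMap.mem_ker] at hf ⊢
    rw [hX.leibniz 2 _ (F.b_mem _ _ D), hb', hf, zero_mul, mul_zero, smul_zero, zero_add]

theorem map_ξ_mem {V : Opens M} (hV : V ≤ U) (X : localFields N (-1) V) (a : Fin r) :
    X.1 V le_rfl (F.ξ V hV a) ∈ N.deg V 0 :=
  (X.2.2 V le_rfl).map_deg 1 _ (F.ξ_mem V hV a)

theorem map_b_mem {V : Opens M} (hV : V ≤ U) (X : localFields N (-1) V) (D : Fin s) :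
    X.1 V le_rfl (F.b V hV D) ∈ N.deg V 1 :=
  (X.2.2 V le_rfl).map_deg 2 _ (F.b_mem V hV D)

theorem dξ_mem {V : Opens M} (hV : V ≤ U) {f : N.Fn V} (hf : f ∈ N.deg V 1) (a : Fin r) :
    F.dξ V hV a f ∈ N.deg V 0 :=
  (F.dξ_der V hV a).map_deg 1 _ hf

theorem map_b_mem' {V : Opens M} (hV : V ≤ U) (X : localFields N (-2) V) (D : Fin s) :
    X.1 V le_rfl (F.b V hV D) ∈ N.deg V 0 :=
  (X.2.2 V le_rfl).map_deg 2 _ (F.b_mem V hV D)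

theorem map_ξ_eq_zero {V : Opens M} (hV : V ≤ U) (X : localFields N (-2) V) (a : Fin r) :
    X.1 V le_rfl (F.ξ V hV a) = 0 :=
  eq_zero_of_mem_deg_neg (by norm_num) ((X.2.2 V le_rfl).map_deg 1 _ (F.ξ_mem V hV a))

/-- The coordinates of a vector field of degree `-1`. -/
def coordsOne {V : Opens M} (hV : V ≤ U) :
    localFields N (-1) V →ₗ[SmoothOn n V] (Fin r ⊕ Fin r × Fin s → SmoothOn n V) where
  toFun X := Sum.elim (fun a => smoothPart (X.1 V le_rfl (F.ξ V hV a)))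
    fun aD => smoothPart (F.dξ V hV aD.1 (X.1 V le_rfl (F.b V hV aD.2)))
  map_add' X Y := by
    funext i
    rcases i with a | ⟨a, D⟩
    · exact smoothPart_add (F.map_ξ_mem hV X a) (F.map_ξ_mem hV Y a)
    · change smoothPart (F.dξ V hV a (X.1 V le_rfl (F.b V hV D) + Y.1 V le_rfl (F.b V hV D))) = _
      rw [map_add]
      exact smoothPart_add (F.dξ_mem hV (F.map_b_mem hV X D) a)
        (F.dξ_mem hV (F.map_b_mem hV Y D) a)
  map_smul' c X := by
    funext i
    rcases i with a | ⟨a, D⟩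
    · exact smoothPart_smul c (F.map_ξ_mem hV X a)
    · change smoothPart (F.dξ V hV a (c • X.1 V le_rfl (F.b V hV D))) = _
      rw [(F.dξ_der V hV a).map_smooth_smul (by norm_num)]
      exact smoothPart_smul c (F.dξ_mem hV (F.map_b_mem hV X D) a)

theorem map_ξ {V : Opens M} (hV : V ≤ U) (X : localFields N (-1) V) (a : Fin r) :
    X.1 V le_rfl (F.ξ V hV a) =
      algebraMap (SmoothOn n V) (N.Fn V) (F.coordsOne hV X (Sum.inl a)) :=
  (algebraMap_smoothPart (F.map_ξ_mem hV X a)).symm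

/-- The value on `b^D` has degree one, hence is linear in the `ξᵃ`. Its coefficients and the
functions `X(ξᵃ)` are all the data of `X`. -/
theorem map_b {V : Opens M} (hV : V ≤ U) (X : localFields N (-1) V) (D : Fin s) :
    X.1 V le_rfl (F.b V hV D) =
      ∑ a, algebraMap (SmoothOn n V) (N.Fn V) (F.coordsOne hV X (Sum.inr (a, D))) *
        F.ξ V hV a := by
  conv_lhs => rw [F.eq_sum V hV _ (F.map_b_mem hV X D)]
  exact Finset.sum_congr rfl fun a _ => by
    rw [← algebraMap_smoothPart (F.dξ_mem hV (F.map_b_mem hV X D) a)]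
    rfl

theorem coordsOne_injective {V : Opens M} (hV : V ≤ U) :
    Function.Injective (F.coordsOne hV) := by
  rw [injective_iff_map_eq_zero]
  intro X hX
  refine F.eq_zero (by norm_num) hV X (fun a => ?_) fun D => ?_
  · rw [F.map_ξ, hX, Pi.zero_apply, map_zero]
  · rw [F.map_b, hX]
    simp

/-- The frame of the vector fields of degree `-1`. -/
def fieldsOne {V : Opens M} (hV : V ≤ U) : Fin r ⊕ Fin r × Fin s → localFields N (-1) V :=
  Sum.elim
    (fun a => ⟨fun V' hV' => F.dξ V' (hV'.trans hV) a,
      fun _ _ hV' h f => F.res_dξ (hV'.trans hV) h a f, fun V' _ => F.dξ_der V' _ a⟩)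
    fun aD => ⟨fun V' hV' => F.ξdb V' (hV'.trans hV) aD.1 aD.2,
      fun _ _ hV' h f => F.res_ξdb (hV'.trans hV) h aD.1 aD.2 f,
      fun V' _ => F.ξdb_der V' _ aD.1 aD.2⟩

theorem coordsOne_fieldsOne {V : Opens M} (hV : V ≤ U) (i : Fin r ⊕ Fin r × Fin s) :
    F.coordsOne hV (F.fieldsOne hV i) = Pi.single i 1 := by
  funext j
  rcases i with a | ⟨a, D⟩ <;> rcases j with a' | ⟨a', D'⟩
  · change smoothPart (F.dξ V hV a (F.ξ V hV a')) = _
    rw [F.dξ_ξ, Pi.single_apply]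
    by_cases h : a = a'
    · subst h; simp [smoothPart_one]
    · simp [h, Ne.symm h, smoothPart_zero]
  · change smoothPart (F.dξ V hV a' (F.dξ V hV a (F.b V hV D'))) = _
    rw [F.dξ_b, map_zero, smoothPart_zero]
    simp
  · change smoothPart (F.ξdb V hV a D (F.ξ V hV a')) = _
    rw [F.ξdb_ξ, smoothPart_zero]
    simp
  · change smoothPart (F.dξ V hV a' (F.ξdb V hV a D (F.b V hV D'))) = _
    rw [F.ξdb_b]
    by_cases hD : D = D'
    · subst hD
      rw [if_pos rfl, F.dξ_ξ]
      by_cases h : a = a'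
      · subst h; simp [smoothPart_one]
      · simp [Ne.symm h, smoothPart_zero]
    · rw [if_neg hD, map_zero, smoothPart_zero]
      simp [Ne.symm hD]

/-- The module of vector fields of degree `-1` over a coordinate neighbourhood is free. -/
def coordsOneEquiv {V : Opens M} (hV : V ≤ U) :
    localFields N (-1) V ≃ₗ[SmoothOn n V] (Fin r ⊕ Fin r × Fin s → SmoothOn n V) :=
  LinearEquiv.ofBijective (F.coordsOne hV) ⟨F.coordsOne_injective hV, fun c =>
    ⟨∑ i, c i • F.fieldsOne hV i, by
      simp only [map_sum, map_smul, F.coordsOne_fieldsOne]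
      exact (pi_eq_sum_univ' c).symm⟩⟩

theorem coordsOne_res {V V' : Opens M} (hV : V ≤ U) (h : V' ≤ V) (X : localFields N (-1) V)
    (i : Fin r ⊕ Fin r × Fin s) :
    F.coordsOne (h.trans hV) (localRes (-1) h X) i = smoothRes n h (F.coordsOne hV X i) := by
  rcases i with a | ⟨a, D⟩
  · change smoothPart (X.1 V' h (F.ξ V' _ a)) = _
    rw [← F.res_ξ hV h, ← X.2.1 V V' le_rfl h, smoothPart_res h (F.map_ξ_mem hV X a)]
    rfl
  · change smoothPart (F.dξ V' _ a (X.1 V' h (F.b V' _ D))) = _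
    rw [← F.res_b hV h, ← X.2.1 V V' le_rfl h, ← F.res_dξ hV h,
      smoothPart_res h (F.dξ_mem hV (F.map_b_mem hV X D) a)]
    rfl

/-- The coordinates of a vector field of degree `-2`. -/
def coordsTwo {V : Opens M} (hV : V ≤ U) :
    localFields N (-2) V →ₗ[SmoothOn n V] (Fin s → SmoothOn n V) where
  toFun X D := smoothPart (X.1 V le_rfl (F.b V hV D))
  map_add' X Y := funext fun D => smoothPart_add (F.map_b_mem' hV X D) (F.map_b_mem' hV Y D)
  map_smul' c X := funext fun D => smoothPart_smul c (F.map_b_mem' hV X D)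

theorem map_b' {V : Opens M} (hV : V ≤ U) (X : localFields N (-2) V) (D : Fin s) :
    X.1 V le_rfl (F.b V hV D) = algebraMap (SmoothOn n V) (N.Fn V) (F.coordsTwo hV X D) :=
  (algebraMap_smoothPart (F.map_b_mem' hV X D)).symm

theorem coordsTwo_injective {V : Opens M} (hV : V ≤ U) :
    Function.Injective (F.coordsTwo hV) := by
  rw [injective_iff_map_eq_zero]
  intro X hX
  refine F.eq_zero (by norm_num) hV X (fun a => F.map_ξ_eq_zero hV X a) fun D => ?_
  rw [F.map_b', hX, Pi.zero_apply, map_zero]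

/-- The frame of the vector fields of degree `-2`. -/
def fieldsTwo {V : Opens M} (hV : V ≤ U) (D : Fin s) : localFields N (-2) V :=
  ⟨fun V' hV' => F.db V' (hV'.trans hV) D,
    fun _ _ hV' h f => F.res_db (hV'.trans hV) h D f, fun V' _ => F.db_der V' _ D⟩

theorem coordsTwo_fieldsTwo {V : Opens M} (hV : V ≤ U) (D : Fin s) :
    F.coordsTwo hV (F.fieldsTwo hV D) = Pi.single D 1 := by
  funext D'
  change smoothPart (F.db V hV D (F.b V hV D')) = _
  rw [F.db_b, Pi.single_apply]
  by_cases h : D = D'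
  · subst h; simp [smoothPart_one]
  · simp [h, Ne.symm h, smoothPart_zero]

/-- The module of vector fields of degree `-2` over a coordinate neighbourhood is free. -/
def coordsTwoEquiv {V : Opens M} (hV : V ≤ U) :
    localFields N (-2) V ≃ₗ[SmoothOn n V] (Fin s → SmoothOn n V) :=
  LinearEquiv.ofBijective (F.coordsTwo hV) ⟨F.coordsTwo_injective hV, fun c =>
    ⟨∑ D, c D • F.fieldsTwo hV D, by
      simp only [map_sum, map_smul, F.coordsTwo_fieldsTwo]
      exact (pi_eq_sum_univ' c).symm⟩⟩

theorem coordsTwo_res {V V' : Opens M} (hV : V ≤ U) (h : V' ≤ V) (X : localFields N (-2) V)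
    (D : Fin s) :
    F.coordsTwo (h.trans hV) (localRes (-2) h X) D = smoothRes n h (F.coordsTwo hV X D) := by
  change smoothPart (X.1 V' h (F.b V' _ D)) = _
  rw [← F.res_b hV h, ← X.2.1 V V' le_rfl h, smoothPart_res h (F.map_b_mem' hV X D)]
  rfl

end Frame

end Local

/-! ### The differential graded Lie algebra of vector fields -/

section Global

variable {n r s : ℕ} {M : Type u} [TopologicalSpace M]
  [ChartedSpace (EuclideanSpace ℝ (Fin n)) M] {N : N2Manifold.{u, v} n r s M}

attribute [local instance] vectorFieldsSMul

theorem vectorFields_ext {k : ℤ} {X Y : vectorFields N k} (h : ∀ U f, X.1 U f = Y.1 U f) : X = Y :=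
  Subtype.ext (funext fun U => LinearMap.ext (h U))

theorem add_apply' {k : ℤ} (X Y : vectorFields N k) (U : Opens M) (f : N.Fn U) :
    (X + Y).1 U f = X.1 U f + Y.1 U f := rfl

theorem neg_apply' {k : ℤ} (X : vectorFields N k) (U : Opens M) (f : N.Fn U) :
    (-X).1 U f = -X.1 U f := rfl

theorem real_smul_apply {k : ℤ} (c : ℝ) (X : vectorFields N k) (U : Opens M) (f : N.Fn U) :
    (c • X).1 U f = c • X.1 U f := rfl

theorem smul_apply' {k : ℤ} (g : SmoothFn n M) (X : vectorFields N k) (U : Opens M) (f : N.Fn U) :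
    (g • X).1 U f = smoothToOpen n U g • X.1 U f := rfl

theorem bracket_apply {k l m : ℤ} (h : k + l = m) (X : vectorFields N k) (Y : vectorFields N l)
    (U : Opens M) (f : N.Fn U) :
    (bracket N h X Y).1 U f = X.1 U (Y.1 U f) - sgn (k * l) • Y.1 U (X.1 U f) := by
  change X.1 U (Y.1 U f) - ((k * l).negOnePow • (Y.1 * X.1) : Operators N) U f = _
  rw [negOnePow_smul_eq]
  rfl

theorem map_smooth_smul' {k : ℤ} (X : vectorFields N k) (U : Opens M) (c : SmoothOn n U)
    (f : N.Fn U) : X.1 U (c • f) =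
      X.1 U (algebraMap (SmoothOn n U) (N.Fn U) c) * f + c • X.1 U f := by
  rw [Algebra.smul_def, X.2.2.2 U 0 _ (smooth_mem_deg N c), mul_zero, Int.negOnePow_zero, one_smul,
    Algebra.smul_def]

theorem map_smooth_eq_zero {k : ℤ} (hk : k < 0) (X : vectorFields N k) (U : Opens M)
    (c : SmoothOn n U) : X.1 U (algebraMap (SmoothOn n U) (N.Fn U) c) = 0 :=
  eq_zero_of_mem_deg_neg (by omega : k + 0 < 0) (X.2.2.1 U 0 _ (smooth_mem_deg N c))

theorem map_smooth_smul_of_neg {k : ℤ} (hk : k < 0) (X : vectorFields N k) (U : Opens M)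
    (c : SmoothOn n U) (f : N.Fn U) : X.1 U (c • f) = c • X.1 U f := by
  rw [map_smooth_smul', map_smooth_eq_zero hk, zero_mul, zero_add]

theorem anchorZero_top {k : ℤ} (hk : k = 0) (X : vectorFields N k) (f : SmoothFn n M) :
    algebraMap (SmoothOn n (⊤ : Opens M)) (N.Fn ⊤) (smoothToOpen n ⊤ (anchorZero N hk X f)) =
      X.1 ⊤ (algebraMap (SmoothOn n (⊤ : Opens M)) (N.Fn ⊤) (smoothToOpen n ⊤ f)) :=
  congrArg Subtype.val ((degZeroEquiv N).apply_symm_apply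
    ((X.1 ⊤).restrict (p := N.deg ⊤ 0) (q := N.deg ⊤ 0)
      (fun f hf => by simpa [hk] using X.2.2.1 ⊤ 0 f hf) (degZeroEquiv N f)))

theorem anchorZero_spec {k : ℤ} (hk : k = 0) (X : vectorFields N k) (f : SmoothFn n M)
    (U : Opens M) :
    algebraMap (SmoothOn n U) (N.Fn U) (smoothToOpen n U (anchorZero N hk X f)) =
      X.1 U (algebraMap (SmoothOn n U) (N.Fn U) (smoothToOpen n U f)) := by
  have h := congrArg (N.res (le_top : U ≤ ⊤)) (anchorZero_top hk X f)
  rwa [N.res_smooth, X.2.1, N.res_smooth] at h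

theorem smoothFn_ext_top {f g : SmoothFn n M}
    (h : algebraMap (SmoothOn n (⊤ : Opens M)) (N.Fn ⊤) (smoothToOpen n ⊤ f) =
      algebraMap (SmoothOn n (⊤ : Opens M)) (N.Fn ⊤) (smoothToOpen n ⊤ g)) : f = g :=
  (smoothTopEquiv n).injective (N.smooth_injective ⊤ h)

theorem bracket_antisymm {k l m : ℤ} (h : k + l = m) (h' : l + k = m) (X : vectorFields N k)
    (Y : vectorFields N l) : bracket N h' Y X = -(sgn (k * l) • bracket N h X Y) := by
  refine vectorFields_ext fun U f => ?_
  rw [neg_apply', real_smul_apply, bracket_apply, bracket_apply, smul_sub, smul_smul,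
    sgn_mul_self, one_smul, neg_sub, mul_comm]

/-- Signs are multiplicative in each degree, so all of them are products of the three signs `p`,
`q`, `t` of the pairs. Comparing the coefficients of the composites of `X`, `Y`, `Z` then needs only
`p² = 1`. -/
theorem bracket_jacobi {i j k ij jk ik m : ℤ} (hij : i + j = ij) (hjk : j + k = jk)
    (hik : i + k = ik) (h₁ : i + jk = m) (h₂ : ij + k = m) (h₃ : j + ik = m)
    (X : vectorFields N i) (Y : vectorFields N j) (Z : vectorFields N k) :
    bracket N h₁ X (bracket N hjk Y Z) = bracket N h₂ (bracket N hij X Y) Z +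
      sgn (i * j) • bracket N h₃ Y (bracket N hik X Z) := by
  refine vectorFields_ext fun U f => ?_
  have e1 : sgn (i * jk) = sgn (i * j) * sgn (i * k) := by rw [← sgn_add, ← hjk, mul_add]
  have e2 : sgn (ij * k) = sgn (i * k) * sgn (j * k) := by rw [← sgn_add, ← hij, add_mul]
  have e3 : sgn (j * ik) = sgn (i * j) * sgn (j * k) := by
    rw [← sgn_add, ← hik, mul_add, mul_comm j i]
  have hp := sgn_mul_self (i * j)
  simp only [add_apply', real_smul_apply, bracket_apply, map_sub, map_smul, e1, e2, e3]
  generalize sgn (i * j) = p at *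
  generalize sgn (i * k) = q at *
  generalize sgn (j * k) = t at *
  match_scalars <;> try ring1
  · linear_combination t * hp
  · linear_combination (-(q * t)) * hp

/-- For odd `Q` the commutator is `[Q,Q] = 2Q²`. -/
theorem sq_eq_zero {Q : vectorFields N 1}
    (hQ : bracket N (show (1 : ℤ) + 1 = 2 by norm_num) Q Q = 0) (U : Opens M) (f : N.Fn U) :
    Q.1 U (Q.1 U f) = 0 := by
  have h : (bracket N (show (1 : ℤ) + 1 = 2 by norm_num) Q Q).1 U f = 0 := by
    rw [hQ]; rfl
  rw [bracket_apply, sgn_odd (by decide), neg_one_smul, sub_neg_eq_add, ← two_smul ℝ] at h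
  exact (smul_eq_zero.1 h).resolve_left two_ne_zero

/-- The terms with `Q²` vanish, and the two terms `QXQ` cancel because the signs for the degrees `k`
and `k + 1` are opposite. -/
theorem dQ_dQ {Q : vectorFields N 1}
    (hQ : bracket N (show (1 : ℤ) + 1 = 2 by norm_num) Q Q = 0) {k l m : ℤ} (h : k + 1 = l)
    (h' : l + 1 = m) (X : vectorFields N k) : dQ N Q h' (dQ N Q h X) = 0 := by
  refine vectorFields_ext fun U f => ?_
  have e : sgn (1 * l) = -sgn (1 * k) := by
    rw [← h, mul_add, sgn_add, sgn_odd (k := 1 * 1) (by decide), mul_neg_one]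
  rw [dQ, dQ, bracket_apply, bracket_apply, bracket_apply, map_sub, sq_eq_zero hQ, map_smul, e,
    sq_eq_zero hQ]
  change _ = (0 : N.Fn U)
  simp

/-- Only the composite in which `Q` acts last meets `f`, and the Leibniz rule there produces the
defect `Q(f)X`. -/
theorem dQ_smul (Q : vectorFields N 1) {k m : ℤ} (h : k + 1 = m) (f : SmoothFn n M)
    (X : vectorFields N k) (U : Opens M) (g : N.Fn U) :
    (dQ N Q h (f • X)).1 U g =
      Q.1 U (algebraMap (SmoothOn n U) (N.Fn U) (smoothToOpen n U f)) * X.1 U g +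
        smoothToOpen n U f • (dQ N Q h X).1 U g := by
  rw [dQ, bracket_apply, bracket_apply, smul_apply', smul_apply', map_smooth_smul', smul_sub,
    smul_comm (sgn (1 * k)), add_sub_assoc]

theorem isStronglyAnchoredDGLA_vectorFields {Q : vectorFields N 1}
    (hQ : bracket N (show (1 : ℤ) + 1 = 2 by norm_num) Q Q = 0) :
    IsStronglyAnchoredDGLA (R := SmoothFn n M) (A := fun k : ℤ => vectorFields N k) 0
      (fun {k l m} h => bracket N (show k + l = m by rw [← h, add_zero]))
      (fun h => dQ N Q h)
      (fun {k} h => anchorZero N (show k = 0 by rw [← h, add_zero])) where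
  antisymm {k l m} h h' a b := by
    have e : sgn ((k + 0) * (l + 0)) = sgn (k * l) := by rw [add_zero, add_zero]
    rw [negOnePow_smul_eq, e]
    exact bracket_antisymm _ _ a b
  jacobi {i j k ij jk ik m} hij hjk hik h₁ h₂ h₃ a b c := by
    have e : sgn ((i + 0) * (j + 0)) = sgn (i * j) := by rw [add_zero, add_zero]
    rw [negOnePow_smul_eq, e]
    exact bracket_jacobi _ _ _ _ _ _ a b c
  sq_zero h h' a := dQ_dQ hQ h h' a
  derivation {k l m k' l' m'} h hm hk hl h₁ h₂ a b := by
    have e : sgn (k + 0) = sgn (1 * k) := by rw [add_zero, one_mul]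
    rw [negOnePow_smul_eq, e]
    -- The differential is the bracket with `Q`, so its derivation property is the Jacobi identity
    -- with first entry `Q`.
    exact bracket_jacobi _ _ _ _ _ _ Q a b
  scalar {k} c f a := by
    refine vectorFields_ext fun U g => ?_
    change smoothToOpen n U (c • f) • a.1 U g = c • smoothToOpen n U f • a.1 U g
    rw [map_smul, smul_assoc]
  leibniz {k l} hk h X f Y := by
    refine vectorFields_ext fun U g => ?_
    change (bracket N _ X (f • Y)).1 U g =
      smoothToOpen n U (anchorZero N _ X f) • Y.1 U g +
        smoothToOpen n U f • (bracket N _ X Y).1 U g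
    rw [bracket_apply, bracket_apply, smul_apply', smul_apply', map_smooth_smul', smul_sub,
      smul_comm (sgn (k * l)), add_sub_assoc, ← anchorZero_spec (by omega),
      ← Algebra.smul_def]
  anchor_linear {k} hk f g X := by
    refine smoothFn_ext_top (N := N) ?_
    rw [anchorZero_spec, map_mul, map_mul, anchorZero_spec]
    change smoothToOpen n ⊤ f • X.1 ⊤ _ = _
    rw [Algebra.smul_def]
  anchor_diff_linear {k l} hk hl f g X := by
    refine smoothFn_ext_top (N := N) ?_
    rw [anchorZero_spec, map_mul, map_mul, anchorZero_spec]
    change (dQ N Q hk (f • X)).1 ⊤ _ = _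
    -- Here `X` has degree `-1` and is evaluated on a smooth function, so the defect `Q(f)X(g)`
    -- vanishes.
    rw [dQ_smul, map_smooth_eq_zero (by omega : k < 0), mul_zero, zero_add, Algebra.smul_def]
  first_order {k l} h f g X := by
    refine vectorFields_ext fun U u => ?_
    change (dQ N Q h ((f * g) • X)).1 U u + smoothToOpen n U (f * g) • (dQ N Q h X).1 U u =
      smoothToOpen n U f • (dQ N Q h (g • X)).1 U u + smoothToOpen n U g • (dQ N Q h (f • X)).1 U u
    -- The defects match because `Q(fg) = Q(f) g + f Q(g)`.
    rw [dQ_smul, dQ_smul, dQ_smul, map_mul, map_mul,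
      ← Algebra.smul_def (smoothToOpen n U f)
        (algebraMap (SmoothOn n U) (N.Fn U) (smoothToOpen n U g)),
      map_smooth_smul', ← Algebra.commutes (smoothToOpen n U g), ← Algebra.smul_def, mul_smul]
    rw [add_mul, smul_mul_assoc, smul_mul_assoc, smul_add, smul_add,
      smul_comm (smoothToOpen n U g) (smoothToOpen n U f)]
    abel

theorem bracket_smul_right {k l m : ℤ} (h : k + l = m) (hk : k < 0) (f : SmoothFn n M)
    (X : vectorFields N k) (Y : vectorFields N l) :
    bracket N h X (f • Y) = f • bracket N h X Y := by
  refine vectorFields_ext fun U g => ?_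
  rw [smul_apply', bracket_apply, bracket_apply, smul_apply', smul_apply',
    map_smooth_smul_of_neg hk, smul_sub, smul_comm (sgn (k * l))]

theorem bracket_smul_left {k l m : ℤ} (h : k + l = m) (hl : l < 0) (f : SmoothFn n M)
    (X : vectorFields N k) (Y : vectorFields N l) :
    bracket N h (f • X) Y = f • bracket N h X Y := by
  refine vectorFields_ext fun U g => ?_
  rw [smul_apply', bracket_apply, bracket_apply, smul_apply', smul_apply',
    map_smooth_smul_of_neg hl, smul_sub, smul_comm (sgn (k * l))]

end Global

/-! ### Instances on the spaces of vector fields. -/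

section Instances

variable {n r s : ℕ} {M : Type u} [TopologicalSpace M]
  [ChartedSpace (EuclideanSpace ℝ (Fin n)) M] (N : N2Manifold.{u, v} n r s M) (k : ℤ)

/-- A shortcut for instance search. -/
@[reducible] def vectorFieldsAddCommGroup : AddCommGroup (vectorFields N k) :=
  Submodule.addCommGroup _

/-- A shortcut for instance search. -/
@[reducible] def vectorFieldsAddCommMonoid : AddCommMonoid (vectorFields N k) :=
  Submodule.addCommMonoid _

/-- A shortcut for instance search. -/
@[reducible] def vectorFieldsRealModule : Module ℝ (vectorFields N k) :=
  Submodule.module _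

end Instances

/-! ### Identities for the derived bracket -/

section Derived

variable {n r s : ℕ} {M : Type u} [TopologicalSpace M]
  [ChartedSpace (EuclideanSpace ℝ (Fin n)) M] {N : N2Manifold.{u, v} n r s M}

attribute [local instance] vectorFieldsSMul vectorFieldsAddCommGroup vectorFieldsAddCommMonoid
  vectorFieldsRealModule

/-- A vector field of degree less than `-2` vanishes. -/
theorem vectorFields_eq_zero {k : ℤ} (hk : k < -2) (X : vectorFields N k) : X = 0 := by
  choose d hd hF using exists_frame N
  refine (vectorFieldsEquiv k).injective (localFields_separated hd fun x => ?_)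
  obtain ⟨F⟩ := hF x
  rw [AddEquiv.map_zero, AddMonoidHom.map_zero]
  -- The coordinates have degree at most two, so below degree `-2` their images have negative degree
  -- and vanish.
  refine F.eq_zero (by omega) le_rfl _ (fun a => ?_) fun D => ?_
  · exact eq_zero_of_mem_deg_neg (by omega : k + 1 < 0) (X.2.2.1 _ 1 _ (F.ξ_mem _ _ a))
  · exact eq_zero_of_mem_deg_neg (by omega : k + 2 < 0) (X.2.2.1 _ 2 _ (F.b_mem _ _ D))

variable (N) in
/-- The product `⟨ψ, φ⟩ = [ψ, φ]` of vector fields of degree `-1`. -/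
abbrev pairing : vectorFields N (-1) →ₗ[ℝ] vectorFields N (-1) →ₗ[ℝ] vectorFields N (-2) :=
  bracket N (show (-1 : ℤ) + -1 = -2 by norm_num)

/-- The differential from degree `-1` to degree `0`. -/
abbrev diffOne (Q : vectorFields N 1) : vectorFields N (-1) →ₗ[ℝ] vectorFields N 0 :=
  dQ N Q (show (-1 : ℤ) + 1 = 0 by norm_num)

/-- The differential from degree `-2` to degree `-1`. -/
abbrev diffTwo (Q : vectorFields N 1) : vectorFields N (-2) →ₗ[ℝ] vectorFields N (-1) :=
  dQ N Q (show (-2 : ℤ) + 1 = -1 by norm_num)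

/-- The derived bracket `[[Q, φ], ψ]`. -/
def derivedBracket (Q : vectorFields N 1) :
    vectorFields N (-1) →ₗ[ℝ] vectorFields N (-1) →ₗ[ℝ] vectorFields N (-1) :=
  bracket N (show (0 : ℤ) + -1 = -1 by norm_num) ∘ₗ diffOne Q

/-- The derived action `[[ψ, Q], v]`. -/
def derivedAction (Q : vectorFields N 1) :
    vectorFields N (-1) →ₗ[ℝ] vectorFields N (-2) →ₗ[ℝ] vectorFields N (-2) :=
  bracket N (show (0 : ℤ) + -2 = -2 by norm_num) ∘ₗ
    (bracket N (show (-1 : ℤ) + 1 = 0 by norm_num)).flip Q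

/-- Both entries are odd, so the commutator is symmetric. This reconciles `[[Q,φ],ψ]` in the bracket
with `[[ψ,Q],v]` in the connection. -/
theorem bracket_Q_eq (Q : vectorFields N 1) (ψ : vectorFields N (-1)) :
    bracket N (show (-1 : ℤ) + 1 = 0 by norm_num) ψ Q = diffOne Q ψ := by
  rw [bracket_antisymm (show (1 : ℤ) + -1 = 0 by norm_num), sgn_odd (by decide), neg_one_smul,
    neg_neg]
  rfl

theorem derivedAction_apply (Q : vectorFields N 1) (ψ : vectorFields N (-1))
    (v : vectorFields N (-2)) : derivedAction Q ψ v =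
      bracket N (show (0 : ℤ) + -2 = -2 by norm_num) (diffOne Q ψ) v := by
  rw [← bracket_Q_eq]
  rfl

theorem pairing_comm (ψ φ : vectorFields N (-1)) : pairing N ψ φ = pairing N φ ψ := by
  rw [pairing, bracket_antisymm (show (-1 : ℤ) + -1 = -2 by norm_num), sgn_odd (by decide),
    neg_one_smul, neg_neg]

/-- In the Jacobi identity for `ψ`, `Q`, `v` the remaining term is `[Q,[ψ,v]]`, and `[ψ,v]` has
degree `-3`, so it is zero. This is the step that uses the absence of coordinates of degree three or
more. -/
theorem pairing_diffTwo (Q : vectorFields N 1) (ψ : vectorFields N (-1))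
    (v : vectorFields N (-2)) : pairing N ψ (diffTwo Q v) = derivedAction Q ψ v := by
  have h := bracket_jacobi (show (-1 : ℤ) + 1 = 0 by norm_num) (show (1 : ℤ) + -2 = -1 by norm_num)
    (show (-1 : ℤ) + -2 = -3 by norm_num) (show (-1 : ℤ) + -1 = -2 by norm_num)
    (show (0 : ℤ) + -2 = -2 by norm_num) (show (1 : ℤ) + -3 = -2 by norm_num) ψ Q v
  rw [vectorFields_eq_zero (by norm_num) (bracket N (show (-1 : ℤ) + -2 = -3 by norm_num) ψ v),
    map_zero, smul_zero, add_zero] at h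
  exact h

/-- Since `d_Q² = 0`, the derivation property gives `[[Q,ψ],[Q,φ₁]] = [Q,[[Q,ψ],φ₁]]`. Inserted into
the Jacobi identity for the degree zero fields `[Q,ψ]`, `[Q,φ₁]` and for `φ₂`, this yields the
claim. -/
theorem derivedBracket_jacobi {Q : vectorFields N 1}
    (hQ : bracket N (show (1 : ℤ) + 1 = 2 by norm_num) Q Q = 0) (ψ φ₁ φ₂ : vectorFields N (-1)) :
    derivedBracket Q ψ (derivedBracket Q φ₁ φ₂) =
      derivedBracket Q (derivedBracket Q ψ φ₁) φ₂ +
        derivedBracket Q φ₁ (derivedBracket Q ψ φ₂) := by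
  have h := bracket_jacobi (show (0 : ℤ) + 0 = 0 by norm_num) (show (0 : ℤ) + -1 = -1 by norm_num)
    (show (0 : ℤ) + -1 = -1 by norm_num) (show (0 : ℤ) + -1 = -1 by norm_num)
    (show (0 : ℤ) + -1 = -1 by norm_num) (show (0 : ℤ) + -1 = -1 by norm_num)
    (diffOne Q ψ) (diffOne Q φ₁) φ₂
  have h' := bracket_jacobi (show (1 : ℤ) + 0 = 1 by norm_num) (show (0 : ℤ) + -1 = -1 by norm_num)
    (show (1 : ℤ) + -1 = 0 by norm_num) (show (1 : ℤ) + -1 = 0 by norm_num)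
    (show (1 : ℤ) + -1 = 0 by norm_num) (show (0 : ℤ) + 0 = 0 by norm_num)
    Q (diffOne Q ψ) φ₁
  rw [sgn_even (by decide), one_smul] at h h'
  have h0 : bracket N (show (1 : ℤ) + 0 = 1 by norm_num) Q (diffOne Q ψ) = 0 :=
    dQ_dQ hQ (show (-1 : ℤ) + 1 = 0 by norm_num) (show (0 : ℤ) + 1 = 1 by norm_num) ψ
  rw [h0, map_zero, LinearMap.zero_apply, zero_add (_ : vectorFields N 0)] at h'
  rw [show bracket N (show (0 : ℤ) + 0 = 0 by norm_num) (diffOne Q ψ) (diffOne Q φ₁) =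
    diffOne Q (derivedBracket Q ψ φ₁) from h'.symm] at h
  exact h

/-- By the derivation property `[Q,[ψ,ψ]] = [[Q,ψ],ψ] - [ψ,[Q,ψ]]`, and by antisymmetry the two
terms on the right are equal. -/
theorem derivedBracket_self (Q : vectorFields N 1) (ψ : vectorFields N (-1)) :
    derivedBracket Q ψ ψ = (1 / 2 : ℝ) • diffTwo Q (pairing N ψ ψ) := by
  have h := bracket_jacobi (show (1 : ℤ) + -1 = 0 by norm_num)
    (show (-1 : ℤ) + -1 = -2 by norm_num) (show (1 : ℤ) + -1 = 0 by norm_num)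
    (show (1 : ℤ) + -2 = -1 by norm_num) (show (0 : ℤ) + -1 = -1 by norm_num)
    (show (-1 : ℤ) + 0 = -1 by norm_num) Q ψ ψ
  rw [bracket_antisymm (show (0 : ℤ) + -1 = -1 by norm_num) (show (-1 : ℤ) + 0 = -1 by norm_num),
    sgn_odd (by decide), sgn_even (by decide), one_smul, neg_one_smul, neg_neg,
    ← two_smul ℝ (_ : vectorFields N (-1))] at h
  have h2 : diffTwo Q (pairing N ψ ψ) = (2 : ℝ) • derivedBracket Q ψ ψ := h
  rw [h2, smul_smul]
  norm_num

/-- The degree zero field `[Q,ψ]` acts as a derivation without signs, and the pairing is symmetric,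
so its two terms coincide. -/
theorem derivedAction_pairing (Q : vectorFields N 1) (ψ φ : vectorFields N (-1)) :
    derivedAction Q ψ (pairing N φ φ) = (2 : ℝ) • pairing N (derivedBracket Q ψ φ) φ := by
  have h := bracket_jacobi (show (0 : ℤ) + -1 = -1 by norm_num)
    (show (-1 : ℤ) + -1 = -2 by norm_num) (show (0 : ℤ) + -1 = -1 by norm_num)
    (show (0 : ℤ) + -2 = -2 by norm_num) (show (-1 : ℤ) + -1 = -2 by norm_num)
    (show (-1 : ℤ) + -1 = -2 by norm_num) (diffOne Q ψ) φ φ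
  rw [sgn_even (by decide), one_smul] at h
  rw [derivedAction_apply, two_smul]
  refine h.trans ?_
  congr 1
  exact pairing_comm _ _

theorem pairing_derivedBracket_self (Q : vectorFields N 1) (ψ φ : vectorFields N (-1)) :
    pairing N ψ (derivedBracket Q φ φ) = (1 / 2 : ℝ) • derivedAction Q ψ (pairing N φ φ) := by
  rw [derivedBracket_self, map_smul, pairing_diffTwo]

/-- Linearity is not visible in `[[ψ,Q],v]`, since `[fψ,Q]` contains `Q(f)ψ`. It is visible in
`[ψ,[Q,v]]`, where `ψ` enters only through the linear pairing. -/
theorem derivedAction_smul_left (Q : vectorFields N 1) (f : SmoothFn n M)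
    (ψ : vectorFields N (-1)) (v : vectorFields N (-2)) :
    derivedAction Q (f • ψ) v = f • derivedAction Q ψ v := by
  rw [← pairing_diffTwo, ← pairing_diffTwo]
  exact bracket_smul_left _ (by norm_num) f ψ _

theorem derivedAction_smul_right {Q : vectorFields N 1}
    (hQ : bracket N (show (1 : ℤ) + 1 = 2 by norm_num) Q Q = 0) (f : SmoothFn n M)
    (ψ : vectorFields N (-1)) (v : vectorFields N (-2)) :
    derivedAction Q ψ (f • v) =
      anchorZero N rfl (diffOne Q ψ) f • v + f • derivedAction Q ψ v := by
  rw [derivedAction_apply, derivedAction_apply]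
  exact (isStronglyAnchoredDGLA_vectorFields hQ).leibniz (k := 0) (l := -2) (by norm_num)
    (by norm_num) (diffOne Q ψ) f v

theorem diffTwo_first_order {Q : vectorFields N 1}
    (hQ : bracket N (show (1 : ℤ) + 1 = 2 by norm_num) Q Q = 0) (f g : SmoothFn n M)
    (v : vectorFields N (-2)) :
    diffTwo Q ((f * g) • v) + (f * g) • diffTwo Q v =
      f • diffTwo Q (g • v) + g • diffTwo Q (f • v) :=
  (isStronglyAnchoredDGLA_vectorFields hQ).first_order (show (-2 : ℤ) + 1 = -1 by norm_num) f g v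

end Derived

/-! ### The algebroid structure obtained from identifications with sections -/

section Transfer

variable {n r s : ℕ} {M : Type u} [TopologicalSpace M]
  [ChartedSpace (EuclideanSpace ℝ (Fin n)) M] {N : N2Manifold.{u, v} n r s M}

attribute [local instance] vectorFieldsSMul vectorFieldsAddCommGroup vectorFieldsAddCommMonoid
  vectorFieldsRealModule

variable {W V : SmoothVectorBundle n M} {eW : vectorFields N (-1) ≃ₗ[ℝ] Sec W}
  {eV : vectorFields N (-2) ≃ₗ[ℝ] Sec V}
  {ρ : ∀ x : M, W.Fib x →ₗ[ℝ] TangentSpace (mdl n) x}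
  {pair : ∀ x : M, W.Fib x →ₗ[ℝ] W.Fib x →ₗ[ℝ] V.Fib x} {Q : vectorFields N 1}

/-- The derived bracket on sections. -/
def secBracket (eW : vectorFields N (-1) ≃ₗ[ℝ] Sec W) (Q : vectorFields N 1) :
    Sec W →ₗ[ℝ] Sec W →ₗ[ℝ] Sec W :=
  eW.arrowCongr (eW.arrowCongr eW) (derivedBracket Q)

/-- The differential on sections. -/
def secDiff (eW : vectorFields N (-1) ≃ₗ[ℝ] Sec W) (eV : vectorFields N (-2) ≃ₗ[ℝ] Sec V)
    (Q : vectorFields N 1) : Sec V →ₗ[ℝ] Sec W :=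
  eV.arrowCongr eW (diffTwo Q)

/-- The connection on sections. -/
def secConn (eW : vectorFields N (-1) ≃ₗ[ℝ] Sec W) (eV : vectorFields N (-2) ≃ₗ[ℝ] Sec V)
    (Q : vectorFields N 1) : Sec W →ₗ[ℝ] Sec V →ₗ[ℝ] Sec V :=
  eW.arrowCongr (eV.arrowCongr eV) (derivedAction Q)

theorem secBracket_apply (φ ψ : vectorFields N (-1)) :
    secBracket eW Q (eW φ) (eW ψ) = eW (derivedBracket Q φ ψ) := by
  simp [secBracket, LinearEquiv.arrowCongr_apply]

theorem secDiff_apply (v : vectorFields N (-2)) :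
    secDiff eW eV Q (eV v) = eW (diffTwo Q v) := by
  simp [secDiff, LinearEquiv.arrowCongr_apply]

theorem secConn_apply (ψ : vectorFields N (-1)) (v : vectorFields N (-2)) :
    secConn eW eV Q (eW ψ) (eV v) = eV (derivedAction Q ψ v) := by
  simp [secConn, LinearEquiv.arrowCongr_apply]

theorem secPair_apply (h : IsInnerProduct W V pair)
    (hpair : ∀ ψ φ x, pair x (eW ψ x) (eW φ x) = eV (pairing N ψ φ) x)
    (ψ φ : vectorFields N (-1)) : secPair h (eW ψ) (eW φ) = eV (pairing N ψ φ) := by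
  ext x
  exact hpair ψ φ x

theorem secConn_leibniz (hQ : bracket N (show (1 : ℤ) + 1 = 2 by norm_num) Q Q = 0)
    (heV : ∀ (f : SmoothFn n M) v, eV (f • v) = fsmul f (eV v))
    (hρ : ∀ ψ f x, dirDeriv n f x (ρ x (eW ψ x)) = anchorZero N rfl (diffOne Q ψ) f x)
    (φ : Sec W) (f : SmoothFn n M) (v : Sec V) (x : M) :
    secConn eW eV Q φ (fsmul f v) x =
      dirDeriv n f x (ρ x (φ x)) • v x + f x • secConn eW eV Q φ v x := by
  obtain ⟨ψ, rfl⟩ := eW.surjective φ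
  obtain ⟨w, rfl⟩ := eV.surjective v
  rw [← heV, secConn_apply, secConn_apply, derivedAction_smul_right hQ, LinearEquiv.map_add, heV, heV, hρ]
  rfl

theorem secBracket_jacobi (hQ : bracket N (show (1 : ℤ) + 1 = 2 by norm_num) Q Q = 0)
    (ψ φ₁ φ₂ : Sec W) : secBracket eW Q ψ (secBracket eW Q φ₁ φ₂) =
      secBracket eW Q (secBracket eW Q ψ φ₁) φ₂ + secBracket eW Q φ₁ (secBracket eW Q ψ φ₂) := by
  obtain ⟨ψ, rfl⟩ := eW.surjective ψ
  obtain ⟨φ₁, rfl⟩ := eW.surjective φ₁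
  obtain ⟨φ₂, rfl⟩ := eW.surjective φ₂
  simp only [secBracket_apply, derivedBracket_jacobi hQ ψ φ₁ φ₂, LinearEquiv.map_add]

/-- Every section comes from a vector field and the identifications intertwine all operations, so
each axiom is one of the derived bracket identities. -/
theorem isVinogradovAlgebroid [IsManifold (mdl n) ∞ M]
    (hQ : bracket N (show (1 : ℤ) + 1 = 2 by norm_num) Q Q = 0)
    (heW : ∀ (f : SmoothFn n M) ψ, eW (f • ψ) = fsmul f (eW ψ))
    (heV : ∀ (f : SmoothFn n M) v, eV (f • v) = fsmul f (eV v))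
    (hρ : ∀ ψ f x, dirDeriv n f x (ρ x (eW ψ x)) = anchorZero N rfl (diffOne Q ψ) f x)
    (hpair : ∀ ψ φ x, pair x (eW ψ x) (eW φ x) = eV (pairing N ψ φ) x)
    (hanchor : IsSmoothAnchor W ρ) (hinner : IsInnerProduct W V pair) :
    IsVinogradovAlgebroid W V ρ (secBracket eW Q) pair (secDiff eW eV Q) (secConn eW eV Q) where
  anchor := hanchor
  inner := hinner
  covers := secConn_leibniz hQ heV hρ
  jacobi := secBracket_jacobi hQ
  symmetric_part ψ := by
    obtain ⟨ψ, rfl⟩ := eW.surjective ψ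
    rw [secPair_apply hinner hpair, secDiff_apply, secBracket_apply, derivedBracket_self, LinearEquiv.map_smul]
  invariant ψ φ := by
    obtain ⟨ψ, rfl⟩ := eW.surjective ψ
    obtain ⟨φ, rfl⟩ := eW.surjective φ
    rw [secBracket_apply, secPair_apply hinner hpair, secPair_apply hinner hpair, secConn_apply,
      derivedAction_pairing, LinearEquiv.map_smul]
  first_order f g v := by
    obtain ⟨v, rfl⟩ := eV.surjective v
    rw [← heV, ← heV, ← heV, secDiff_apply, secDiff_apply, secDiff_apply, secDiff_apply, ← heW,
      ← heW, ← heW, ← LinearEquiv.map_add, diffTwo_first_order hQ, LinearEquiv.map_add]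

theorem isVTwistedCourantAlgebroid [IsManifold (mdl n) ∞ M]
    (hQ : bracket N (show (1 : ℤ) + 1 = 2 by norm_num) Q Q = 0)
    (heW : ∀ (f : SmoothFn n M) ψ, eW (f • ψ) = fsmul f (eW ψ))
    (heV : ∀ (f : SmoothFn n M) v, eV (f • v) = fsmul f (eV v))
    (hρ : ∀ ψ f x, dirDeriv n f x (ρ x (eW ψ x)) = anchorZero N rfl (diffOne Q ψ) f x)
    (hpair : ∀ ψ φ x, pair x (eW ψ x) (eW φ x) = eV (pairing N ψ φ) x)
    (hanchor : IsSmoothAnchor W ρ) (hinner : IsInnerProduct W V pair) :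
    IsVTwistedCourantAlgebroid W V ρ (secBracket eW Q) pair (secConn eW eV Q) where
  anchor := hanchor
  inner := hinner
  conn_linear f ψ v := by
    obtain ⟨ψ, rfl⟩ := eW.surjective ψ
    obtain ⟨v, rfl⟩ := eV.surjective v
    rw [← heW, secConn_apply, secConn_apply, derivedAction_smul_left, heV]
  conn_leibniz := secConn_leibniz hQ heV hρ
  jacobi := secBracket_jacobi hQ
  invariant_left ψ φ := by
    obtain ⟨ψ, rfl⟩ := eW.surjective ψ
    obtain ⟨φ, rfl⟩ := eW.surjective φ
    rw [secBracket_apply, secPair_apply hinner hpair, secPair_apply hinner hpair, secConn_apply,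
      derivedAction_pairing, LinearEquiv.map_smul, smul_smul]
    norm_num
  invariant_right ψ φ := by
    obtain ⟨ψ, rfl⟩ := eW.surjective ψ
    obtain ⟨φ, rfl⟩ := eW.surjective φ
    rw [secBracket_apply, secPair_apply hinner hpair, secPair_apply hinner hpair, secConn_apply,
      pairing_derivedBracket_self, LinearEquiv.map_smul]

theorem secPair_secDiff (hpair : ∀ ψ φ x, pair x (eW ψ x) (eW φ x) = eV (pairing N ψ φ) x)
    (h : IsInnerProduct W V pair) (ψ : Sec W) (v : Sec V) :
    secPair h ψ (secDiff eW eV Q v) = secConn eW eV Q ψ v := by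
  obtain ⟨ψ, rfl⟩ := eW.surjective ψ
  obtain ⟨v, rfl⟩ := eV.surjective v
  rw [secDiff_apply, secPair_apply h hpair, secConn_apply, pairing_diffTwo]

end Transfer

/-! ### Vector fields of negative degree as sections of vector bundles -/

section FieldsFrame

variable {n r s : ℕ} {M : Type u} [TopologicalSpace M]
  [ChartedSpace (EuclideanSpace ℝ (Fin n)) M]

/-- Frames, indexed by `ι`, of the modules of vector fields of degree `k` near each point. -/
structure FieldsFrame (N : N2Manifold.{u, v} n r s M) (k : ℤ) (ι : Type) where
  /-- A neighbourhood of `x` with a frame. -/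
  dom : M → Opens M
  mem_dom : ∀ x, x ∈ dom x
  /-- The coordinates with respect to the frame near `x`. -/
  coord : ∀ (x : M) (V : Opens M), V ≤ dom x →
    localFields N k V ≃ₗ[SmoothOn n V] (ι → SmoothOn n V)
  coord_res : ∀ (x : M) {U V : Opens M} (hV : V ≤ dom x) (h : U ≤ V) (X : localFields N k V)
    (i : ι), coord x U (h.trans hV) (localRes k h X) i = smoothRes n h (coord x V hV X i)

variable {N : N2Manifold.{u, v} n r s M} {k : ℤ} {ι : Type} [Fintype ι]

attribute [local instance] vectorFieldsSMul vectorFieldsAddCommGroup vectorFieldsAddCommMonoid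
  vectorFieldsRealModule

namespace FieldsFrame

variable (E : FieldsFrame N k ι)

/-- The locally free sheaf of vector fields of degree `k`. -/
def sheaf : LocallyFreeSheaf n M (Fintype.card ι) where
  S U := localFields N k U
  res h := localRes k h
  res_smul _ _ _ := rfl
  res_res _ _ _ := rfl
  dom := E.dom
  mem_dom := E.mem_dom
  coord x V hV := E.coord x V hV ≪≫ₗ LinearEquiv.funCongrLeft _ _ (Fintype.equivFin ι).symm
  coord_res x _ _ hV h X _ := E.coord_res x hV h X _
  separated _ _ h := localFields_separated E.mem_dom h
  glue X h := localFields_glue E.mem_dom X h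

/-- The vector bundle whose sections are the vector fields of degree `k`. -/
def bundle : SmoothVectorBundle n M := E.sheaf.bundle

/-- The fibre at `p` is identified with `ℝ^ι` by the chosen frame near `p`. -/
def fiberEquiv (p : M) : E.bundle.Fib p ≃ₗ[ℝ] (ι → ℝ) :=
  E.sheaf.fibCoord p ≪≫ₗ WithLp.linearEquiv 2 ℝ (Fin (Fintype.card ι) → ℝ) ≪≫ₗ
    LinearEquiv.funCongrLeft ℝ ℝ (Fintype.equivFin ι)

/-- The section of the bundle given by a vector field. -/
def toSec (X : vectorFields N k) : Sec E.bundle :=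
  E.sheaf.toSec (vectorFieldsEquiv k X)

theorem toSec_smul (f : SmoothFn n M) (X : vectorFields N k) :
    E.toSec (f • X) = fsmul f (E.toSec X) :=
  E.sheaf.toSec_smul f (vectorFieldsEquiv k X)

/-- The vector fields of degree `k` are the sections of the bundle. -/
def secEquiv : vectorFields N k ≃ₗ[ℝ] Sec E.bundle :=
  LinearEquiv.ofBijective
    { toFun := E.toSec
      map_add' := fun X Y => E.sheaf.toSec_add (vectorFieldsEquiv k X) (vectorFieldsEquiv k Y)
      map_smul' := fun c X => by
        -- Real scalars act as constant functions, so real linearity is a case of linearity over the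
        -- smooth functions.
        have h : c • X = (algebraMap ℝ (SmoothFn n M) c) • X :=
          vectorFields_ext fun U f => by
            rw [real_smul_apply, smul_apply', AlgHom.commutes, algebraMap_smul]
        rw [h, E.toSec_smul]
        rfl }
    ⟨E.sheaf.toSec_injective.comp (vectorFieldsEquiv k).injective,
      E.sheaf.toSec_surjective.comp (vectorFieldsEquiv k).surjective⟩

theorem secEquiv_smul (f : SmoothFn n M) (X : vectorFields N k) :
    E.secEquiv (f • X) = fsmul f (E.secEquiv X) :=
  E.toSec_smul f X

theorem fiberEquiv_secEquiv (X : vectorFields N k) (p : M) (i : ι) :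
    E.fiberEquiv p (E.secEquiv X p) i =
      E.coord p (E.dom p) le_rfl (localRes k le_top (vectorFieldsEquiv k X)) i
        ⟨p, E.mem_dom p⟩ := by
  change E.coord p (E.dom p) le_rfl (localRes k le_top (vectorFieldsEquiv k X))
    ((Fintype.equivFin ι).symm (Fintype.equivFin ι i)) ⟨p, E.mem_dom p⟩ = _
  rw [Equiv.symm_apply_apply]

end FieldsFrame

end FieldsFrame

/-! ### The pairing -/

section Pairing

variable {n r s : ℕ} {M : Type u} [TopologicalSpace M]
  [ChartedSpace (EuclideanSpace ℝ (Fin n)) M] {N : N2Manifold.{u, v} n r s M}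
  {d : M → Opens M}

/-- The frames of the modules of vector fields of degree `-1`. -/
def frameOne (F : ∀ x, Frame N (d x)) (hd : ∀ x, x ∈ d x) :
    FieldsFrame N (-1) (Fin r ⊕ Fin r × Fin s) where
  dom := d
  mem_dom := hd
  coord x _ hV := (F x).coordsOneEquiv hV
  coord_res x _ _ hV h X i := (F x).coordsOne_res hV h X i

/-- The frames of the modules of vector fields of degree `-2`. -/
def frameTwo (F : ∀ x, Frame N (d x)) (hd : ∀ x, x ∈ d x) : FieldsFrame N (-2) (Fin s) where
  dom := d
  mem_dom := hd
  coord x _ hV := (F x).coordsTwoEquiv hV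
  coord_res x _ _ hV h X i := (F x).coordsTwo_res hV h X i

/-- The pairing in coordinates. -/
def pairCoord (r s : ℕ) : (Fin r ⊕ Fin r × Fin s → ℝ) →ₗ[ℝ] (Fin r ⊕ Fin r × Fin s → ℝ) →ₗ[ℝ]
    (Fin s → ℝ) :=
  LinearMap.mk₂ ℝ (fun u w D => ∑ a, (u (.inl a) * w (.inr (a, D)) + w (.inl a) * u (.inr (a, D))))
    (fun u u' w => by
      ext D
      simp only [Pi.add_apply, ← Finset.sum_add_distrib]
      exact Finset.sum_congr rfl fun a _ => by ring)
    (fun c u w => by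
      ext D
      simp only [Pi.smul_apply, smul_eq_mul, Finset.mul_sum]
      exact Finset.sum_congr rfl fun a _ => by ring)
    (fun u w w' => by
      ext D
      simp only [Pi.add_apply, ← Finset.sum_add_distrib]
      exact Finset.sum_congr rfl fun a _ => by ring)
    (fun c u w => by
      ext D
      simp only [Pi.smul_apply, smul_eq_mul, Finset.mul_sum]
      exact Finset.sum_congr rfl fun a _ => by ring)

theorem pairCoord_apply (u w : Fin r ⊕ Fin r × Fin s → ℝ) (D : Fin s) : pairCoord r s u w D =
    ∑ a, (u (.inl a) * w (.inr (a, D)) + w (.inl a) * u (.inr (a, D))) := rfl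

theorem pairCoord_comm (u w : Fin r ⊕ Fin r × Fin s → ℝ) :
    pairCoord r s u w = pairCoord r s w u := by
  ext D
  rw [pairCoord_apply, pairCoord_apply]
  exact Finset.sum_congr rfl fun a _ => by ring

theorem pairCoord_single_inl (u : Fin r ⊕ Fin r × Fin s → ℝ) (a : Fin r) (D : Fin s) :
    pairCoord r s u (Pi.single (.inl a) 1) D = u (.inr (a, D)) := by
  rw [pairCoord_apply, Finset.sum_eq_single a]
  · simp
  · intro b _ hb
    simp [hb]
  · simp

theorem pairCoord_single_inr (u : Fin r ⊕ Fin r × Fin s → ℝ) (a : Fin r) (D : Fin s) :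
    pairCoord r s u (Pi.single (.inr (a, D)) 1) D = u (.inl a) := by
  rw [pairCoord_apply, Finset.sum_eq_single a]
  · simp
  · intro b _ hb
    simp [hb]
  · simp

/-- The component `uᵃ` is detected by `ξᵃ∂/∂b^D` for any one `D`, which exists as `0 < s`; the
component `u^{aD}` is detected by `∂/∂ξᵃ`. -/
theorem pairCoord_nondegenerate (hs : 0 < s) {u : Fin r ⊕ Fin r × Fin s → ℝ}
    (hu : u ≠ 0) : ∃ w, pairCoord r s u w ≠ 0 := by
  obtain ⟨i, hi⟩ := Function.ne_iff.1 hu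
  rcases i with a | ⟨a, D⟩
  · exact ⟨Pi.single (.inr (a, ⟨0, hs⟩)) 1, fun h => hi <| by
      rw [← pairCoord_single_inr u a ⟨0, hs⟩, h]; rfl⟩
  · exact ⟨Pi.single (.inl a) 1, fun h => hi <| by rw [← pairCoord_single_inl u a D, h]; rfl⟩

/-- Pairing with a single `∂/∂ξᵃ`, available as `0 < r`, reads off the components `u^{aD}`, which
may be prescribed. Every vector is thus the pairing of two vectors, without sums. -/
theorem pairCoord_surjective (hr : 0 < r) (v : Fin s → ℝ) :
    ∃ u w, pairCoord r s u w = v :=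
  ⟨Sum.elim 0 fun aD => v aD.2, Pi.single (.inl ⟨0, hr⟩) 1, funext fun D =>
    pairCoord_single_inl _ _ D⟩

/-- The pairing of the vector bundles. -/
def fiberPairing (F : ∀ x, Frame N (d x)) (hd : ∀ x, x ∈ d x) (x : M) :
    (frameOne F hd).bundle.Fib x →ₗ[ℝ] (frameOne F hd).bundle.Fib x →ₗ[ℝ]
      (frameTwo F hd).bundle.Fib x :=
  ((pairCoord r s).compl₁₂ ((frameOne F hd).fiberEquiv x).toLinearMap
    ((frameOne F hd).fiberEquiv x).toLinearMap).compr₂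
    ((frameTwo F hd).fiberEquiv x).symm.toLinearMap

theorem fiberPairing_apply (F : ∀ x, Frame N (d x)) (hd : ∀ x, x ∈ d x) (x : M)
    (w w' : (frameOne F hd).bundle.Fib x) : fiberPairing F hd x w w' =
      ((frameTwo F hd).fiberEquiv x).symm (pairCoord r s ((frameOne F hd).fiberEquiv x w)
        ((frameOne F hd).fiberEquiv x w')) := rfl

attribute [local instance] vectorFieldsSMul vectorFieldsAddCommGroup vectorFieldsAddCommMonoid
  vectorFieldsRealModule

theorem Frame.map_map_b {U V : Opens M} (F : Frame N U) (hV : V ≤ U)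
    (X Y : localFields N (-1) V) (D : Fin s) : X.1 V le_rfl (Y.1 V le_rfl (F.b V hV D)) =
      algebraMap (SmoothOn n V) (N.Fn V)
        (∑ a, F.coordsOne hV Y (.inr (a, D)) * F.coordsOne hV X (.inl a)) := by
  rw [F.map_b, map_sum, map_sum]
  exact Finset.sum_congr rfl fun a _ => by
    rw [(X.2.2 V le_rfl).map_smooth_mul (by norm_num), F.map_ξ, map_mul]

/-- For fields of degree `-1` the bracket is `ψφ + φψ`. On `b^D` the inner field gives a combination
of the `ξᵃ`, whose coefficients the outer field passes through by linearity. -/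
theorem coordsTwo_pairing {U : Opens M} (F : Frame N U) (ψ φ : vectorFields N (-1)) (D : Fin s) :
    F.coordsTwo le_rfl (localRes (-2) le_top (vectorFieldsEquiv (-2) (pairing N ψ φ))) D =
      ∑ a, (F.coordsOne le_rfl (localRes (-1) le_top (vectorFieldsEquiv (-1) ψ)) (.inl a) *
          F.coordsOne le_rfl (localRes (-1) le_top (vectorFieldsEquiv (-1) φ)) (.inr (a, D)) +
        F.coordsOne le_rfl (localRes (-1) le_top (vectorFieldsEquiv (-1) φ)) (.inl a) *
          F.coordsOne le_rfl (localRes (-1) le_top (vectorFieldsEquiv (-1) ψ)) (.inr (a, D))) := by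
  apply N.smooth_injective U
  rw [← F.map_b']
  change (pairing N ψ φ).1 U (F.b U le_rfl D) = _
  rw [bracket_apply, sgn_odd (by decide), neg_one_smul, sub_neg_eq_add]
  refine (congrArg₂ (· + ·)
    (F.map_map_b le_rfl (localRes (-1) le_top (vectorFieldsEquiv (-1) ψ))
      (localRes (-1) le_top (vectorFieldsEquiv (-1) φ)) D)
    (F.map_map_b le_rfl (localRes (-1) le_top (vectorFieldsEquiv (-1) φ))
      (localRes (-1) le_top (vectorFieldsEquiv (-1) ψ)) D)).trans ?_
  rw [← map_add, ← Finset.sum_add_distrib]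
  congr 1
  exact Finset.sum_congr rfl fun a _ => by ring

variable (F : ∀ x, Frame N (d x)) (hd : ∀ x, x ∈ d x)

theorem fiberPairing_secEquiv (ψ φ : vectorFields N (-1)) (x : M) :
    fiberPairing F hd x ((frameOne F hd).secEquiv ψ x) ((frameOne F hd).secEquiv φ x) =
      (frameTwo F hd).secEquiv (pairing N ψ φ) x := by
  rw [fiberPairing_apply, LinearEquiv.symm_apply_eq]
  funext D
  rw [pairCoord_apply, FieldsFrame.fiberEquiv_secEquiv]
  simp only [FieldsFrame.fiberEquiv_secEquiv]
  have h := congrArg (fun g => g ⟨x, hd x⟩) (coordsTwo_pairing (F x) ψ φ D)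
  simp only [sum_smoothOn_apply] at h
  exact h.symm

theorem isInnerProduct_fiberPairing (hr : 0 < r) (hs : 0 < s) :
    IsInnerProduct (frameOne F hd).bundle (frameTwo F hd).bundle (fiberPairing F hd) where
  smooth σ τ := by
    obtain ⟨ψ, rfl⟩ := (frameOne F hd).secEquiv.surjective σ
    obtain ⟨φ, rfl⟩ := (frameOne F hd).secEquiv.surjective τ
    exact ⟨_, fun x => (fiberPairing_secEquiv F hd ψ φ x).symm⟩
  symm x φ ψ := by rw [fiberPairing_apply, pairCoord_comm, fiberPairing_apply]
  nondegenerate x φ hφ := by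
    obtain ⟨w, hw⟩ := pairCoord_nondegenerate hs
      (((frameOne F hd).fiberEquiv x).map_ne_zero_iff.2 hφ)
    refine ⟨((frameOne F hd).fiberEquiv x).symm w, ?_⟩
    rw [fiberPairing_apply, LinearEquiv.apply_symm_apply]
    exact (LinearEquiv.map_ne_zero_iff _).2 hw
  surjective x v := by
    obtain ⟨u, w, h⟩ := pairCoord_surjective hr ((frameTwo F hd).fiberEquiv x v)
    refine ⟨((frameOne F hd).fiberEquiv x).symm u ⊗ₜ ((frameOne F hd).fiberEquiv x).symm w, ?_⟩
    rw [TensorProduct.lift.tmul, fiberPairing_apply, LinearEquiv.apply_symm_apply,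
      LinearEquiv.apply_symm_apply, h, LinearEquiv.symm_apply_apply]

end Pairing

/-! ### The anchor -/

section Anchor

variable {n r s : ℕ} {M : Type u} [TopologicalSpace M]
  [ChartedSpace (EuclideanSpace ℝ (Fin n)) M] {N : N2Manifold.{u, v} n r s M}

theorem smoothPart_real_smul {V : Opens M} (c : ℝ) {f : N.Fn V} (hf : f ∈ N.deg V 0) :
    smoothPart (c • f) = c • smoothPart f := by
  rw [← algebraMap_smul (SmoothOn n V) c f, smoothPart_smul _ hf, ← Algebra.smul_def]

theorem algebraMap_real_smul {V : Opens M} (c : ℝ) (f : SmoothOn n V) :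
    algebraMap (SmoothOn n V) (N.Fn V) (c • f) = c • algebraMap (SmoothOn n V) (N.Fn V) f :=
  (IsScalarTower.toAlgHom ℝ (SmoothOn n V) (N.Fn V)).toLinearMap.map_smul c f

/-- The derivation of germs at `p` given by operators near `p` that restrict to derivations of the
smooth functions. -/
def GermDerivation.ofOperators {U : Opens M} {p : M} (hp : p ∈ U)
    (T : ∀ V : Opens M, V ≤ U → Module.End ℝ (N.Fn V))
    (res_T : ∀ {V V' : Opens M} (hV : V ≤ U) (h : V' ≤ V) (f : N.Fn V),
      N.res h (T V hV f) = T V' (h.trans hV) (N.res h f))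
    (mem : ∀ (V : Opens M) (hV : V ≤ U) (f : SmoothOn n V),
      T V hV (algebraMap (SmoothOn n V) (N.Fn V) f) ∈ N.deg V 0)
    (leibniz : ∀ (V : Opens M) (hV : V ≤ U) (f g : SmoothOn n V),
      T V hV (algebraMap (SmoothOn n V) (N.Fn V) f * algebraMap (SmoothOn n V) (N.Fn V) g) =
        T V hV (algebraMap (SmoothOn n V) (N.Fn V) f) * algebraMap (SmoothOn n V) (N.Fn V) g +
          algebraMap (SmoothOn n V) (N.Fn V) f * T V hV (algebraMap (SmoothOn n V) (N.Fn V) g)) :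
    GermDerivation n p where
  toFun V hV :=
    -- The operators exist only inside `U`, while `V` is an arbitrary neighbourhood of `p`; hence
    -- the restriction to `V ⊓ U` before evaluating at `p`.
    { toFun := fun f => smoothPart (T (V ⊓ U) inf_le_right
        (algebraMap (SmoothOn n (V ⊓ U : Opens M)) (N.Fn (V ⊓ U)) (smoothRes n inf_le_left f)))
          ⟨p, Opens.mem_inf.2 ⟨hV, hp⟩⟩
      map_add' := fun f g => by
        rw [map_add, map_add, map_add, smoothPart_add (mem _ _ _) (mem _ _ _)]
        rfl
      map_smul' := fun c f => by
        rw [map_smul, algebraMap_real_smul, map_smul, smoothPart_real_smul _ (mem _ _ _)]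
        rfl }
  map_res {V' V} h hV' f := by
    have hle : V' ⊓ U ≤ V ⊓ U := inf_le_inf_right _ h
    change smoothPart (T (V' ⊓ U) _ (algebraMap _ (N.Fn (V' ⊓ U))
      (smoothRes n hle (smoothRes n inf_le_left f)))) _ = _
    rw [← N.res_smooth, ← res_T inf_le_right hle, smoothPart_res hle (mem _ _ _)]
    rfl
  map_mul V hV f g := by
    have h : smoothPart (T (V ⊓ U) inf_le_right (algebraMap (SmoothOn n (V ⊓ U : Opens M))
        (N.Fn (V ⊓ U)) (smoothRes n inf_le_left (f * g)))) =
        smoothPart (T (V ⊓ U) inf_le_right (algebraMap (SmoothOn n (V ⊓ U : Opens M))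
          (N.Fn (V ⊓ U)) (smoothRes n inf_le_left f))) * smoothRes n inf_le_left g +
        smoothRes n inf_le_left f * smoothPart (T (V ⊓ U) inf_le_right
          (algebraMap (SmoothOn n (V ⊓ U : Opens M)) (N.Fn (V ⊓ U))
            (smoothRes n inf_le_left g))) :=
      smoothPart_eq <| by
        rw [_root_.map_mul (smoothRes n _), _root_.map_mul, leibniz, map_add, _root_.map_mul,
          _root_.map_mul,
          algebraMap_smoothPart (mem _ _ _), algebraMap_smoothPart (mem _ _ _)]
    exact congrArg (fun g => g ⟨p, Opens.mem_inf.2 ⟨hV, hp⟩⟩) h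

theorem GermDerivation.ofOperators_apply {U : Opens M} {p : M} (hp : p ∈ U)
    (T : ∀ V : Opens M, V ≤ U → Module.End ℝ (N.Fn V)) (res_T) (mem) (leibniz) {V : Opens M}
    (hV : p ∈ V) (f : SmoothOn n V) : (ofOperators hp T res_T mem leibniz).toFun V hV f =
      smoothPart (T (V ⊓ U) inf_le_right (algebraMap (SmoothOn n (V ⊓ U : Opens M))
        (N.Fn (V ⊓ U)) (smoothRes n inf_le_left f))) ⟨p, Opens.mem_inf.2 ⟨hV, hp⟩⟩ := rfl

theorem map_smooth_mul_smooth {k : ℤ} (X : vectorFields N k) (V : Opens M) (f g : SmoothOn n V) :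
    X.1 V (algebraMap (SmoothOn n V) (N.Fn V) f * algebraMap (SmoothOn n V) (N.Fn V) g) =
      X.1 V (algebraMap (SmoothOn n V) (N.Fn V) f) * algebraMap (SmoothOn n V) (N.Fn V) g +
        algebraMap (SmoothOn n V) (N.Fn V) f * X.1 V (algebraMap (SmoothOn n V) (N.Fn V) g) := by
  rw [X.2.2.2 V 0 _ (smooth_mem_deg N f), mul_zero, Int.negOnePow_zero, one_smul]

/-- The derivation of germs at `p` given by a vector field of degree zero. -/
def germZero (Z : vectorFields N 0) (p : M) : GermDerivation n p :=
  GermDerivation.ofOperators (N := N) (U := ⊤) (Opens.mem_top p) (fun V _ => Z.1 V)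
    (fun _ h f => Z.2.1 _ _ h f) (fun V _ f => Z.2.2.1 V 0 _ (smooth_mem_deg N f))
    (fun V _ f g => map_smooth_mul_smooth Z V f g)

theorem germZero_apply (Z : vectorFields N 0) {p : M} {V : Opens M} (hV : p ∈ V)
    (f : SmoothOn n V) : (germZero Z p).toFun V hV f =
      smoothPart (Z.1 V (algebraMap (SmoothOn n V) (N.Fn V) f)) ⟨p, hV⟩ := by
  rw [germZero, GermDerivation.ofOperators_apply, ← N.res_smooth, ← Z.2.1,
    smoothPart_res _ (Z.2.2.1 V 0 _ (smooth_mem_deg N f))]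
  rfl

theorem dirDeriv_germZero [IsManifold (mdl n) ∞ M] (Z : vectorFields N 0) (f : SmoothFn n M)
    (p : M) : dirDeriv n f p (germZero Z p).toTangent = anchorZero N rfl Z f p := by
  rw [(germZero Z p).dirDeriv_toTangent f (V := ⊤) (Opens.mem_top p), germZero_apply,
    smoothPart_eq (anchorZero_spec rfl Z f ⊤)]
  rfl

theorem contMDiff_germZero [IsManifold (mdl n) ∞ M] (Z : vectorFields N 0) :
    ContMDiff (mdl n) (mdl n).tangent ∞
      (fun p => (⟨p, (germZero Z p).toTangent⟩ : TangentBundle (mdl n) M)) :=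
  GermDerivation.contMDiff_toTangent _ fun V f =>
    ⟨smoothPart (Z.1 V (algebraMap (SmoothOn n V) (N.Fn V) f)), fun _ hp =>
      (germZero_apply Z hp f).symm⟩

/-- The derivation `f ↦ ∂(Q f)/∂ξᵃ` of germs at `p`. -/
def Frame.germ {U : Opens M} (F : Frame N U) (Q : vectorFields N 1) {p : M} (hp : p ∈ U)
    (a : Fin r) : GermDerivation n p :=
  GermDerivation.ofOperators hp (fun V hV => F.dξ V hV a ∘ₗ Q.1 V)
    (fun hV h f => by
      simp only [LinearMap.comp_apply]
      rw [F.res_dξ hV h, Q.2.1])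
    (fun V hV f => F.dξ_mem hV (Q.2.2.1 V 0 _ (smooth_mem_deg N f)) a)
    (fun V hV f g => by
      simp only [LinearMap.comp_apply]
      -- The term of the wrong sign in the graded Leibniz rule contains `∂g/∂ξᵃ = 0`, so an ordinary
      -- derivation remains.
      rw [map_smooth_mul_smooth, map_add,
        (F.dξ_der V hV a).leibniz 1 _ (Q.2.2.1 V 0 _ (smooth_mem_deg N f)),
        (F.dξ_der V hV a).map_smooth (by norm_num), mul_zero, smul_zero, add_zero,
        (F.dξ_der V hV a).map_smooth_mul (by norm_num)])

attribute [local instance] vectorFieldsSMul vectorFieldsAddCommGroup vectorFieldsAddCommMonoid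
  vectorFieldsRealModule

theorem diffOne_map_smooth (Q : vectorFields N 1) (ψ : vectorFields N (-1)) (V : Opens M)
    (f : SmoothOn n V) : (diffOne Q ψ).1 V (algebraMap (SmoothOn n V) (N.Fn V) f) =
      ψ.1 V (Q.1 V (algebraMap (SmoothOn n V) (N.Fn V) f)) := by
  change (bracket N _ Q ψ).1 V _ = _
  rw [bracket_apply, sgn_odd (by decide), neg_one_smul, sub_neg_eq_add,
    map_smooth_eq_zero (by norm_num), map_zero, zero_add]

/-- Since `ψ` kills smooth functions, `[Q,ψ]` acts on them by `f ↦ ψ(Qf)`, and `Qf` has degree one,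
so it expands in the `ξᵃ`. The coefficients of `ψ` enter only through their values at `p`, so the
anchor descends to the fibre (`fiberAnchor`). -/
theorem Frame.germZero_diffOne {U : Opens M} (F : Frame N U) (Q : vectorFields N 1)
    (ψ : vectorFields N (-1)) {p : M} (hp : p ∈ U) {V : Opens M} (hV : p ∈ V) (f : SmoothOn n V) :
    (germZero (diffOne Q ψ) p).toFun V hV f =
      ∑ a, F.coordsOne le_rfl (localRes (-1) le_top (vectorFieldsEquiv (-1) ψ)) (.inl a) ⟨p, hp⟩ *
        (F.germ Q hp a).toFun V hV f := by
  rw [← (germZero (diffOne Q ψ) p).map_res (inf_le_left : V ⊓ U ≤ V) (Opens.mem_inf.2 ⟨hV, hp⟩), germZero_apply,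
    diffOne_map_smooth]
  set g := algebraMap (SmoothOn n (V ⊓ U : Opens M)) (N.Fn (V ⊓ U)) (smoothRes n inf_le_left f)
  have hg : Q.1 _ g ∈ N.deg _ 1 := Q.2.2.1 _ 0 _ (smooth_mem_deg N _)
  set c : Fin r → SmoothOn n (V ⊓ U : Opens M) := fun a =>
    F.coordsOne inf_le_right (localRes (-1) le_top (vectorFieldsEquiv (-1) ψ)) (.inl a)
  have h : smoothPart (ψ.1 (V ⊓ U) (Q.1 _ g)) =
      ∑ a, c a * smoothPart (F.dξ (V ⊓ U) inf_le_right a (Q.1 _ g)) := by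
    refine smoothPart_eq ?_
    conv_rhs => rw [F.eq_sum (V ⊓ U) inf_le_right _ hg]
    rw [map_sum, map_sum]
    refine Finset.sum_congr rfl fun a _ => ?_
    have h1 := ((localRes (-1) le_top (vectorFieldsEquiv (-1) ψ)).2.2 (V ⊓ U)
      le_rfl).map_smooth_mul (by norm_num) (smoothPart (F.dξ (V ⊓ U) inf_le_right a (Q.1 _ g)))
      (F.ξ (V ⊓ U) inf_le_right a)
    rw [algebraMap_smoothPart (F.dξ_mem _ hg a)] at h1
    refine Eq.trans ?_ h1.symm
    rw [F.map_ξ, mul_comm, map_mul, algebraMap_smoothPart (F.dξ_mem _ hg a)]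
  rw [h, sum_smoothOn_apply]
  refine Finset.sum_congr rfl fun a _ => ?_
  have hc : c a = smoothRes n inf_le_right
      (F.coordsOne le_rfl (localRes (-1) le_top (vectorFieldsEquiv (-1) ψ)) (.inl a)) :=
    F.coordsOne_res le_rfl inf_le_right (localRes (-1) le_top (vectorFieldsEquiv (-1) ψ)) _
  rw [hc]
  rfl

variable [IsManifold (mdl n) ∞ M] {d : M → Opens M}

theorem GermDerivation.toTangent_eq_sum {ι : Type*} [Fintype ι] {p : M} {δ : GermDerivation n p}
    {δ' : ι → GermDerivation n p} {c : ι → ℝ}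
    (h : ∀ (V : Opens M) (hV : p ∈ V) (f : SmoothOn n V),
      δ.toFun V hV f = ∑ a, c a * (δ' a).toFun V hV f) :
    δ.toTangent = ∑ a, c a • (δ' a).toTangent := by
  have key : ∀ (v : ι → EuclideanSpace ℝ (Fin n)) (w : EuclideanSpace ℝ (Fin n)),
      (∀ i, w i = ∑ a, c a * v a i) → w = ∑ a, c a • v a := fun v w h => by
    ext i
    simp [h]
  exact key (fun a => (δ' a).toTangent) δ.toTangent fun i => h _ _ _

/-- The anchor on the fibres. -/
def fiberAnchor (F : ∀ x, Frame N (d x)) (hd : ∀ x, x ∈ d x) (Q : vectorFields N 1) (p : M) :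
    (frameOne F hd).bundle.Fib p →ₗ[ℝ] TangentSpace (mdl n) p :=
  ∑ a, (LinearMap.proj (.inl a) ∘ₗ
    ((frameOne F hd).fiberEquiv p).toLinearMap).smulRight ((F p).germ Q (hd p) a).toTangent

theorem fiberAnchor_secEquiv (F : ∀ x, Frame N (d x)) (hd : ∀ x, x ∈ d x) (Q : vectorFields N 1)
    (ψ : vectorFields N (-1)) (p : M) :
    fiberAnchor F hd Q p ((frameOne F hd).secEquiv ψ p) = (germZero (diffOne Q ψ) p).toTangent := by
  rw [GermDerivation.toTangent_eq_sum fun V hV f => (F p).germZero_diffOne Q ψ (hd p) hV f,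
    fiberAnchor, LinearMap.sum_apply]
  refine Finset.sum_congr rfl fun a _ => ?_
  change (frameOne F hd).fiberEquiv p ((frameOne F hd).secEquiv ψ p) (.inl a) •
    ((F p).germ Q (hd p) a).toTangent = _
  rw [FieldsFrame.fiberEquiv_secEquiv]
  rfl

theorem isSmoothAnchor_fiberAnchor (F : ∀ x, Frame N (d x)) (hd : ∀ x, x ∈ d x)
    (Q : vectorFields N 1) : IsSmoothAnchor (frameOne F hd).bundle (fiberAnchor F hd Q) := by
  intro σ
  obtain ⟨ψ, rfl⟩ := (frameOne F hd).secEquiv.surjective σ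
  simp only [fiberAnchor_secEquiv]
  exact contMDiff_germZero _

theorem dirDeriv_fiberAnchor (F : ∀ x, Frame N (d x)) (hd : ∀ x, x ∈ d x) (Q : vectorFields N 1)
    (ψ : vectorFields N (-1)) (f : SmoothFn n M) (x : M) :
    dirDeriv n f x (fiberAnchor F hd Q x ((frameOne F hd).secEquiv ψ x)) =
      anchorZero N rfl (diffOne Q ψ) f x := by
  rw [fiberAnchor_secEquiv, dirDeriv_germZero]

end Anchor

end QTwo

end

/-! ### The main theorem. -/

set_option synthInstance.maxHeartbeats 100000 in
theorem propositionp {n r s : ℕ} (hr : 0 < r) (hs : 0 < s) {M : Type u} [TopologicalSpace M]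
    [ChartedSpace (EuclideanSpace ℝ (Fin n)) M] [IsManifold (QTwo.mdl n) ∞ M] [T2Space M]
    [SecondCountableTopology M] (N : QTwo.N2Manifold.{u, v} n r s M)
    (Q : QTwo.vectorFields N 1)
    (hQ : QTwo.bracket N (show (1 : ℤ) + 1 = 2 by norm_num) Q Q = 0) :
    QTwo.IsStronglyAnchoredDGLA (R := QTwo.SmoothFn n M)
      (A := fun k : ℤ => QTwo.vectorFields N k) 0
      (fun {k l m} h => QTwo.bracket N (show k + l = m by rw [← h, add_zero]))
      (fun h => QTwo.dQ N Q h)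
      (fun {k} h => QTwo.anchorZero N (show k = 0 by rw [← h, add_zero])) ∧
    (∀ (f : QTwo.SmoothFn n M) (ψ φ : QTwo.vectorFields N (-1)),
      QTwo.bracket N (show (-1 : ℤ) + -1 = -2 by norm_num) ψ (f • φ) =
        f • QTwo.bracket N (show (-1 : ℤ) + -1 = -2 by norm_num) ψ φ) ∧
    ∃ (W V : QTwo.SmoothVectorBundle n M)
      (eW : QTwo.vectorFields N (-1) ≃ₗ[ℝ] QTwo.Sec W)
      (eV : QTwo.vectorFields N (-2) ≃ₗ[ℝ] QTwo.Sec V)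
      (ρ : ∀ x : M, W.Fib x →ₗ[ℝ] TangentSpace (QTwo.mdl n) x)
      (br : QTwo.Sec W →ₗ[ℝ] QTwo.Sec W →ₗ[ℝ] QTwo.Sec W)
      (pair : ∀ x : M, W.Fib x →ₗ[ℝ] W.Fib x →ₗ[ℝ] V.Fib x)
      (D : QTwo.Sec V →ₗ[ℝ] QTwo.Sec W)
      (conn : QTwo.Sec W →ₗ[ℝ] QTwo.Sec V →ₗ[ℝ] QTwo.Sec V),
      -- the identifications with spaces of sections are linear over the smooth functions
      (∀ f ψ, eW (f • ψ) = QTwo.fsmul f (eW ψ)) ∧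
      (∀ f v, eV (f • v) = QTwo.fsmul f (eV v)) ∧
      -- the anchor: `ρ(ψ)[f] = [Q, ψ](f)`
      (∀ ψ f x, QTwo.dirDeriv n f x (ρ x (eW ψ x)) =
        QTwo.anchorZero N rfl (QTwo.dQ N Q (show (-1 : ℤ) + 1 = 0 by norm_num) ψ) f x) ∧
      -- the derived bracket: `[φ, ψ]_W = [[Q, φ], ψ]`, with `[Q, φ] = [φ, Q]`
      (∀ φ ψ, br (eW φ) (eW ψ) = eW (QTwo.bracket N (show (0 : ℤ) + -1 = -1 by norm_num)
        (QTwo.dQ N Q (show (-1 : ℤ) + 1 = 0 by norm_num) φ) ψ)) ∧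
      -- the pairing: `⟨ψ, φ⟩ = [ψ, φ]`
      (∀ ψ φ x, pair x (eW ψ x) (eW φ x) =
        eV (QTwo.bracket N (show (-1 : ℤ) + -1 = -2 by norm_num) ψ φ) x) ∧
      -- the differential: `D v = [Q, v]`
      (∀ v, D (eV v) = eW (QTwo.dQ N Q (show (-2 : ℤ) + 1 = -1 by norm_num) v)) ∧
      -- the connection: `∇_ψ v = [[ψ, Q], v]`
      (∀ ψ v, conn (eW ψ) (eV v) = eV (QTwo.bracket N (show (0 : ℤ) + -2 = -2 by norm_num)
        (QTwo.bracket N (show (-1 : ℤ) + 1 = 0 by norm_num) ψ Q) v)) ∧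
      QTwo.IsVinogradovAlgebroid W V ρ br pair D conn ∧
      QTwo.IsVTwistedCourantAlgebroid W V ρ br pair conn ∧
      -- `D` is the adjoint of the connection
      ∀ (h : QTwo.IsInnerProduct W V pair) (ψ : QTwo.Sec W) (v : QTwo.Sec V),
        QTwo.secPair h ψ (D v) = conn ψ v := by
  refine ⟨QTwo.isStronglyAnchoredDGLA_vectorFields hQ,
    fun f ψ φ => QTwo.bracket_smul_right _ (by norm_num) f ψ φ, ?_⟩
  -- One choice of coordinates near each point yields the frames of both `W` and `V`, so that the
  -- pairing takes the form `pairCoord` on every fibre.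
  choose d hd hF using QTwo.exists_frame N
  let F : ∀ x, QTwo.Frame N (d x) := fun x => (hF x).some
  have hanchor := QTwo.isSmoothAnchor_fiberAnchor F hd Q
  have hinner := QTwo.isInnerProduct_fiberPairing F hd hr hs
  have heW := (QTwo.frameOne F hd).secEquiv_smul
  have heV := (QTwo.frameTwo F hd).secEquiv_smul
  have hρ := QTwo.dirDeriv_fiberAnchor F hd Q
  have hpair := QTwo.fiberPairing_secEquiv F hd
  exact ⟨(QTwo.frameOne F hd).bundle, (QTwo.frameTwo F hd).bundle, (QTwo.frameOne F hd).secEquiv,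
    (QTwo.frameTwo F hd).secEquiv, QTwo.fiberAnchor F hd Q,
    QTwo.secBracket (QTwo.frameOne F hd).secEquiv Q, QTwo.fiberPairing F hd,
    QTwo.secDiff (QTwo.frameOne F hd).secEquiv (QTwo.frameTwo F hd).secEquiv Q,
    QTwo.secConn (QTwo.frameOne F hd).secEquiv (QTwo.frameTwo F hd).secEquiv Q,
    heW, heV, hρ, QTwo.secBracket_apply, hpair, QTwo.secDiff_apply, QTwo.secConn_apply,
    QTwo.isVinogradovAlgebroid hQ heW heV hρ hpair hanchor hinner,
    QTwo.isVTwistedCourantAlgebroid hQ heW heV hρ hpair hanchor hinner,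
    QTwo.secPair_secDiff hpair⟩
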